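/- Let $M$ be a $C^\infty$ manifold of dimension $m$ (Hausdorff, second countable, without boundary), and let $\Lambda^*(M)$ be the algebra of smooth differential forms on $M$. A Poisson tensor is a smooth skew-symmetric contravariant 2-tensor field $h=(h^{ij})$ whose bracket $\{f,g\}=h^{ij}f_{x_i}g_{x_j}$ on $C^\infty(M)$ satisfies the Jacobi identity; at each point it is regarded as the linear map $h_x:T^*_xM\to T_xM$, $(h_x a)^i=h^{ij}(x)a_j$. For a smooth foliation of $M$ by $p$-dimensional leaves with tangent distribution $D\subset TM$, let $I\subset\Lambda^*(M)$ be the ideal generated by the smooth one-forms that vanish on all leaves. A 2-form $\Omega\in\Lambda^2(M)$ is called leafwise symplectic if its restriction to every leaf is closed and non-degenerate. A Poisson tensor $h$ is said to be defined by the foliation and $\Omega$ if $h_x(T^*_xM)=D_x$ for all $x$ and $h$ is inverse to $\Omega$ along the leaves, i.e. $\Omega_x(v,h_xa)=a(v)$ for all $x\in M$, $a\in T_x^*M$, $v\in D_x$. 1. Let $h$ be a Poisson tensor of constant rank $2n$. Then the images $D_x=h_x(T_x^*M)$ are the tangent spaces to the leaves of a (completely integrable) smooth foliation of $M$ by $2n$-dimensional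 leaves (the Casimir foliation), and this foliation is orientable (there is a smooth $2n$-form on $M$ restricting to a volume form on every leaf). Its ideal $I$ satisfies $dI\subset I$ and defines the foliation: $D_x$ is the common kernel of the one-forms in $I$. There is a leafwise symplectic $\Omega\in\Lambda^2(M)$ such that $h$ is the tensor defined by the foliation and $\Omega$, and $d\Omega\in I$. 2. Conversely, for every foliation of $M$ by $p$-dimensional leaves and every leafwise symplectic $\Omega\in\Lambda^2(M)$ there is exactly one Poisson tensor defined by the foliation and $\Omega$; it has constant rank $p$. 3. Let a foliation with ideal $I$ and a leafwise symplectic $\Omega\in\Lambda^2(M)$ be given, and let $\Omega'\in\Lambda^2(M)$. Then $\Omega'$ is leafwise symplectic for this foliation and defines the same Poisson tensor as $\Omega$ if and only if $\Omega'-\Omega\in I$. -/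

import Mathlib

open scoped Manifold ContDiff

noncomputable section

namespace PoissonFoliation

/-! ### Exterior product of alternating forms -/

section Wedge

variable {V : Type*} [AddCommGroup V] [Module ℝ V] [TopologicalSpace V]

/-- The multilinear map `(v₁, …, v_{k+l}) ↦ α (v₁, …, v_k) * β (v_{k+1}, …, v_{k+l})`. -/
def mulForms {k l : ℕ} (α : V [⋀^Fin k]→L[ℝ] ℝ) (β : V [⋀^Fin l]→L[ℝ] ℝ) :
    ContinuousMultilinearMap ℝ (fun _ : Fin (k + l) => V) ℝ where
  toMultilinearMap :=
    ((LinearMap.mul' ℝ ℝ).compMultilinearMap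
      (α.toMultilinearMap.domCoprod β.toMultilinearMap)).domDomCongr finSumFinEquiv
  cont := by
    have h : Continuous fun v : Fin (k + l) → V =>
        α (fun i => v (Fin.castAdd l i)) * β (fun i => v (Fin.natAdd k i)) :=
      (α.cont.comp (continuous_pi fun i => continuous_apply _)).mul
        (β.cont.comp (continuous_pi fun i => continuous_apply _))
    exact h

/-- The exterior product `α ∧ β = (1 / (k! l!)) ∑ σ, sign σ • (α ⊗ β) ∘ σ`. -/
def wedge {k l : ℕ} (α : V [⋀^Fin k]→L[ℝ] ℝ) (β : V [⋀^Fin l]→L[ℝ] ℝ) :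
    V [⋀^Fin (k + l)]→L[ℝ] ℝ :=
  ((k.factorial * l.factorial : ℝ)⁻¹) • (mulForms α β).alternatization

theorem wedge_apply {k l : ℕ} (α : V [⋀^Fin k]→L[ℝ] ℝ) (β : V [⋀^Fin l]→L[ℝ] ℝ)
    (v : Fin (k + l) → V) :
    wedge α β v = ((k.factorial * l.factorial : ℝ)⁻¹) *
      ∑ σ : Equiv.Perm (Fin (k + l)), ((Equiv.Perm.sign σ : ℤ) : ℝ) *
        (α (fun i => v (σ (Fin.castAdd l i))) * β (fun i => v (σ (Fin.natAdd k i)))) := by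
  have h : ∀ w : Fin (k + l) → V, mulForms α β w =
      α (fun i => w (Fin.castAdd l i)) * β (fun i => w (Fin.natAdd k i)) := fun _ => rfl
  simp only [wedge, ContinuousAlternatingMap.smul_apply,
    ContinuousMultilinearMap.alternatization_apply_apply, h, Function.comp_apply, smul_eq_mul,
    Units.smul_def, zsmul_eq_mul]

end Wedge

/-! ### Differential forms and bivector fields on a manifold of dimension `m` -/

section Manifold

variable {m : ℕ} {M : Type*} [TopologicalSpace M] [ChartedSpace (EuclideanSpace ℝ (Fin m)) M]

variable (m M) in
/-- A (not necessarily smooth) field of alternating `k`-forms on `M`. -/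
abbrev Form (k : ℕ) : Type _ := ∀ x : M, TangentSpace (𝓡 m) x [⋀^Fin k]→L[ℝ] ℝ

/-- The pullback of a form on `M` under a map from a Euclidean space, as a form on that space. -/
def pullbackForm {q k : ℕ} (f : EuclideanSpace ℝ (Fin q) → M) (θ : Form m M k) :
    EuclideanSpace ℝ (Fin q) → EuclideanSpace ℝ (Fin q) [⋀^Fin k]→L[ℝ] ℝ :=
  fun u => (θ (f u)).compContinuousLinearMap (mfderiv (𝓡 q) (𝓡 m) f u)

/-- The form `θ` written in the chart at `x₀`. -/
def chartForm {k : ℕ} (x₀ : M) (θ : Form m M k) :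
    EuclideanSpace ℝ (Fin m) → EuclideanSpace ℝ (Fin m) [⋀^Fin k]→L[ℝ] ℝ :=
  pullbackForm (extChartAt (𝓡 m) x₀).symm θ

/-- `θ` is a `C^∞` differential form: its expressions in charts are `C^∞`. -/
def SmoothForm {k : ℕ} (θ : Form m M k) : Prop :=
  ∀ x₀ : M, ContDiffOn ℝ ∞ (chartForm x₀ θ) (extChartAt (𝓡 m) x₀).target

/-- The exterior derivative, computed at `x` in the chart at `x`. -/
def extD {k : ℕ} (θ : Form m M k) : Form m M (k + 1) := fun x =>
  (extDeriv (chartForm x θ) (extChartAt (𝓡 m) x x)).compContinuousLinearMap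
    (mfderiv (𝓡 m) (𝓡 m) (extChartAt (𝓡 m) x) x)

/-- The exterior product of two fields of forms. -/
def wedgeForm {k l : ℕ} (α : Form m M k) (β : Form m M l) : Form m M (k + l) :=
  fun x => wedge (α x) (β x)

variable (m M) in
/-- A field of contravariant 2-tensors `h`, each written as the linear map
`T*ₓM → TₓM`, `α ↦ (h^{ij} α_j)_i`. -/
abbrev TwoTensor : Type _ :=
  ∀ x : M, (TangentSpace (𝓡 m) x →L[ℝ] ℝ) →L[ℝ] TangentSpace (𝓡 m) x

/-- `h` is `C^∞`: for all constant covectors `a`, `b` the function `h^{ij} a_i b_j` computed in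
the chart at any `x₀` is `C^∞`. -/
def SmoothTensor (h : TwoTensor m M) : Prop :=
  ∀ (x₀ : M) (a b : EuclideanSpace ℝ (Fin m) →L[ℝ] ℝ),
    ContDiffOn ℝ ∞ (fun y : EuclideanSpace ℝ (Fin m) =>
      let x : M := (extChartAt (𝓡 m) x₀).symm y
      let A : TangentSpace (𝓡 m) x →L[ℝ] EuclideanSpace ℝ (Fin m) :=
        mfderiv (𝓡 m) (𝓡 m) (extChartAt (𝓡 m) x₀) x
      a (A (h x (b ∘L A)))) (extChartAt (𝓡 m) x₀).target

/-- The differential of a function as a covector. -/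
def dFun (f : M → ℝ) (x : M) : TangentSpace (𝓡 m) x →L[ℝ] ℝ :=
  mfderiv (𝓡 m) 𝓘(ℝ, ℝ) f x

/-- The bracket `{f, g} = h^{ij} f_{x_i} g_{x_j}`. -/
def bracket (h : TwoTensor m M) (f g : M → ℝ) : M → ℝ :=
  fun x => dFun (m := m) f x (h x (dFun g x))

/-- `h` is a Poisson tensor: smooth, skew-symmetric, and its bracket satisfies the Jacobi
identity on `C^∞(M)`. -/
structure IsPoisson (h : TwoTensor m M) : Prop where
  smooth : SmoothTensor h
  skew : ∀ (x : M) (a b : TangentSpace (𝓡 m) x →L[ℝ] ℝ), a (h x b) = -b (h x a)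
  jacobi : ∀ f g l : M → ℝ, ContMDiff (𝓡 m) 𝓘(ℝ, ℝ) ∞ f → ContMDiff (𝓡 m) 𝓘(ℝ, ℝ) ∞ g →
    ContMDiff (𝓡 m) 𝓘(ℝ, ℝ) ∞ l → ∀ x : M,
      bracket h (bracket h f g) l x + bracket h (bracket h g l) f x
        + bracket h (bracket h l f) g x = 0

/-- The rank of `h` is `r` at every point. -/
def HasConstRank (h : TwoTensor m M) (r : ℕ) : Prop :=
  ∀ x : M, Module.finrank ℝ (LinearMap.range (h x).toLinearMap) = r

variable (m M) in
/-- A field of tangent subspaces. -/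
abbrev Distribution : Type _ := ∀ x : M, Submodule ℝ (TangentSpace (𝓡 m) x)

/-- The characteristic distribution of `h`: at `x` it is the image of `h x`, which is spanned by
the Hamiltonian vectors (equivalently, for skew `h`, the annihilator of the kernel of `h x`). -/
def casimirDistribution (h : TwoTensor m M) : Distribution m M :=
  fun x => LinearMap.range (h x).toLinearMap

/-- `D` is the field of tangent spaces to the leaves of a (completely integrable) `C^∞` foliation
with leaves of dimension `p`: near every point there is a foliated chart of the smooth structure,
in which the leaves are the parallel translates of a `p`-dimensional linear subspace `W`. -/
def IsFoliation (p : ℕ) (D : Distribution m M) : Prop :=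
  ∀ x : M, ∃ φ ∈ IsManifold.maximalAtlas (𝓡 m) ∞ M, x ∈ φ.source ∧
    ∃ W : Submodule ℝ (EuclideanSpace ℝ (Fin m)), Module.finrank ℝ W = p ∧
      ∀ y ∈ φ.source, ∀ v : TangentSpace (𝓡 m) y,
        v ∈ D y ↔ (mfderiv (𝓡 m) (𝓡 m) φ y v : EuclideanSpace ℝ (Fin m)) ∈ W

/-- The form `θ` vanishes on the leaves. -/
def VanishesOn {k : ℕ} (D : Distribution m M) (θ : Form m M k) : Prop :=
  ∀ (x : M) (v : Fin k → TangentSpace (𝓡 m) x), (∀ i, v i ∈ D x) → θ x v = 0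

/-- The foliation is orientable: there is a smooth `p`-form on `M` whose restriction to the
`p`-dimensional leaves is a volume form, i.e. is nowhere zero. -/
def IsOrientable (p : ℕ) (D : Distribution m M) : Prop :=
  ∃ μ : Form m M p, SmoothForm μ ∧
    ∀ x : M, ∃ v : Fin p → TangentSpace (𝓡 m) x, (∀ i, v i ∈ D x) ∧ μ x v ≠ 0

/-- The ideal `I` of the exterior algebra `Λ*(M)` of smooth forms that is generated by the
smooth one-forms vanishing on the leaves, given through its homogeneous components. As
`θ ∧ β = ± β ∧ θ`, its elements are the finite sums `∑ αᵢ ∧ θᵢ` with `θᵢ` such one-forms; in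
degree `0` there is only the zero function. -/
def foliationIdeal (D : Distribution m M) : (k : ℕ) → Submodule ℝ (Form m M k)
  | 0 => ⊥
  | k + 1 => Submodule.span ℝ {η : Form m M (k + 1) | ∃ (α : Form m M k) (θ : Form m M 1),
      SmoothForm α ∧ SmoothForm θ ∧ VanishesOn D θ ∧ η = wedgeForm α θ}

/-- The family `J` of spaces of smooth forms is a (two-sided, homogeneous) ideal of `Λ*(M)` with
`dJ ⊆ J`. -/
structure IsDifferentialIdeal (J : (k : ℕ) → Submodule ℝ (Form m M k)) : Prop where
  smooth : ∀ k, ∀ η ∈ J k, SmoothForm η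
  wedge_left : ∀ (k l : ℕ) (α : Form m M k), SmoothForm α → ∀ η ∈ J l,
    wedgeForm α η ∈ J (k + l)
  wedge_right : ∀ (k l : ℕ) (α : Form m M l), SmoothForm α → ∀ η ∈ J k,
    wedgeForm η α ∈ J (k + l)
  extD_mem : ∀ k, ∀ η ∈ J k, extD η ∈ J (k + 1)

/-- `f` is a smooth parametrization, by an open subset `U` of `ℝᵖ`, of a (immersed) piece of a
`p`-dimensional leaf. -/
structure IsLeafPatch (p : ℕ) (D : Distribution m M) (U : Set (EuclideanSpace ℝ (Fin p)))
    (f : EuclideanSpace ℝ (Fin p) → M) : Prop where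
  isOpen : IsOpen U
  smooth : ContMDiffOn (𝓡 p) (𝓡 m) ∞ f U
  injective : ∀ u ∈ U, Function.Injective (mfderiv (𝓡 p) (𝓡 m) f u)
  range_eq : ∀ u ∈ U, LinearMap.range (mfderiv (𝓡 p) (𝓡 m) f u).toLinearMap = D (f u)

/-- The restriction of `θ` to every leaf is closed: in local parametrizations of the leaves the
exterior derivative of the restriction is zero. -/
def LeafwiseClosed (p : ℕ) {k : ℕ} (D : Distribution m M) (θ : Form m M k) : Prop :=
  ∀ (U : Set (EuclideanSpace ℝ (Fin p))) (f : EuclideanSpace ℝ (Fin p) → M),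
    IsLeafPatch p D U f → ∀ u ∈ U, extDeriv (pullbackForm f θ) u = 0

/-- The restriction of the 2-form `Ω` to every leaf is non-degenerate. -/
def LeafwiseNondegenerate (D : Distribution m M) (Ω : Form m M 2) : Prop :=
  ∀ x : M, ∀ v ∈ D x, (∀ w ∈ D x, Ω x ![v, w] = 0) → v = 0

/-- `Ω` is a smooth 2-form on `M` that is closed and non-degenerate on every leaf. -/
structure IsLeafwiseSymplectic (p : ℕ) (D : Distribution m M) (Ω : Form m M 2) : Prop where
  smooth : SmoothForm Ω
  closed : LeafwiseClosed p D Ω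
  nondegenerate : LeafwiseNondegenerate D Ω

/-- `h` is the tensor defined by the foliation and the 2-form `Ω`: the image of `h` is tangent
to the leaves, and along the leaves `h` is inverse to `Ω` (`Ω_{ij} h^{jk} = δ_i^k`), i.e.
`Ω (v, h a) = a v` for `v` tangent to a leaf. -/
structure IsTensorOf (D : Distribution m M) (Ω : Form m M 2) (h : TwoTensor m M) : Prop where
  range_eq : casimirDistribution h = D
  inverse : ∀ (x : M) (a : TangentSpace (𝓡 m) x →L[ℝ] ℝ), ∀ v ∈ D x, Ω x ![v, h x a] = a v

end Manifold

end PoissonFoliation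

end

open PoissonFoliation

set_option linter.unusedSectionVars false

namespace PoissonFoliation
open Set Filter Topology IsManifold

local notation "𝔼" n:max => EuclideanSpace ℝ (Fin n)

/-! ### Smoothness of maps into spaces of alternating forms -/

section Eval

variable {F V : Type*} [NormedAddCommGroup F] [NormedSpace ℝ F] [NormedAddCommGroup V]
  [NormedSpace ℝ V] [FiniteDimensional ℝ V]

/-! In a chart, a Poisson tensor is a smooth family `H` of skew linear maps from covectors to
vectors. The second derivatives in the Jacobi identity cancel (`jacobi_eq_jacobiator`), and every
covector is the differential of a global smooth function (`exists_contMDiff_fderiv_eq`), so the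
Jacobi identity amounts to the vanishing of the first-order expression `jacobiator H`. This
expression plays two roles. Its vanishing keeps the brackets of the fields `H b` and `H c` in the
image of `H` (`hamiltonian_bracket_mem_range`). And in a foliated chart, where the image is a fixed
subspace, it equals up to sign the value of `dΩ` on vectors `H c, H b, H a`, for any `Ω` inverse to
`H` along that subspace (`extDeriv_eq_neg_jacobiator`). Hence closedness of `Ω` on the leaves and
the Jacobi identity are the same condition.

Foliated charts come from Frobenius' theorem. Constant rank makes the image of `H` locally the graph
of a family of linear maps `F` over its value at the base point, and the bracket condition becomes a
symmetry of the derivative of `F` along the graph (`fderiv_frame_symm`). The leaves are found by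
integrating along rays from the base point. Smooth dependence on direction and initial value is the
implicit function theorem in a Banach space of curves (`exists_smooth_rays`), and uniqueness for the
variational equation shows that the surfaces so obtained are tangent to the distribution
(`deriv_rays_eq`).

The ideal `I` consists exactly of the smooth forms that vanish on the leaves
(`IsFoliation.mem_foliationIdeal_iff`). With this, `dI ⊂ I`, `dΩ ∈ I` and the comparison of `Ω` with
`Ω'` all become statements about restrictions to leaves. As members of `I` are finite sums, finitely
many global one-forms must cut out the foliation: a general position argument reduces a locally
finite sequence to `2m + 1` combinations (`exists_finite_combinations`). A form vanishing on the
leaves is then decomposed locally, and the coefficients are glued by a partition of unity.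

Between `h` and `Ω` there is linear algebra with smooth parameters. Given `h`, its local inverses
satisfy an affine condition and glue to a global `Ω`; given `Ω`, nondegeneracy determines `h`
pointwise, and inversion in a foliated chart shows that it is smooth. The orientation is the
Liouville form, a multiple of the `n`-th power of `Ω`, which is nonzero on symplectic bases of the
leaves. -/

/-- The values of an alternating form on the vectors of a basis. -/
noncomputable def basisValues (V : Type*) [NormedAddCommGroup V] [NormedSpace ℝ V] [FiniteDimensional ℝ V]
    (k : ℕ) : (V [⋀^Fin k]→L[ℝ] ℝ) →ₗ[ℝ] ((Fin k → Fin (Module.finrank ℝ V)) → ℝ) where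
  toFun η s := η fun i => Module.finBasis ℝ V (s i)
  map_add' _ _ := rfl
  map_smul' _ _ := rfl

theorem basisValues_injective (k : ℕ) : Function.Injective (basisValues V k) := by
  intro a c hac
  have : a.toAlternatingMap = c.toAlternatingMap :=
    Module.Basis.ext_alternating (Module.finBasis ℝ V) fun s _ => congrFun hac s
  ext v
  exact congrArg (fun η : V [⋀^Fin k]→ₗ[ℝ] ℝ => η v) this

/-- A map into the space of alternating forms is smooth when its values on constant vectors are. -/
theorem contDiffAt_alternating_iff {k : ℕ} {η : F → V [⋀^Fin k]→L[ℝ] ℝ} {n : WithTop ℕ∞} {y : F} :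
    ContDiffAt ℝ n η y ↔ ∀ v : Fin k → V, ContDiffAt ℝ n (fun y => η y v) y := by
  constructor
  · intro h v
    exact (ContinuousAlternatingMap.apply ℝ V ℝ v).contDiff.contDiffAt.comp y h
  · intro h
    obtain ⟨L, hL⟩ := (basisValues V k).exists_leftInverse_of_injective
      (LinearMap.ker_eq_bot.2 (basisValues_injective k))
    have h1 : ContDiffAt ℝ n (fun y => basisValues V k (η y)) y :=
      contDiffAt_pi.2 fun s => h fun i => Module.finBasis ℝ V (s i)
    have h2 : η = fun y => L.toContinuousLinearMap (basisValues V k (η y)) := by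
      funext y
      exact (congrArg (fun T : (V [⋀^Fin k]→L[ℝ] ℝ) →ₗ[ℝ] _ => T (η y)) hL).symm
    rw [h2]
    exact L.toContinuousLinearMap.contDiff.contDiffAt.comp y h1

/-- Smooth maps can be inserted into a smooth family of alternating forms. -/
theorem ContDiffAt.alternating_apply {k : ℕ} {η : F → V [⋀^Fin k]→L[ℝ] ℝ} {n : WithTop ℕ∞} {y : F}
    {v : F → Fin k → V} (hη : ContDiffAt ℝ n η y) (hv : ∀ i, ContDiffAt ℝ n (fun y => v y i) y) :
    ContDiffAt ℝ n (fun y => η y (v y)) y := by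
  let b := Module.finBasis ℝ V
  have h : (fun y => η y (v y)) = fun y => ∑ s : Fin k → Fin (Module.finrank ℝ V),
      (∏ i, b.repr (v y i) (s i)) * η y (fun i => b (s i)) := by
    funext y
    have : v y = fun i => ∑ j, b.repr (v y i) j • b j := funext fun i => (b.sum_repr _).symm
    conv_lhs => rw [this]
    have h2 := (η y).toMultilinearMap.map_sum (fun i j => b.repr (v y i) j • b j)
    refine h2.trans (Finset.sum_congr rfl fun s _ => ?_)
    exact (η y).toMultilinearMap.map_smul_univ _ _
  rw [h]
  refine ContDiffAt.sum fun s _ => (contDiffAt_prod fun i _ => ?_).mul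
    (contDiffAt_alternating_iff.1 hη _)
  exact (b.coord (s i)).toContinuousLinearMap.contDiff.contDiffAt.comp y (hv i)

end Eval

/-! ### Charts and pullbacks -/

theorem two_le_infty : (2 : WithTop ℕ∞) ≤ ∞ := by exact ENat.LEInfty.out


section Charts

variable {m : ℕ} {M : Type*} [TopologicalSpace M] [ChartedSpace (EuclideanSpace ℝ (Fin m)) M]
  [IsManifold (𝓡 m) ∞ M]

theorem mdifferentiable_of_mem_atlas_top {φ : OpenPartialHomeomorph M (𝔼 m)}
    (hφ : φ ∈ maximalAtlas (𝓡 m) ∞ M) : φ.MDifferentiable (𝓡 m) (𝓡 m) :=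
  ⟨(contMDiffOn_of_mem_maximalAtlas hφ).mdifferentiableOn (by simp),
    (contMDiffOn_symm_of_mem_maximalAtlas hφ).mdifferentiableOn (by simp)⟩

theorem mfderiv_symm_mfderiv {φ : OpenPartialHomeomorph M (𝔼 m)}
    (hφ : φ ∈ maximalAtlas (𝓡 m) ∞ M) {x : M} (hx : x ∈ φ.source) (v : TangentSpace (𝓡 m) x) :
    mfderiv (𝓡 m) (𝓡 m) φ.symm (φ x) (mfderiv (𝓡 m) (𝓡 m) φ x v) = v :=
  congrArg (fun L : TangentSpace (𝓡 m) x →L[ℝ] TangentSpace (𝓡 m) x => L v)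
    ((mdifferentiable_of_mem_atlas_top hφ).symm_comp_deriv hx)

theorem mfderiv_mfderiv_symm {φ : OpenPartialHomeomorph M (𝔼 m)}
    (hφ : φ ∈ maximalAtlas (𝓡 m) ∞ M) {y : 𝔼 m} (hy : y ∈ φ.target) (v : 𝔼 m) :
    mfderiv (𝓡 m) (𝓡 m) φ (φ.symm y) (mfderiv (𝓡 m) (𝓡 m) φ.symm y v) = v :=
  congrArg (fun L : 𝔼 m →L[ℝ] 𝔼 m => L v)
    ((mdifferentiable_of_mem_atlas_top hφ).comp_symm_deriv hy)

theorem mfderiv_chart_comp {q : ℕ} {φ : OpenPartialHomeomorph M (𝔼 m)}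
    (hφ : φ ∈ maximalAtlas (𝓡 m) ∞ M) {f : 𝔼 q → M} {u : 𝔼 q} (hu : f u ∈ φ.source)
    (hf : MDifferentiableAt (𝓡 q) (𝓡 m) f u) (v : 𝔼 q) :
    fderiv ℝ (φ ∘ f) u v
      = mfderiv (𝓡 m) (𝓡 m) φ (f u) (mfderiv (𝓡 q) (𝓡 m) f u v) := by
  have h := mfderiv_comp (I := 𝓡 q) (I' := 𝓡 m) (I'' := 𝓡 m) u
    ((mdifferentiable_of_mem_atlas_top hφ).mdifferentiableAt hu) hf
  rw [← mfderiv_eq_fderiv]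
  exact congrArg (fun L : 𝔼 q →L[ℝ] 𝔼 m => L v) h

theorem mfderiv_eq_symm_comp {q : ℕ} {φ : OpenPartialHomeomorph M (𝔼 m)}
    (hφ : φ ∈ maximalAtlas (𝓡 m) ∞ M) {f : 𝔼 q → M} {u : 𝔼 q} (hu : f u ∈ φ.source)
    (hf : MDifferentiableAt (𝓡 q) (𝓡 m) f u) (v : 𝔼 q) :
    mfderiv (𝓡 q) (𝓡 m) f u v
      = mfderiv (𝓡 m) (𝓡 m) φ.symm (φ (f u)) (fderiv ℝ (φ ∘ f) u v) := by
  rw [mfderiv_chart_comp hφ hu hf]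
  exact (mfderiv_symm_mfderiv hφ hu _).symm

theorem contDiffAt_chart_comp {q : ℕ} {φ : OpenPartialHomeomorph M (𝔼 m)}
    (hφ : φ ∈ maximalAtlas (𝓡 m) ∞ M) {f : 𝔼 q → M} {u : 𝔼 q} (hu : f u ∈ φ.source)
    (hf : ContMDiffAt (𝓡 q) (𝓡 m) ∞ f u) : ContDiffAt ℝ ∞ (φ ∘ f) u := by
  rw [← contMDiffAt_iff_contDiffAt]
  exact ((contMDiffOn_of_mem_maximalAtlas hφ).contMDiffAt (φ.open_source.mem_nhds hu)).comp u hf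

theorem contMDiffAt_chart_symm {φ : OpenPartialHomeomorph M (𝔼 m)}
    (hφ : φ ∈ maximalAtlas (𝓡 m) ∞ M) {y : 𝔼 m} (hy : y ∈ φ.target) :
    ContMDiffAt (𝓡 m) (𝓡 m) ∞ φ.symm y :=
  (contMDiffOn_symm_of_mem_maximalAtlas hφ).contMDiffAt (φ.open_target.mem_nhds hy)

theorem contMDiffAt_chart {φ : OpenPartialHomeomorph M (𝔼 m)}
    (hφ : φ ∈ maximalAtlas (𝓡 m) ∞ M) {x : M} (hx : x ∈ φ.source) :
    ContMDiffAt (𝓡 m) (𝓡 m) ∞ φ x :=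
  (contMDiffOn_of_mem_maximalAtlas hφ).contMDiffAt (φ.open_source.mem_nhds hx)

/-- By the chain rule a pullback factors through any chart, which reduces smoothness and exterior
derivatives of pullbacks to Euclidean statements. -/
theorem pullbackForm_eq_comp {q k : ℕ} {φ : OpenPartialHomeomorph M (𝔼 m)}
    (hφ : φ ∈ maximalAtlas (𝓡 m) ∞ M) (θ : Form m M k) {f : 𝔼 q → M} {u : 𝔼 q}
    (hu : f u ∈ φ.source) (hf : MDifferentiableAt (𝓡 q) (𝓡 m) f u) :
    pullbackForm f θ u
      = (pullbackForm φ.symm θ (φ (f u))).compContinuousLinearMap (fderiv ℝ (φ ∘ f) u) := by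
  ext v
  have h : ∀ i, mfderiv (𝓡 q) (𝓡 m) f u (v i)
      = mfderiv (𝓡 m) (𝓡 m) φ.symm (φ (f u)) (fderiv ℝ (φ ∘ f) u (v i)) := fun i =>
    mfderiv_eq_symm_comp hφ hu hf (v i)
  change θ (f u) (fun i => mfderiv (𝓡 q) (𝓡 m) f u (v i)) = θ (φ.symm (φ (f u)))
    (fun i => mfderiv (𝓡 m) (𝓡 m) φ.symm (φ (f u)) (fderiv ℝ (φ ∘ f) u (v i)))
  rw [funext h, φ.left_inv hu]

theorem pullbackForm_eventuallyEq_comp {q k : ℕ} {φ : OpenPartialHomeomorph M (𝔼 m)}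
    (hφ : φ ∈ maximalAtlas (𝓡 m) ∞ M) (θ : Form m M k) {f : 𝔼 q → M} {u : 𝔼 q}
    (hu : f u ∈ φ.source) (hf : ContMDiffAt (𝓡 q) (𝓡 m) ∞ f u) :
    pullbackForm f θ =ᶠ[𝓝 u] fun u' => (pullbackForm φ.symm θ ((φ ∘ f) u')).compContinuousLinearMap
      (fderiv ℝ (φ ∘ f) u') := by
  have h1 : ∀ᶠ u' in 𝓝 u, ContMDiffAt (𝓡 q) (𝓡 m) 1 f u' :=
    (contMDiffAt_iff_contMDiffAt_nhds (by simp)).1 (hf.of_le (by exact_mod_cast le_top))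
  filter_upwards [h1, hf.continuousAt.preimage_mem_nhds (φ.open_source.mem_nhds hu)] with u' h h'
  exact pullbackForm_eq_comp hφ θ h' (h.mdifferentiableAt (by simp))

theorem chartForm_eq {k : ℕ} (x₀ : M) (θ : Form m M k) :
    chartForm x₀ θ = pullbackForm (chartAt (𝔼 m) x₀).symm θ := rfl

theorem smoothForm_iff_chartAt {k : ℕ} {θ : Form m M k} :
    SmoothForm θ ↔ ∀ x₀ : M, ContDiffOn ℝ ∞ (pullbackForm (chartAt (𝔼 m) x₀).symm θ)
      (chartAt (𝔼 m) x₀).target := by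
  simp [SmoothForm, chartForm_eq, mfld_simps]

/-- The pullback of a form that is smooth in one chart is smooth. -/
theorem contDiffAt_pullbackForm {q k : ℕ} {φ : OpenPartialHomeomorph M (𝔼 m)}
    (hφ : φ ∈ maximalAtlas (𝓡 m) ∞ M) {θ : Form m M k} {f : 𝔼 q → M} {u : 𝔼 q}
    (hu : f u ∈ φ.source) (hf : ContMDiffAt (𝓡 q) (𝓡 m) ∞ f u)
    (hθ : ContDiffAt ℝ ∞ (pullbackForm φ.symm θ) (φ (f u))) :
    ContDiffAt ℝ ∞ (pullbackForm f θ) u := by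
  refine ContDiffAt.congr_of_eventuallyEq ?_ (pullbackForm_eventuallyEq_comp hφ θ hu hf)
  have h1 := contDiffAt_chart_comp hφ hu hf
  have h2 : ContDiffAt ℝ ∞ (fderiv ℝ (φ ∘ f)) u := h1.fderiv_right (by simp)
  refine contDiffAt_alternating_iff.2 fun v => ?_
  exact ContDiffAt.alternating_apply (η := fun u' => pullbackForm φ.symm θ ((φ ∘ f) u'))
    (v := fun u' i => fderiv ℝ (φ ∘ f) u' (v i)) (ContDiffAt.comp (g := pullbackForm φ.symm θ) u hθ h1)
    fun i => h2.clm_apply contDiffAt_const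

/-- Any chart of the maximal atlas may serve around a given point, since passing to a preferred
chart is again a pullback by a smooth map. -/
theorem smoothForm_of_local {k : ℕ} {θ : Form m M k}
    (h : ∀ x : M, ∃ φ ∈ maximalAtlas (𝓡 m) ∞ M, x ∈ φ.source ∧
      ContDiffAt ℝ ∞ (pullbackForm φ.symm θ) (φ x)) : SmoothForm θ := by
  rw [smoothForm_iff_chartAt]
  intro x₀ y hy
  obtain ⟨φ, hφ, hx, hθ⟩ := h ((chartAt (𝔼 m) x₀).symm y)
  exact (contDiffAt_pullbackForm hφ hx
    (contMDiffAt_chart_symm (chart_mem_maximalAtlas x₀) hy) hθ).contDiffWithinAt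

theorem SmoothForm.contDiffAt_pullbackForm {q k : ℕ} {θ : Form m M k} (hθ : SmoothForm θ)
    {f : 𝔼 q → M} {u : 𝔼 q} (hf : ContMDiffAt (𝓡 q) (𝓡 m) ∞ f u) :
    ContDiffAt ℝ ∞ (pullbackForm f θ) u := by
  have hs := mem_chart_source (𝔼 m) (f u)
  exact PoissonFoliation.contDiffAt_pullbackForm (chart_mem_maximalAtlas (f u)) hs hf
    ((smoothForm_iff_chartAt.1 hθ (f u)).contDiffAt
      ((chartAt (𝔼 m) (f u)).open_target.mem_nhds ((chartAt (𝔼 m) (f u)).map_source hs)))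

theorem SmoothForm.contDiffOn_chart {k : ℕ} {θ : Form m M k} (hθ : SmoothForm θ)
    {φ : OpenPartialHomeomorph M (𝔼 m)} (hφ : φ ∈ maximalAtlas (𝓡 m) ∞ M) :
    ContDiffOn ℝ ∞ (pullbackForm φ.symm θ) φ.target := fun _ hy =>
  (hθ.contDiffAt_pullbackForm (contMDiffAt_chart_symm hφ hy)).contDiffWithinAt

/-- The exterior derivative commutes with pullbacks. -/
theorem SmoothForm.pullbackForm_extD {q k : ℕ} {θ : Form m M k} (hθ : SmoothForm θ)
    {f : 𝔼 q → M} {u : 𝔼 q} (hf : ContMDiffAt (𝓡 q) (𝓡 m) ∞ f u) :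
    pullbackForm f (extD θ) u = extDeriv (pullbackForm f θ) u := by
  have hs := mem_chart_source (𝔼 m) (f u)
  have hm := chart_mem_maximalAtlas (I := 𝓡 m) (n := ∞) (f u)
  rw [(pullbackForm_eventuallyEq_comp hm θ hs hf).extDeriv_eq,
    extDeriv_pullback (r := ∞) _ (contDiffAt_chart_comp hm hs hf) (by simpa using two_le_infty)]
  · ext v
    change extDeriv (chartForm (f u) θ) (chartAt (𝔼 m) (f u) (f u))
      (fun i => mfderiv (𝓡 m) (𝓡 m) (chartAt (𝔼 m) (f u)) (f u) (mfderiv (𝓡 q) (𝓡 m) f u (v i)))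
      = extDeriv (chartForm (f u) θ) (chartAt (𝔼 m) (f u) (f u)) _
    congr 1
    funext i
    exact (mfderiv_chart_comp hm hs (hf.mdifferentiableAt (by simp)) (v i)).symm
  · have := (hθ.contDiffOn_chart hm).contDiffAt
      ((chartAt (𝔼 m) (f u)).open_target.mem_nhds ((chartAt (𝔼 m) (f u)).map_source hs))
    exact this.differentiableAt (by simp)

/-- Evaluation of a form in terms of a chart. -/
theorem form_apply_eq_pullbackForm {k : ℕ} {φ : OpenPartialHomeomorph M (𝔼 m)}
    (hφ : φ ∈ maximalAtlas (𝓡 m) ∞ M) (θ : Form m M k) {x : M} (hx : x ∈ φ.source)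
    (v : Fin k → TangentSpace (𝓡 m) x) :
    θ x v = pullbackForm φ.symm θ (φ x) (fun i => mfderiv (𝓡 m) (𝓡 m) φ x (v i)) := by
  change θ x v = θ (φ.symm (φ x)) (fun i => mfderiv (𝓡 m) (𝓡 m) φ.symm (φ x)
    (mfderiv (𝓡 m) (𝓡 m) φ x (v i)))
  rw [show (fun i => mfderiv (𝓡 m) (𝓡 m) φ.symm (φ x) (mfderiv (𝓡 m) (𝓡 m) φ x (v i))) = v from
    funext fun i => mfderiv_symm_mfderiv hφ hx (v i), φ.left_inv hx]

/-- The derivative of a chart, with values in the model space. -/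
noncomputable def chartDeriv (φ : OpenPartialHomeomorph M (𝔼 m)) (x : M) :
    TangentSpace (𝓡 m) x →L[ℝ] 𝔼 m := mfderiv (𝓡 m) (𝓡 m) φ x

/-- The inverse of the derivative of a chart. -/
noncomputable def chartDerivInv (φ : OpenPartialHomeomorph M (𝔼 m)) (x : M) :
    𝔼 m →L[ℝ] TangentSpace (𝓡 m) x := mfderiv (𝓡 m) (𝓡 m) φ.symm (φ x)

theorem chartDerivInv_chartDeriv {φ : OpenPartialHomeomorph M (𝔼 m)}
    (hφ : φ ∈ maximalAtlas (𝓡 m) ∞ M) {x : M} (hx : x ∈ φ.source) (v : TangentSpace (𝓡 m) x) :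
    chartDerivInv φ x (chartDeriv φ x v) = v := mfderiv_symm_mfderiv hφ hx v

theorem chartDeriv_chartDerivInv {φ : OpenPartialHomeomorph M (𝔼 m)}
    (hφ : φ ∈ maximalAtlas (𝓡 m) ∞ M) {x : M} (hx : x ∈ φ.source) (v : 𝔼 m) :
    chartDeriv φ x (chartDerivInv φ x v) = v := by
  have h := mfderiv_mfderiv_symm hφ (φ.map_source hx) v
  rw [φ.left_inv hx] at h
  exact h

theorem form_apply_eq {k : ℕ} {φ : OpenPartialHomeomorph M (𝔼 m)}
    (hφ : φ ∈ maximalAtlas (𝓡 m) ∞ M) (θ : Form m M k) {x : M} (hx : x ∈ φ.source)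
    (v : Fin k → TangentSpace (𝓡 m) x) :
    θ x v = pullbackForm φ.symm θ (φ x) (fun i => chartDeriv φ x (v i)) :=
  form_apply_eq_pullbackForm hφ θ hx v

/-- `extD` uses a different chart at each point; naturality shows that near `x` all these choices
agree with `extDeriv` in the single chart at `x`. -/
theorem smoothForm_extD {k : ℕ} {θ : Form m M k} (hθ : SmoothForm θ) : SmoothForm (extD θ) := by
  refine smoothForm_of_local fun x => ⟨chartAt (𝔼 m) x, chart_mem_maximalAtlas x,
    mem_chart_source _ x, ?_⟩
  have hm := chart_mem_maximalAtlas (I := 𝓡 m) (n := ∞) x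
  have ht := (chartAt (𝔼 m) x).open_target.mem_nhds
    ((chartAt (𝔼 m) x).map_source (mem_chart_source _ x))
  have h : pullbackForm (chartAt (𝔼 m) x).symm (extD θ) =ᶠ[𝓝 (chartAt (𝔼 m) x x)]
      extDeriv (pullbackForm (chartAt (𝔼 m) x).symm θ) := by
    filter_upwards [ht] with y hy
    exact hθ.pullbackForm_extD (contMDiffAt_chart_symm hm hy)
  refine ContDiffAt.congr_of_eventuallyEq ?_ h
  have h2 := ((hθ.contDiffOn_chart hm).contDiffAt ht).fderiv_right (m := ∞) (by simp)
  exact (ContinuousAlternatingMap.alternatizeUncurryFinCLM ℝ (𝔼 m) ℝ).contDiff.contDiffAt.comp _ h2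

end Charts

/-! ### Algebra of smooth forms and gluing by partitions of unity -/

section Forms

variable {m : ℕ} {M : Type*} [TopologicalSpace M] [ChartedSpace (EuclideanSpace ℝ (Fin m)) M]
  [IsManifold (𝓡 m) ∞ M]

theorem wedge_compContinuousLinearMap {V V' : Type*} [AddCommGroup V] [Module ℝ V]
    [TopologicalSpace V] [AddCommGroup V'] [Module ℝ V'] [TopologicalSpace V'] {k l : ℕ}
    (α : V [⋀^Fin k]→L[ℝ] ℝ) (β : V [⋀^Fin l]→L[ℝ] ℝ) (L : V' →L[ℝ] V) :
    wedge (α.compContinuousLinearMap L) (β.compContinuousLinearMap L)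
      = (wedge α β).compContinuousLinearMap L := by
  ext v
  rw [ContinuousAlternatingMap.compContinuousLinearMap_apply, wedge_apply, wedge_apply]
  rfl

theorem pullbackForm_wedgeForm {q k l : ℕ} (f : 𝔼 q → M) (α : Form m M k) (β : Form m M l)
    (u : 𝔼 q) :
    pullbackForm f (wedgeForm α β) u = wedge (pullbackForm f α u) (pullbackForm f β u) :=
  (wedge_compContinuousLinearMap _ _ _).symm

theorem contDiffAt_wedge {F V : Type*} [NormedAddCommGroup F] [NormedSpace ℝ F]
    [NormedAddCommGroup V] [NormedSpace ℝ V] [FiniteDimensional ℝ V] {k l : ℕ}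
    {α : F → V [⋀^Fin k]→L[ℝ] ℝ} {β : F → V [⋀^Fin l]→L[ℝ] ℝ} {n : WithTop ℕ∞} {y : F}
    (hα : ContDiffAt ℝ n α y) (hβ : ContDiffAt ℝ n β y) :
    ContDiffAt ℝ n (fun y => wedge (α y) (β y)) y := by
  refine contDiffAt_alternating_iff.2 fun v => ?_
  simp only [wedge_apply]
  refine contDiffAt_const.mul (ContDiffAt.sum fun σ _ => contDiffAt_const.mul ?_)
  exact (contDiffAt_alternating_iff.1 hα _).mul (contDiffAt_alternating_iff.1 hβ _)

theorem smoothForm_iff_pullbackForm {k : ℕ} {θ : Form m M k} :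
    SmoothForm θ ↔ ∀ x : M, ContDiffAt ℝ ∞ (pullbackForm (chartAt (𝔼 m) x).symm θ)
      (chartAt (𝔼 m) x x) := by
  refine ⟨fun h x => h.contDiffAt_pullbackForm ?_, fun h => smoothForm_of_local fun x =>
    ⟨_, chart_mem_maximalAtlas x, mem_chart_source _ x, h x⟩⟩
  exact contMDiffAt_chart_symm (chart_mem_maximalAtlas x) (mem_chart_target _ x)

theorem SmoothForm.wedgeForm {k l : ℕ} {α : Form m M k} {β : Form m M l} (hα : SmoothForm α)
    (hβ : SmoothForm β) : SmoothForm (wedgeForm α β) := by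
  rw [smoothForm_iff_pullbackForm] at *
  intro x
  simp_rw [funext (pullbackForm_wedgeForm (chartAt (𝔼 m) x).symm α β)]
  exact contDiffAt_wedge (hα x) (hβ x)

theorem SmoothForm.add {k : ℕ} {α β : Form m M k} (hα : SmoothForm α)
    (hβ : SmoothForm β) : SmoothForm (α + β) := by
  rw [smoothForm_iff_pullbackForm] at *
  exact fun x => (hα x).add (hβ x)

theorem SmoothForm.sub {k : ℕ} {α β : Form m M k} (hα : SmoothForm α)
    (hβ : SmoothForm β) : SmoothForm (α - β) := by
  rw [smoothForm_iff_pullbackForm] at *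
  exact fun x => (hα x).sub (hβ x)

theorem SmoothForm.smul {k : ℕ} {α : Form m M k} (c : ℝ) (hα : SmoothForm α) :
    SmoothForm (c • α) := by
  rw [smoothForm_iff_pullbackForm] at *
  exact fun x => (hα x).const_smul c

variable (m M) in
theorem smoothForm_zero (k : ℕ) : SmoothForm (0 : Form m M k) := by
  rw [smoothForm_iff_pullbackForm]
  exact fun x => contDiffAt_const (c := (0 : 𝔼 m [⋀^Fin k]→L[ℝ] ℝ))

/-- The form on `M` given by a form `η` on the range of a chart. -/
noncomputable def chartPullback {k : ℕ} (φ : OpenPartialHomeomorph M (𝔼 m))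
    (η : 𝔼 m → 𝔼 m [⋀^Fin k]→L[ℝ] ℝ) : Form m M k :=
  fun x => (η (φ x)).compContinuousLinearMap (mfderiv (𝓡 m) (𝓡 m) φ x)

theorem pullbackForm_chartPullback {k : ℕ} {φ : OpenPartialHomeomorph M (𝔼 m)}
    (hφ : φ ∈ maximalAtlas (𝓡 m) ∞ M) (η : 𝔼 m → 𝔼 m [⋀^Fin k]→L[ℝ] ℝ) {y : 𝔼 m}
    (hy : y ∈ φ.target) : pullbackForm φ.symm (chartPullback φ η) y = η y := by
  ext v
  change η (φ (φ.symm y)) (fun i => mfderiv (𝓡 m) (𝓡 m) φ (φ.symm y)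
    (mfderiv (𝓡 m) (𝓡 m) φ.symm y (v i))) = η y v
  rw [φ.right_inv hy]
  exact congrArg (η y) (funext fun i => mfderiv_mfderiv_symm hφ hy (v i))

theorem contDiffAt_pullbackForm_chartPullback {q k : ℕ} {φ : OpenPartialHomeomorph M (𝔼 m)}
    (hφ : φ ∈ maximalAtlas (𝓡 m) ∞ M) {η : 𝔼 m → 𝔼 m [⋀^Fin k]→L[ℝ] ℝ} {f : 𝔼 q → M} {u : 𝔼 q}
    (hu : f u ∈ φ.source) (hf : ContMDiffAt (𝓡 q) (𝓡 m) ∞ f u)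
    (hη : ContDiffAt ℝ ∞ η (φ (f u))) :
    ContDiffAt ℝ ∞ (pullbackForm f (chartPullback φ η)) u := by
  refine contDiffAt_pullbackForm hφ hu hf (hη.congr_of_eventuallyEq ?_)
  filter_upwards [φ.open_target.mem_nhds (φ.map_source hu)] with y hy
  exact pullbackForm_chartPullback hφ η hy

/-- Finite families of smooth forms which locally satisfy a convex condition exist globally. -/
theorem exists_smoothForm_of_local [T2Space M] [SigmaCompactSpace M] {ι : Type*} {k : ℕ}
    (P : ∀ x : M, Set (ι → TangentSpace (𝓡 m) x [⋀^Fin k]→L[ℝ] ℝ)) (hP : ∀ x, Convex ℝ (P x))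
    (h : ∀ x₀ : M, ∃ φ ∈ maximalAtlas (𝓡 m) ∞ M, x₀ ∈ φ.source ∧ ∃ O : Set (𝔼 m), IsOpen O ∧
      φ x₀ ∈ O ∧ ∃ η : ι → 𝔼 m → 𝔼 m [⋀^Fin k]→L[ℝ] ℝ, (∀ i, ContDiffOn ℝ ∞ (η i) O) ∧
        ∀ x ∈ φ.source, φ x ∈ O → (fun i => chartPullback φ (η i) x) ∈ P x) :
    ∃ θ : ι → Form m M k, (∀ i, SmoothForm (θ i)) ∧ ∀ x, (fun i => θ i x) ∈ P x := by
  choose φ hφ hx O hO hxO η hη hηP using h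
  let U : M → Set M := fun c => (φ c).source ∩ φ c ⁻¹' O c
  have hU : ∀ c, IsOpen (U c) := fun c => (φ c).isOpen_inter_preimage (hO c)
  obtain ⟨ρ, hρ⟩ := SmoothPartitionOfUnity.exists_isSubordinate (𝓡 m) isClosed_univ U hU
    (fun x _ => mem_iUnion.2 ⟨x, hx x, hxO x⟩)
  -- All members of the family are averaged with the same weights, so a convex condition coupling
  -- them survives the gluing.
  let Θ : ∀ x : M, ι → TangentSpace (𝓡 m) x [⋀^Fin k]→L[ℝ] ℝ :=
    fun x => ∑ᶠ c, ρ c x • fun i => chartPullback (φ c) (η c i) x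
  have hΘ : ∀ x₀ : M, ∀ᶠ x in 𝓝 x₀, ∀ i, Θ x i =
      ∑ c ∈ ρ.fintsupport x₀, ρ c x • chartPullback (φ c) (η c i) x := by
    intro x₀
    filter_upwards [ρ.eventually_finsupport_subset x₀] with x hx i
    have : Θ x = ∑ c ∈ ρ.fintsupport x₀, ρ c x • fun i => chartPullback (φ c) (η c i) x := by
      refine finsum_eq_sum_of_support_subset _ fun c hc => hx ?_
      rw [ρ.mem_finsupport]
      intro h0
      exact hc (by simp only [h0, zero_smul])
    rw [this, Finset.sum_apply]
    rfl
  refine ⟨fun i x => Θ x i, fun i => ?_, fun x => ?_⟩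
  · rw [smoothForm_iff_pullbackForm]
    intro x₀
    set ψ := chartAt (𝔼 m) x₀
    have hψ : ψ ∈ maximalAtlas (𝓡 m) ∞ M := chart_mem_maximalAtlas x₀
    have hψx : ψ.symm (ψ x₀) = x₀ := ψ.left_inv (mem_chart_source _ x₀)
    have hψt : ψ x₀ ∈ ψ.target := mem_chart_target _ x₀
    have hc := contMDiffAt_chart_symm hψ hψt
    have h1 : ∀ᶠ y in 𝓝 (ψ x₀), pullbackForm ψ.symm (fun x => Θ x i) y
        = ∑ c ∈ ρ.fintsupport x₀, ρ c (ψ.symm y) •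
          pullbackForm ψ.symm (chartPullback (φ c) (η c i)) y := by
      have := hc.continuousAt.eventually (by rw [hψx]; exact hΘ x₀)
      filter_upwards [this] with y hy
      ext v
      change Θ (ψ.symm y) i (fun i => mfderiv (𝓡 m) (𝓡 m) ψ.symm y (v i)) = _
      rw [hy, ContinuousAlternatingMap.sum_apply, ContinuousAlternatingMap.sum_apply]
      rfl
    refine ContDiffAt.congr_of_eventuallyEq (ContDiffAt.sum fun c hcs => ?_) h1
    have hxc : x₀ ∈ U c := hρ c ((ρ.mem_fintsupport_iff x₀ c).1 hcs)
    refine ContDiffAt.smul (f := fun y => ρ c (ψ.symm y))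
      (g := pullbackForm ψ.symm (chartPullback (φ c) (η c i))) ?_ ?_
    · rw [← contMDiffAt_iff_contDiffAt]
      exact ((ρ c).contMDiff.contMDiffAt (x := ψ.symm (ψ x₀))).comp _ hc
    · refine contDiffAt_pullbackForm_chartPullback (hφ c) (by rw [hψx]; exact hxc.1) hc ?_
      rw [hψx]
      exact (hη c i).contDiffAt ((hO c).mem_nhds hxc.2)
  · refine (hP x).finsum_mem (fun c => ρ.nonneg c x) (ρ.sum_eq_one (mem_univ x)) fun c hc => ?_
    have hxc : x ∈ U c := hρ c (subset_closure hc)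
    exact hηP c x hxc.1 hxc.2

/-- A single smooth form from local ones. -/
theorem exists_smoothForm_of_local_one [T2Space M] [SigmaCompactSpace M] {k : ℕ}
    (P : ∀ x : M, Set (TangentSpace (𝓡 m) x [⋀^Fin k]→L[ℝ] ℝ)) (hP : ∀ x, Convex ℝ (P x))
    (h : ∀ x₀ : M, ∃ φ ∈ maximalAtlas (𝓡 m) ∞ M, x₀ ∈ φ.source ∧ ∃ O : Set (𝔼 m), IsOpen O ∧
      φ x₀ ∈ O ∧ ∃ η : 𝔼 m → 𝔼 m [⋀^Fin k]→L[ℝ] ℝ, ContDiffOn ℝ ∞ η O ∧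
        ∀ x ∈ φ.source, φ x ∈ O → chartPullback φ η x ∈ P x) :
    ∃ θ : Form m M k, SmoothForm θ ∧ ∀ x, θ x ∈ P x := by
  obtain ⟨θ, h1, h2⟩ := exists_smoothForm_of_local (ι := Unit)
    (fun x => {f | f () ∈ P x}) (fun x => (hP x).is_linear_preimage
      ⟨fun _ _ => rfl, fun _ _ => rfl⟩) (fun x₀ => by
      obtain ⟨φ, hφ, hx, O, hO, hxO, η, hη, hηP⟩ := h x₀
      exact ⟨φ, hφ, hx, O, hO, hxO, fun _ => η, fun _ => hη, hηP⟩)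
  exact ⟨θ (), h1 (), h2⟩

end Forms

/-! ### Foliations -/

section Foliation

variable {m : ℕ} {M : Type*} [TopologicalSpace M] [ChartedSpace (EuclideanSpace ℝ (Fin m)) M]
  [IsManifold (𝓡 m) ∞ M] {p : ℕ} {D : Distribution m M}

theorem VanishesOn.pullbackForm_eq_zero {k : ℕ} {θ : Form m M k} (hθ : VanishesOn D θ)
    {U : Set (𝔼 p)} {f : 𝔼 p → M} (hf : IsLeafPatch p D U f) {u : 𝔼 p} (hu : u ∈ U) :
    pullbackForm f θ u = 0 := by
  ext v
  refine hθ (f u) (fun i => mfderiv (𝓡 p) (𝓡 m) f u (v i)) fun i => ?_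
  rw [← hf.range_eq u hu]
  exact ⟨v i, rfl⟩

theorem VanishesOn.leafwiseClosed {k : ℕ} {θ : Form m M k} (hθ : VanishesOn D θ) :
    LeafwiseClosed p D θ := by
  intro U f hf u hu
  have h : pullbackForm f θ =ᶠ[𝓝 u] 0 := by
    filter_upwards [hf.isOpen.mem_nhds hu] with u' hu'
    exact hθ.pullbackForm_eq_zero hf hu'
  rw [h.extDeriv_eq]
  simp only [extDeriv, Pi.zero_def, fderiv_fun_const]
  exact map_zero (ContinuousAlternatingMap.alternatizeUncurryFinCLM ℝ (𝔼 p) ℝ)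

/-- Every point of a foliated manifold lies on a leaf patch. -/
theorem IsFoliation.exists_isLeafPatch (hD : IsFoliation p D) (x : M) :
    ∃ (U : Set (𝔼 p)) (f : 𝔼 p → M), IsLeafPatch p D U f ∧ ∃ u ∈ U, f u = x := by
  obtain ⟨φ, hφ, hx, W, hW, hDW⟩ := hD x
  let e : 𝔼 p ≃L[ℝ] W := ContinuousLinearEquiv.ofFinrankEq (by simp [hW])
  let ι : 𝔼 p →L[ℝ] 𝔼 m := W.subtypeL ∘L (e : 𝔼 p →L[ℝ] W)
  -- In the foliated chart the leaf through `x` is a translate of `W`; `g` parametrizes it, sending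
  -- `0` to `φ x`.
  let g : 𝔼 p → 𝔼 m := fun u => φ x + ι u
  have hg : ContDiff ℝ ∞ g := contDiff_const.add ι.contDiff
  have hg' : ∀ u, fderiv ℝ g u = ι := fun u => by
    simp only [g, fderiv_const_add, ContinuousLinearMap.fderiv]
  have hU : IsOpen (g ⁻¹' φ.target) := φ.open_target.preimage hg.continuous
  have hs : ∀ u ∈ g ⁻¹' φ.target, ContMDiffAt (𝓡 p) (𝓡 m) ∞ (φ.symm ∘ g) u := fun u hu =>
    (contMDiffAt_chart_symm hφ hu).comp u hg.contMDiff.contMDiffAt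
  have hφg : ∀ u ∈ g ⁻¹' φ.target, ∀ v, mfderiv (𝓡 m) (𝓡 m) φ ((φ.symm ∘ g) u)
      (mfderiv (𝓡 p) (𝓡 m) (φ.symm ∘ g) u v) = ι v := by
    intro u hu v
    rw [← mfderiv_chart_comp (f := φ.symm ∘ g) hφ (φ.map_target hu) ((hs u hu).mdifferentiableAt (by simp)) v]
    have : φ ∘ φ.symm ∘ g =ᶠ[𝓝 u] g := by
      filter_upwards [hU.mem_nhds hu] with u' hu'
      exact φ.right_inv hu'
    rw [this.fderiv_eq, hg']
  refine ⟨g ⁻¹' φ.target, φ.symm ∘ g, ⟨hU, fun u hu => (hs u hu).contMDiffWithinAt, ?_, ?_⟩,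
    0, ?_, ?_⟩
  · intro u hu v w hvw
    have := congrArg (mfderiv (𝓡 m) (𝓡 m) φ ((φ.symm ∘ g) u)) hvw
    rw [hφg u hu, hφg u hu] at this
    exact e.injective (Subtype.ext this)
  · intro u hu
    ext v
    rw [hDW ((φ.symm ∘ g) u) (φ.map_target hu) v]
    constructor
    · rintro ⟨w, rfl⟩
      have h2 := hφg u hu w
      change (mfderiv (𝓡 m) (𝓡 m) φ ((φ.symm ∘ g) u)
        (mfderiv (𝓡 p) (𝓡 m) (φ.symm ∘ g) u w) : 𝔼 m) ∈ W
      rw [h2]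
      exact (e w).2
    · intro hv
      refine ⟨e.symm ⟨_, hv⟩, ?_⟩
      apply ((mdifferentiable_of_mem_atlas_top hφ).mfderiv_injective (φ.map_target hu))
      refine (hφg u hu _).trans ?_
      simp [ι]
  · simp only [mem_preimage, g, map_zero, add_zero]
    exact φ.map_source hx
  · simp [g, φ.left_inv hx]

/-- A form is closed on the leaves when its exterior derivative vanishes on the leaves. -/
theorem IsFoliation.leafwiseClosed_iff (hD : IsFoliation p D) {k : ℕ} {θ : Form m M k}
    (hθ : SmoothForm θ) : LeafwiseClosed p D θ ↔ VanishesOn D (extD θ) := by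
  constructor
  · intro h x v hv
    obtain ⟨U, f, hf, u, hu, rfl⟩ := hD.exists_isLeafPatch x
    have h1 := h U f hf u hu
    rw [← hθ.pullbackForm_extD (hf.smooth.contMDiffAt (hf.isOpen.mem_nhds hu))] at h1
    simp_rw [← hf.range_eq u hu] at hv
    choose w hw using hv
    rw [← funext hw]
    exact congrArg (fun η : 𝔼 p [⋀^Fin (k + 1)]→L[ℝ] ℝ => η w) h1
  · intro h U f hf u hu
    rw [← hθ.pullbackForm_extD (hf.smooth.contMDiffAt (hf.isOpen.mem_nhds hu))]
    exact h.pullbackForm_eq_zero hf hu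

/-- The restriction to a leaf is zero on an open set of parameters, hence so is its exterior
derivative, and `extD` commutes with the restriction. -/
theorem IsFoliation.vanishesOn_extD (hD : IsFoliation p D) {k : ℕ} {θ : Form m M k}
    (hθ : SmoothForm θ) (h : VanishesOn D θ) : VanishesOn D (extD θ) :=
  (hD.leafwiseClosed_iff hθ).1 h.leafwiseClosed

theorem VanishesOn.wedgeForm_left {k l : ℕ} {α : Form m M k} {η : Form m M l}
    (h : VanishesOn D η) : VanishesOn D (wedgeForm α η) := by
  intro x v hv
  refine (wedge_apply (α x) (η x) v).trans ?_
  rw [Finset.sum_eq_zero, mul_zero]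
  intro σ _
  rw [h x _ fun i => hv _, mul_zero, mul_zero]

theorem VanishesOn.wedgeForm_right {k l : ℕ} {α : Form m M l} {η : Form m M k}
    (h : VanishesOn D η) : VanishesOn D (wedgeForm η α) := by
  intro x v hv
  refine (wedge_apply (η x) (α x) v).trans ?_
  rw [Finset.sum_eq_zero, mul_zero]
  intro σ _
  rw [h x _ fun i => hv _, zero_mul, mul_zero]

end Foliation

/-! ### Finitely many one-forms defining a foliation -/

theorem oneForm_apply_smul {V : Type*} [AddCommGroup V] [Module ℝ V] [TopologicalSpace V]
    (η : V [⋀^Fin 1]→L[ℝ] ℝ) (c : ℝ) (v : V) : η ![c • v] = c * η ![v] := by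
  have h : ∀ w : V, Function.update ![v] 0 w = ![w] := fun w => by
    funext j
    fin_cases j
    rfl
  have := η.map_update_smul ![v] 0 c v
  rwa [h, h] at this

/-- The covectors are the coordinates of the orthogonal projection onto `Wᗮ`. Using all `m` of them,
whatever the codimension, keeps the index type the same for every chart. -/
theorem exists_covectors {m : ℕ} (W : Submodule ℝ (𝔼 m)) :
    ∃ a : Fin m → 𝔼 m →L[ℝ] ℝ, ∀ v, v ∈ W ↔ ∀ j, a j v = 0 := by
  refine ⟨fun j => EuclideanSpace.proj j ∘L (Wᗮ.subtypeL ∘L Wᗮ.orthogonalProjectionOnto),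
    fun v => ?_⟩
  have h : v ∈ W ↔ Wᗮ.orthogonalProjectionOnto v = 0 := by
    rw [Submodule.orthogonalProjectionOnto_eq_zero_iff, Submodule.orthogonal_orthogonal]
  rw [h]
  constructor
  · intro h j
    simp [h]
  · intro h
    ext j
    exact h j

section Spanning

variable {m : ℕ} {M : Type*} [TopologicalSpace M] [ChartedSpace (EuclideanSpace ℝ (Fin m)) M]
  [IsManifold (𝓡 m) ∞ M]

/-- General position: a smooth form with values in `ℝ^(2m+1)` can be changed by a multiple of a
one-form `τ` so that it is nowhere zero on the vectors with `τ v ≠ 0`. -/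
theorem exists_add_smul_ne_zero [SecondCountableTopology M] (G : Fin (2 * m + 1) → Form m M 1)
    (hG : ∀ i, SmoothForm (G i)) (τ : Form m M 1) :
    ∃ c : Fin (2 * m + 1) → ℝ, ∀ (x : M) (v : TangentSpace (𝓡 m) x),
      (∀ i, G i x ![v] + c i * τ x ![v] = 0) → τ x ![v] = 0 := by
  -- A bad constant `c` comes from a vector `v` with `τ v ≠ 0`; scaled to `τ v = 1`, it gives `c i =
  -- -G i v`. So the bad constants lie in the image of the tangent bundle, read in countably many
  -- charts, under the maps `Ψ a`.
  let Ψ : M → 𝔼 m × 𝔼 m → (Fin (2 * m + 1) → ℝ) := fun a z i =>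
    -(pullbackForm (chartAt (𝔼 m) a).symm (G i) z.1 ![z.2])
  obtain ⟨s, hs, hcov⟩ := TopologicalSpace.countable_cover_nhds
    (fun x : M => (chartAt (𝔼 m) x).open_source.mem_nhds (mem_chart_source _ x))
  let B : Set (Fin (2 * m + 1) → ℝ) := ⋃ a ∈ s, Ψ a '' ((chartAt (𝔼 m) a).target ×ˢ univ)
  -- Locally Lipschitz maps do not raise Hausdorff dimension: the bad set has dimension at most
  -- `2m`, and its complement in dimension `2m + 1` is dense.
  have hB : dimH B < Module.finrank ℝ (Fin (2 * m + 1) → ℝ) := by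
    have h1 : dimH B ≤ (2 * m : ℕ) := by
      rw [dimH_bUnion hs]
      refine iSup₂_le fun a _ => ?_
      refine (dimH_image_le_of_locally_lipschitzOn fun z hz => ?_).trans
        ((dimH_mono (subset_univ _)).trans (Real.dimH_univ_eq_finrank (𝔼 m × 𝔼 m)).le) |>.trans ?_
      · have hΨ : ContDiffAt ℝ 1 (Ψ a) z := by
          refine contDiffAt_pi.2 fun i => ContDiffAt.neg ?_
          have h2 : ContDiffAt ℝ 1 (pullbackForm (chartAt (𝔼 m) a).symm (G i)) z.1 :=
            ((hG i).contDiffAt_pullbackForm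
              (contMDiffAt_chart_symm (chart_mem_maximalAtlas a) hz.1)).of_le
                (by exact_mod_cast le_top)
          refine ContDiffAt.alternating_apply (v := fun z : 𝔼 m × 𝔼 m => ![z.2])
            (η := fun z : 𝔼 m × 𝔼 m => pullbackForm (chartAt (𝔼 m) a).symm (G i) z.1)
            (h2.comp z contDiffAt_fst) fun j => ?_
          simpa using contDiffAt_snd
        obtain ⟨K, t, ht, hK⟩ := hΨ.exists_lipschitzOnWith
        exact ⟨K, t, mem_nhdsWithin_of_mem_nhds ht, hK⟩
      · simp [two_mul]
    refine h1.trans_lt ?_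
    rw [Module.finrank_fin_fun]
    exact_mod_cast Nat.lt_succ_self _
  obtain ⟨c, hc⟩ := (dense_compl_of_dimH_lt_finrank hB).nonempty
  refine ⟨c, fun x v h => ?_⟩
  by_contra hτ
  refine hc ?_
  obtain ⟨a, ha, hxa⟩ := mem_iUnion₂.1 (hcov ▸ mem_univ x : x ∈ ⋃ a ∈ s, (chartAt (𝔼 m) a).source)
  have hm := chart_mem_maximalAtlas (I := 𝓡 m) (n := ∞) a
  refine mem_iUnion₂.2 ⟨a, ha, (chartAt (𝔼 m) a x, chartDeriv (chartAt (𝔼 m) a) x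
    ((τ x ![v])⁻¹ • v)), ⟨(chartAt (𝔼 m) a).map_source hxa, mem_univ _⟩, ?_⟩
  funext i
  have h1 : G i x ![(τ x ![v])⁻¹ • v] = (τ x ![v])⁻¹ * G i x ![v] :=
    oneForm_apply_smul (G i x) _ _
  have h2 := form_apply_eq hm (G i) hxa ![(τ x ![v])⁻¹ • v]
  have h3 : (fun j => chartDeriv (chartAt (𝔼 m) a) x (![(τ x ![v])⁻¹ • v] j))
      = ![chartDeriv (chartAt (𝔼 m) a) x ((τ x ![v])⁻¹ • v)] := by
    funext j
    fin_cases j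
    rfl
  rw [h3, h1] at h2
  change -(pullbackForm (chartAt (𝔼 m) a).symm (G i) (chartAt (𝔼 m) a x)
    ![chartDeriv (chartAt (𝔼 m) a) x ((τ x ![v])⁻¹ • v)]) = c i
  rw [← h2]
  have h4 := h i
  field_simp
  linarith

/-- A locally finite sequence of one-forms can be replaced by `2 m + 1` linear combinations
without enlarging the common kernels. -/
theorem exists_finite_combinations [SecondCountableTopology M] (τ : ℕ → Form m M 1)
    (hτ : ∀ n, SmoothForm (τ n))
    (hfin : ∀ x₀ : M, ∃ K : ℕ, ∀ᶠ x in 𝓝 x₀, ∀ n ≥ K, τ n x = 0) :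
    ∃ θ : Fin (2 * m + 1) → Form m M 1, (∀ i, SmoothForm (θ i)) ∧
      (∀ D : Distribution m M, (∀ n, VanishesOn D (τ n)) → ∀ i, VanishesOn D (θ i)) ∧
      ∀ (x : M) (v : TangentSpace (𝓡 m) x), (∀ i, θ i x ![v] = 0) → ∀ n, τ n x ![v] = 0 := by
  classical
  -- Smoothness of `G` is placed under the existential so that `choose` gives a function of all `G`,
  -- as the recursion below requires.
  have hstep : ∀ (G : Fin (2 * m + 1) → Form m M 1) (n : ℕ), ∃ c : Fin (2 * m + 1) → ℝ,
      (∀ i, SmoothForm (G i)) → ∀ (x : M) (v : TangentSpace (𝓡 m) x),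
      (∀ i, G i x ![v] + c i * τ n x ![v] = 0) → τ n x ![v] = 0 := fun G n => by
    by_cases hG : ∀ i, SmoothForm (G i)
    · obtain ⟨c, hc⟩ := exists_add_smul_ne_zero G hG (τ n)
      exact ⟨c, fun _ => hc⟩
    · exact ⟨0, fun h => absurd h hG⟩
  choose c hc using hstep
  let G : ℕ → Fin (2 * m + 1) → Form m M 1 := fun n =>
    Nat.rec 0 (fun n G i => G i + c G n i • τ n) n
  have hGs : ∀ n i, G (n + 1) i = G n i + c (G n) n i • τ n := fun n i => rfl
  have hG : ∀ n i, SmoothForm (G n i) := by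
    intro n
    induction n with
    | zero => exact fun i => smoothForm_zero m M 1
    | succ n ih => exact fun i => (ih i).add ((hτ n).smul _)
  have hker : ∀ n (x : M) (v : TangentSpace (𝓡 m) x), (∀ i, G n i x ![v] = 0) →
      ∀ j < n, τ j x ![v] = 0 := by
    intro n
    induction n with
    | zero => exact fun x v _ j hj => absurd hj (Nat.not_lt_zero _)
    | succ n ih =>
      intro x v h j hj
      have h1 : τ n x ![v] = 0 := hc (G n) n (hG n) x v h
      rcases Nat.lt_succ_iff_lt_or_eq.1 hj with hj | rfl
      · refine ih x v (fun i => ?_) j hj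
        have h2 : G n i x ![v] + c (G n) n i * τ n x ![v] = 0 := h i
        rwa [h1, mul_zero, add_zero] at h2
      · exact h1
  choose K hK using hfin
  -- The recursion stops changing at `x` once the remaining `τ n` vanish there. The stage `K x₀`
  -- works throughout a neighbourhood of `x₀`, so the eventual value is locally a smooth finite
  -- stage.
  have hconst : ∀ (x : M) (k : ℕ), (∀ n ≥ k, τ n x = 0) → ∀ n ≥ k, ∀ i, G n i x = G k i x := by
    intro x k h n hn i
    induction n, hn using Nat.le_induction with
    | base => rfl
    | succ n hn ih =>
      rw [hGs, Pi.add_apply, Pi.smul_apply, h n hn, smul_zero, add_zero, ih]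
  have hloc : ∀ x₀ : M, ∀ᶠ x in 𝓝 x₀, ∀ i, G (K x) i x = G (K x₀) i x := by
    intro x₀
    filter_upwards [hK x₀] with x hx i
    rw [← hconst x _ hx (max (K x) (K x₀)) (le_max_right _ _) i]
    exact (hconst x _ (hK x).self_of_nhds _ (le_max_left _ _) i).symm
  refine ⟨fun i x => G (K x) i x, fun i => ?_, fun D hD i x v hv => ?_, fun x v h n => ?_⟩
  · rw [smoothForm_iff_pullbackForm]
    intro x₀
    have hx₀ := (chartAt (𝔼 m) x₀).left_inv (mem_chart_source (𝔼 m) x₀)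
    refine (smoothForm_iff_pullbackForm.1 (hG (K x₀) i) x₀).congr_of_eventuallyEq ?_
    have hc := contMDiffAt_chart_symm (chart_mem_maximalAtlas (I := 𝓡 m) (n := ∞) x₀)
      (mem_chart_target (𝔼 m) x₀)
    have := hc.continuousAt.eventually (by rw [hx₀]; exact hloc x₀)
    filter_upwards [this] with y hy
    ext v
    exact congrArg (fun η : TangentSpace (𝓡 m) ((chartAt (𝔼 m) x₀).symm y) [⋀^Fin 1]→L[ℝ] ℝ =>
      η fun i => mfderiv (𝓡 m) (𝓡 m) (chartAt (𝔼 m) x₀).symm y (v i)) (hy i)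
  · change G (K x) i x v = 0
    generalize K x = n
    induction n with
    | zero => rfl
    | succ n ih =>
      rw [hGs, Pi.add_apply, Pi.smul_apply, ContinuousAlternatingMap.add_apply, ih,
        ContinuousAlternatingMap.smul_apply, hD n x v hv, smul_zero, add_zero]
  · by_cases hn : n < K x
    · exact hker (K x) x v h n hn
    · rw [(hK x).self_of_nhds n (not_lt.1 hn)]
      rfl

theorem smoothForm_smul_chartPullback {k : ℕ} {φ : OpenPartialHomeomorph M (𝔼 m)}
    (hφ : φ ∈ maximalAtlas (𝓡 m) ∞ M) {η : 𝔼 m → 𝔼 m [⋀^Fin k]→L[ℝ] ℝ}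
    (hη : ContDiff ℝ ∞ η) {ρ : M → ℝ} (hρ : ContMDiff (𝓡 m) 𝓘(ℝ, ℝ) ∞ ρ)
    (hρφ : tsupport ρ ⊆ φ.source) : SmoothForm (fun x => ρ x • chartPullback φ η x) := by
  rw [smoothForm_iff_pullbackForm]
  intro x
  set ψ := chartAt (𝔼 m) x
  have hψx : ψ.symm (ψ x) = x := ψ.left_inv (mem_chart_source _ x)
  have hc := contMDiffAt_chart_symm (chart_mem_maximalAtlas (I := 𝓡 m) (n := ∞) x)
      (mem_chart_target (𝔼 m) x)
  by_cases hx : x ∈ tsupport ρ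
  · refine ContDiffAt.smul (f := fun y => ρ (ψ.symm y))
      (g := pullbackForm ψ.symm (chartPullback φ η)) ?_ ?_
    · rw [← contMDiffAt_iff_contDiffAt]
      exact (hρ.contMDiffAt (x := ψ.symm (ψ x))).comp _ hc
    · exact contDiffAt_pullbackForm_chartPullback hφ (by rw [hψx]; exact hρφ hx) hc hη.contDiffAt
  · refine (contDiffAt_const (c := (0 : 𝔼 m [⋀^Fin k]→L[ℝ] ℝ))).congr_of_eventuallyEq ?_
    have h0 : ∀ᶠ z in 𝓝 x, ρ z = 0 := by
      filter_upwards [(isClosed_tsupport ρ).isOpen_compl.mem_nhds hx] with z hz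
      exact image_eq_zero_of_notMem_tsupport hz
    have := hc.continuousAt.eventually (by rw [hψx]; exact h0)
    filter_upwards [this] with y hy
    ext v
    change ρ (ψ.symm y) * chartPullback φ η (ψ.symm y)
      (fun i => mfderiv (𝓡 m) (𝓡 m) ψ.symm y (v i)) = 0
    rw [hy, zero_mul]

/-- A foliation is the common kernel of finitely many smooth one-forms. -/
theorem IsFoliation.exists_oneForms [T2Space M] [SecondCountableTopology M] {p : ℕ}
    {D : Distribution m M} (hD : IsFoliation p D) :
    ∃ θ : Fin (2 * m + 1) → Form m M 1, (∀ i, SmoothForm (θ i)) ∧ (∀ i, VanishesOn D (θ i)) ∧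
      ∀ (x : M) (v : TangentSpace (𝓡 m) x), (∀ i, θ i x ![v] = 0) → v ∈ D x := by
  classical
  have : LocallyCompactSpace M := ChartedSpace.locallyCompactSpace (𝔼 m) M
  choose φ hφ hx W hW hDW using hD
  obtain ⟨s, hs, hcov⟩ := TopologicalSpace.countable_cover_nhds
    (fun x : M => (φ x).open_source.mem_nhds (hx x))
  obtain ⟨ρ, hρ⟩ := SmoothPartitionOfUnity.exists_isSubordinate (𝓡 m) isClosed_univ
    (fun c : s => (φ c).source) (fun c => (φ c).open_source) (by
      intro x _
      obtain ⟨a, ha, hxa⟩ := mem_iUnion₂.1 (hcov ▸ mem_univ x : x ∈ ⋃ a ∈ s, (φ a).source)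
      exact mem_iUnion.2 ⟨⟨a, ha⟩, hxa⟩)
  have : Countable s := hs
  let _ : Encodable (s × Fin m) := Encodable.ofCountable _
  choose a ha using fun c => exists_covectors (W c)
  let σ : s × Fin m → Form m M 1 := fun c x => ρ c.1 x • chartPullback (φ c.1)
    (fun _ => ContinuousAlternatingMap.ofSubsingleton ℝ (𝔼 m) ℝ 0 (a c.1 c.2)) x
  have hσa : ∀ c x v, σ c x v = ρ c.1 x * a c.1 c.2 (chartDeriv (φ c.1) x (v 0)) :=
    fun c x v => rfl
  have hσ : ∀ c, SmoothForm (σ c) := fun c =>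
    smoothForm_smul_chartPullback (hφ c.1) contDiff_const (ρ c.1).contMDiff (hρ c.1)
  have hσD : ∀ c, VanishesOn D (σ c) := by
    intro c x v hv
    rw [hσa]
    by_cases hxc : ρ c.1 x = 0
    · rw [hxc, zero_mul]
    · have h1 : chartDeriv (φ c.1) x (v 0) ∈ W c.1 :=
        (hDW c.1 x (hρ c.1 (subset_closure hxc)) (v 0)).1 (hv 0)
      rw [(ha c.1 _).1 h1 c.2, mul_zero]
  -- The countable family is laid out along an encoding, with the zero form at indices that encode
  -- nothing. Local finiteness then says that late terms vanish near a given point.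
  let τ : ℕ → Form m M 1 := fun n => (Encodable.decode₂ (s × Fin m) n).elim 0 σ
  have hτσ : ∀ c, τ (Encodable.encode c) = σ c := fun c => by
    simp [τ, Encodable.decode₂_encode]
  have hτ0 : ∀ n, τ n = 0 ∨ ∃ c, n = Encodable.encode c ∧ τ n = σ c := by
    intro n
    rcases h : Encodable.decode₂ (s × Fin m) n with _ | c
    · left; simp [τ, h]
    · right; exact ⟨c, (Encodable.decode₂_eq_some.1 h).symm, by simp [τ, h]⟩
  obtain ⟨θ, h1, h2, h3⟩ := exists_finite_combinations τ
    (fun n => by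
      rcases hτ0 n with h | ⟨c, -, h⟩
      · rw [h]; exact smoothForm_zero m M 1
      · rw [h]; exact hσ c)
    (fun x₀ => by
      obtain ⟨U, hU, hfin⟩ := ρ.locallyFinite x₀
      have hfin' : {c : s × Fin m | (Function.support (ρ c.1) ∩ U).Nonempty}.Finite := by
        refine (hfin.prod (finite_univ (α := Fin m))).subset fun c hc => ⟨hc, mem_univ _⟩
      obtain ⟨K, hK⟩ := (hfin'.image Encodable.encode).bddAbove
      refine ⟨K + 1, ?_⟩
      filter_upwards [hU] with x hxU n hn
      rcases hτ0 n with h | ⟨c, rfl, h⟩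
      · rw [h]; rfl
      · rw [h]
        have hc : ρ c.1 x = 0 := by
          by_contra hne
          have := hK (mem_image_of_mem Encodable.encode
            (show c ∈ {c : s × Fin m | (Function.support (ρ c.1) ∩ U).Nonempty} from
              ⟨x, hne, hxU⟩))
          omega
        simp only [σ, hc, zero_smul])
  refine ⟨θ, h1, h2 D fun n => ?_, fun x v hv => ?_⟩
  · rcases hτ0 n with h | ⟨c, -, h⟩
    · rw [h]; exact fun _ _ _ => rfl
    · rw [h]; exact hσD c
  · obtain ⟨c, hc⟩ := ρ.exists_pos_of_mem (mem_univ x)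
    refine (hDW c x (hρ c (subset_closure hc.ne')) v).2 ((ha c _).2 fun j => ?_)
    have := h3 x v hv (Encodable.encode (c, j))
    rw [hτσ, hσa] at this
    exact (mul_eq_zero.1 this).resolve_left hc.ne'

end Spanning

/-! ### Forms vanishing on a subspace -/

section Algebra

variable {V : Type*} [NormedAddCommGroup V] [NormedSpace ℝ V]

theorem alternating_map_perm {ι : Type*} [Fintype ι] [DecidableEq ι] (A : V [⋀^ι]→L[ℝ] ℝ)
    (v : ι → V) (σ : Equiv.Perm ι) :
    A (v ∘ σ) = ((Equiv.Perm.sign σ : ℤ) : ℝ) * A v := by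
  have h := A.toAlternatingMap.map_perm v σ
  rw [Units.smul_def, zsmul_eq_mul] at h
  exact h

/-- Permuting by `σ` puts `w` in the last place, and a cycle of sign `(-1) ^ k` brings it to the
front. This reconciles contraction in the first argument with a one-form standing as the last factor
of a wedge product. -/
theorem alternating_update_eq_cons {k : ℕ} (A : V [⋀^Fin (k + 1)]→L[ℝ] ℝ)
    (v : Fin (k + 1) → V) (σ : Equiv.Perm (Fin (k + 1))) (w : V) :
    ((Equiv.Perm.sign σ : ℤ) : ℝ) * ((-1) ^ k * A (Fin.cons w fun i => v (σ i.castSucc)))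
      = A (Function.update v (σ (Fin.last k)) w) := by
  have h1 : Function.update v (σ (Fin.last k)) w ∘ σ
      = Fin.cons w (fun i => v (σ i.castSucc)) ∘ finRotate (k + 1) := by
    have h2 := Fin.snoc_eq_cons_rotate (fun i : Fin k => v (σ i.castSucc)) w
    refine Eq.trans ?_ h2
    funext i
    refine Fin.lastCases ?_ (fun i => ?_) i
    · simp
    · have : σ i.castSucc ≠ σ (Fin.last k) := fun h =>
        (Fin.castSucc_lt_last i).ne (σ.injective h)
      simp
  have h3 := congrArg A h1
  rw [alternating_map_perm, alternating_map_perm, sign_finRotate] at h3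
  have h4 : ((Equiv.Perm.sign σ : ℤ) : ℝ) * ((Equiv.Perm.sign σ : ℤ) : ℝ) = 1 := by
    rw [← Int.cast_mul, ← Units.val_mul, Int.units_mul_self]
    simp
  have h5 : (((((-1 : ℤˣ) ^ (k + 1 - 1) : ℤˣ) : ℤ)) : ℝ) = (-1) ^ k := by
    simp
  rw [h5] at h3
  rw [← h3, ← mul_assoc, h4, one_mul]

/-- The sum over `σ` of `f (σ j)` does not depend on `j`; adding over the `k + 1` values of `j`
gives `(k + 1)!` times the sum of `f`. -/
theorem sum_perm_apply_last {k : ℕ} (f : Fin (k + 1) → ℝ) :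
    ∑ σ : Equiv.Perm (Fin (k + 1)), f (σ (Fin.last k)) = (k.factorial : ℝ) * ∑ i, f i := by
  have h1 : ∀ j : Fin (k + 1), ∑ σ : Equiv.Perm (Fin (k + 1)), f (σ j)
      = ∑ σ : Equiv.Perm (Fin (k + 1)), f (σ (Fin.last k)) := by
    intro j
    refine Fintype.sum_equiv (Equiv.mulRight (Equiv.swap j (Fin.last k))) _ _ fun σ => ?_
    simp
  have h2 : ∑ j : Fin (k + 1), ∑ σ : Equiv.Perm (Fin (k + 1)), f (σ j)
      = ((k + 1).factorial : ℝ) * ∑ i, f i := by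
    rw [Finset.sum_comm]
    simp_rw [fun σ : Equiv.Perm (Fin (k + 1)) => Equiv.sum_comp σ f]
    rw [Finset.sum_const, Finset.card_univ, Fintype.card_perm, Fintype.card_fin, nsmul_eq_mul]
  simp_rw [h1] at h2
  rw [Finset.sum_const, Finset.card_univ, Fintype.card_fin, nsmul_eq_mul, Nat.factorial_succ] at h2
  push_cast at h2
  have h3 : ((k : ℝ) + 1) ≠ 0 := by positivity
  rw [mul_assoc] at h2
  exact mul_left_cancel₀ h3 h2

/-- Contracting with vectors and multiplying by one-forms is the action of an endomorphism as a
derivation of the exterior algebra. -/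
theorem sum_wedge_curryLeft {k N : ℕ} (A : V [⋀^Fin (k + 1)]→L[ℝ] ℝ) (Y : Fin N → V)
    (θ : Fin N → V [⋀^Fin 1]→L[ℝ] ℝ) (v : Fin (k + 1) → V) :
    ∑ j, wedge ((-1 : ℝ) ^ k • A.curryLeft (Y j)) (θ j) v
      = ∑ i, A (Function.update v i (∑ j, θ j ![v i] • Y j)) := by
  simp only [wedge_apply]
  rw [← Finset.mul_sum, Finset.sum_comm]
  have h : ∀ σ : Equiv.Perm (Fin (k + 1)),
      ∑ j, ((Equiv.Perm.sign σ : ℤ) : ℝ) * (((-1 : ℝ) ^ k • A.curryLeft (Y j))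
        (fun i => v (σ (Fin.castAdd 1 i))) * θ j (fun i => v (σ (Fin.natAdd k i))))
      = A (Function.update v (σ (Fin.last k)) (∑ j, θ j ![v (σ (Fin.last k))] • Y j)) := by
    intro σ
    have h1 := A.toMultilinearMap.map_update_sum Finset.univ (σ (Fin.last k))
      (fun j => θ j ![v (σ (Fin.last k))] • Y j) v
    refine Eq.trans ?_ h1.symm
    refine Finset.sum_congr rfl fun j _ => ?_
    have h2 := A.toMultilinearMap.map_update_smul v (σ (Fin.last k)) (θ j ![v (σ (Fin.last k))])
      (Y j)
    refine Eq.trans ?_ h2.symm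
    have h3 : (fun i => v (σ (Fin.natAdd k i))) = ![v (σ (Fin.last k))] := by
      funext i
      fin_cases i
      rfl
    have h4 := alternating_update_eq_cons A v σ (Y j)
    change _ = θ j ![v (σ (Fin.last k))] * A (Function.update v (σ (Fin.last k)) (Y j))
    rw [h3, ← h4]
    change _ * (((-1 : ℝ) ^ k * A (Fin.cons (Y j) fun i => v (σ i.castSucc))) * _) = _
    ring
  rw [Finset.sum_congr rfl fun σ _ => h σ, sum_perm_apply_last
    (fun i => A (Function.update v i (∑ j, θ j ![v i] • Y j)))]
  have : (k.factorial : ℝ) ≠ 0 := by positivity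
  simp only [Nat.factorial_one, Nat.cast_one, mul_one]
  rw [← mul_assoc, inv_mul_cancel₀ this, one_mul]

/-- The form `∑_{S ≠ ∅} |S|⁻¹ η (v')`, where `v' i` is `P (v i)` for `i ∈ S` and `Q (v i)`
otherwise. -/
noncomputable def averagedForm {k : ℕ} (P Q : V →L[ℝ] V) (η : V [⋀^Fin k]→L[ℝ] ℝ) :
    V [⋀^Fin k]→L[ℝ] ℝ where
  -- The term `S = ∅` drops out because `(0 : ℝ)⁻¹ = 0`.
  toContinuousMultilinearMap := ∑ S : Finset (Fin k), (S.card : ℝ)⁻¹ •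
    η.toContinuousMultilinearMap.compContinuousLinearMap (fun i => if i ∈ S then P else Q)
  map_eq_zero_of_eq' := by
    intro v i j hij hne
    let t : Finset (Fin k) → ℝ := fun S =>
      (S.card : ℝ)⁻¹ * η (fun l => (if l ∈ S then P else Q) (v l))
    have h0 : ∀ w, (∑ S : Finset (Fin k), (S.card : ℝ)⁻¹ •
        η.toContinuousMultilinearMap.compContinuousLinearMap
          (fun i => if i ∈ S then P else Q)) w = ∑ S : Finset (Fin k), (S.card : ℝ)⁻¹ *
          η (fun l => (if l ∈ S then P else Q) (w l)) := by
      intro w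
      rw [sum_apply]
      rfl
    refine (h0 v).trans ?_
    -- Exchanging `i` and `j` in `S` preserves the weight and, as `v i = v j`, changes the sign of
    -- the term; the sum is therefore its own negative.
    let e : Finset (Fin k) ≃ Finset (Fin k) := (Equiv.swap i j).finsetCongr
    have h1 : ∀ S, t (e S) = -t S := by
      intro S
      have hv : v ∘ Equiv.swap i j = v := by
        funext l
        by_cases hli : l = i
        · subst hli; simp [hij]
        · by_cases hlj : l = j
          · subst hlj; simp [hij]
          · simp [Equiv.swap_apply_of_ne_of_ne hli hlj]
      have h2 : (fun l => (if l ∈ e S then P else Q) (v l))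
          = (fun l => (if l ∈ S then P else Q) (v l)) ∘ Equiv.swap i j := by
        funext l
        have h3 : l ∈ e S ↔ Equiv.swap i j l ∈ S := by
          simp [e, Finset.mem_map_equiv]
        have h4 := congrFun hv l
        simp only [Function.comp_apply] at h4 ⊢
        rw [h4]
        simp only [h3]
      simp only [t]
      rw [h2, alternating_map_perm, Equiv.Perm.sign_swap hne]
      simp [e]
    have h2 : ∑ S, t S = -∑ S, t S := by
      conv_lhs => rw [← Equiv.sum_comp e t]
      simp only [h1, Finset.sum_neg_distrib]
    exact self_eq_neg.1 h2

theorem averagedForm_apply {k : ℕ} (P Q : V →L[ℝ] V) (η : V [⋀^Fin k]→L[ℝ] ℝ) (v : Fin k → V) :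
    averagedForm P Q η v = ∑ S : Finset (Fin k), (S.card : ℝ)⁻¹ *
      η (fun l => (if l ∈ S then P else Q) (v l)) := by
  change (∑ S : Finset (Fin k), (S.card : ℝ)⁻¹ •
    η.toContinuousMultilinearMap.compContinuousLinearMap (fun i => if i ∈ S then P else Q)) v = _
  rw [sum_apply]
  rfl

/-- Expand `η (P v + Q v)` over the sets `S` of places where `P` is taken. Replacing `v i` by `P (v
i)` keeps the `S`-term when `i ∈ S` and kills it otherwise, because `Q P = 0`. Summing over `i`
multiplies the term by `|S|`, which cancels the weight; the missing term `S = ∅` vanishes by `hη`.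
-/
theorem sum_averagedForm_update {k : ℕ} {P Q : V →L[ℝ] V} (hP : ∀ v, P (P v) = P v)
    (hQ : ∀ v, Q v = v - P v) {η : V [⋀^Fin k]→L[ℝ] ℝ} (hη : ∀ v : Fin k → V, η (fun i => Q (v i)) = 0)
    (v : Fin k → V) :
    ∑ i, averagedForm P Q η (Function.update v i (P (v i))) = η v := by
  have hQP : ∀ v, Q (P v) = 0 := fun v => by rw [hQ, hP, sub_self]
  simp only [averagedForm_apply]
  rw [Finset.sum_comm]
  have h1 : ∀ (S : Finset (Fin k)) (i : Fin k),
      η (fun l => (if l ∈ S then P else Q) (Function.update v i (P (v i)) l))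
      = if i ∈ S then η (fun l => (if l ∈ S then P else Q) (v l)) else 0 := by
    intro S i
    by_cases hi : i ∈ S
    · rw [if_pos hi]
      congr 1
      funext l
      by_cases hl : l = i
      · subst hl; simp [hi, hP]
      · rw [Function.update_of_ne hl]
    · rw [if_neg hi]
      exact η.map_coord_zero i (by simp [hi, hQP])
  have h2 : ∀ S : Finset (Fin k), ∑ i, (S.card : ℝ)⁻¹ *
      η (fun l => (if l ∈ S then P else Q) (Function.update v i (P (v i)) l))
      = η (S.piecewise (fun l => P (v l)) (fun l => Q (v l))) := by
    intro S
    have h3 : (fun l => (if l ∈ S then P else Q) (v l))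
        = S.piecewise (fun l => P (v l)) (fun l => Q (v l)) := by
      funext l
      by_cases hl : l ∈ S <;> simp [hl]
    simp only [h1, h3]
    rw [← Finset.mul_sum, Finset.sum_ite_mem, Finset.univ_inter, Finset.sum_const, nsmul_eq_mul]
    rcases S.eq_empty_or_nonempty with rfl | hS
    · rw [Finset.piecewise_empty, hη]
      simp
    · have : (S.card : ℝ) ≠ 0 := by exact_mod_cast hS.card_pos.ne'
      rw [← mul_assoc, inv_mul_cancel₀ this, one_mul]
  rw [Finset.sum_congr rfl fun S _ => h2 S]
  have h4 := η.toMultilinearMap.map_add_univ (fun l => P (v l)) (fun l => Q (v l))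
  refine h4.symm.trans (congrArg η ?_)
  funext l
  simp [hQ]

end Algebra

/-! ### Smooth inverses and local decomposition of forms -/

section Smooth

variable {F V : Type*} [NormedAddCommGroup F] [NormedSpace ℝ F] [NormedAddCommGroup V]
  [NormedSpace ℝ V] [FiniteDimensional ℝ V]

/-- The inverse of a smooth family of endomorphisms is smooth near a point where it exists. -/
theorem exists_contDiffOn_inverse {R : Type*} [NormedAddCommGroup R] [NormedSpace ℝ R]
    [CompleteSpace R] {B : F → R →L[ℝ] R} {O : Set F} (hO : IsOpen O) (hB : ContDiffOn ℝ ∞ B O)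
    {y₀ : F} (hy₀ : y₀ ∈ O) (h0 : IsUnit (B y₀)) :
    ∃ O' ⊆ O, IsOpen O' ∧ y₀ ∈ O' ∧ ∃ K : F → R →L[ℝ] R, ContDiffOn ℝ ∞ K O' ∧
      ∀ y ∈ O', (∀ r, K y (B y r) = r) ∧ ∀ r, B y (K y r) = r := by
  refine ⟨O ∩ B ⁻¹' {A | IsUnit A}, inter_subset_left,
    hB.continuousOn.isOpen_inter_preimage hO Units.isOpen, ⟨hy₀, h0⟩,
    fun y => Ring.inverse (B y), ?_, ?_⟩
  · intro y hy
    obtain ⟨u, hu⟩ := hy.2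
    have h1 : ContDiffAt ℝ ∞ Ring.inverse (B y) := hu ▸ contDiffAt_ringInverse ℝ u
    exact (h1.comp y (hB.contDiffAt (hO.mem_nhds hy.1))).contDiffWithinAt
  · intro y hy
    exact ⟨fun r => congrArg (fun A : R →L[ℝ] R => A r) (Ring.inverse_mul_cancel _ hy.2),
      fun r => congrArg (fun A : R →L[ℝ] R => A r) (Ring.mul_inverse_cancel _ hy.2)⟩

/-- A smooth family of linear maps with constant kernel has a smooth generalized inverse. -/
theorem exists_generalized_inverse {N : ℕ} {W : Submodule ℝ V} {Θ : F → V →L[ℝ] (Fin N → ℝ)}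
    {O : Set F} (hO : IsOpen O) (hΘ : ContDiffOn ℝ ∞ Θ O)
    (hW : ∀ y ∈ O, ∀ v, v ∈ W ↔ Θ y v = 0) {y₀ : F} (hy₀ : y₀ ∈ O) :
    ∃ O' ⊆ O, IsOpen O' ∧ y₀ ∈ O' ∧ ∃ Y : F → (Fin N → ℝ) →L[ℝ] V, ContDiffOn ℝ ∞ Y O' ∧
      ∀ y ∈ O', ∀ v, Y y (Θ y (Y y (Θ y v))) = Y y (Θ y v) ∧ v - Y y (Θ y v) ∈ W := by
  -- On a complement `R` of the kernel, `Θ y₀` is injective. A left inverse of it, chosen once,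
  -- makes `B y` the identity at `y₀`, hence invertible for nearby `y`.
  obtain ⟨R, hR⟩ := W.exists_isCompl
  let T : R →ₗ[ℝ] (Fin N → ℝ) := (Θ y₀).toLinearMap.domRestrict R
  have hT : LinearMap.ker T = ⊥ := by
    rw [LinearMap.ker_eq_bot']
    intro r hr
    have h1 : (r : V) ∈ W := (hW y₀ hy₀ r).2 hr
    exact Subtype.ext (Submodule.disjoint_def.1 hR.disjoint _ h1 r.2)
  obtain ⟨L, hL⟩ := T.exists_leftInverse_of_injective hT
  let L' : (Fin N → ℝ) →L[ℝ] R := L.toContinuousLinearMap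
  let B : F → R →L[ℝ] R := fun y => L' ∘L (Θ y ∘L R.subtypeL)
  have hB : ContDiffOn ℝ ∞ B O := contDiffOn_const.clm_comp (hΘ.clm_comp contDiffOn_const)
  have hB0 : IsUnit (B y₀) := by
    have : B y₀ = 1 := by
      ext1 r
      exact congrArg (fun A : R →ₗ[ℝ] R => A r) hL
    rw [this]
    exact isUnit_one
  obtain ⟨O', hOO, hO', hy', K, hK, hKB⟩ := exists_contDiffOn_inverse hO hB hy₀ hB0
  refine ⟨O', hOO, hO', hy', fun y => R.subtypeL ∘L (K y ∘L L'),
    contDiffOn_const.clm_comp (hK.clm_comp contDiffOn_const), fun y hy v => ?_⟩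
  have h1 : ∀ r : R, R.subtypeL (K y (L' (Θ y (r : V)))) = r := fun r =>
    congrArg Subtype.val ((hKB y hy).1 r)
  refine ⟨h1 _, ?_⟩
  obtain ⟨w, hw, r, hr, rfl⟩ := Submodule.mem_sup.1 (hR.sup_eq_top ▸ Submodule.mem_top : v ∈ W ⊔ R)
  have h2 : Θ y (w + r) = Θ y r := by rw [map_add, (hW y (hOO hy) w).1 hw, zero_add]
  have h3 := h1 ⟨r, hr⟩
  simp only [ContinuousLinearMap.comp_apply, h2]
  rw [h3]
  simpa using hw

/-- A smooth family of forms vanishing on the common kernel of one-forms is locally a combination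
of these one-forms. -/
theorem exists_local_wedge_decomposition {k N : ℕ} {W : Submodule ℝ V}
    {θ : Fin N → F → V [⋀^Fin 1]→L[ℝ] ℝ} {η : F → V [⋀^Fin (k + 1)]→L[ℝ] ℝ} {O : Set F}
    (hO : IsOpen O) (hθ : ∀ j, ContDiffOn ℝ ∞ (θ j) O) (hη : ContDiffOn ℝ ∞ η O)
    (hW : ∀ y ∈ O, ∀ v, v ∈ W ↔ ∀ j, θ j y ![v] = 0)
    (hηW : ∀ y ∈ O, ∀ v, (∀ i, v i ∈ W) → η y v = 0) {y₀ : F} (hy₀ : y₀ ∈ O) :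
    ∃ O' ⊆ O, IsOpen O' ∧ y₀ ∈ O' ∧ ∃ α : Fin N → F → V [⋀^Fin k]→L[ℝ] ℝ,
      (∀ j, ContDiffOn ℝ ∞ (α j) O') ∧ ∀ y ∈ O', ∑ j, wedge (α j y) (θ j y) = η y := by
  let Θ : F → V →L[ℝ] (Fin N → ℝ) := fun y => ContinuousLinearMap.pi fun j =>
    (ContinuousAlternatingMap.ofSubsingleton ℝ V ℝ (0 : Fin 1)).symm (θ j y)
  have hΘj : ∀ y v j, Θ y v j = θ j y ![v] := fun y v j => by
    change θ j y (fun _ => v) = _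
    congr 1
    funext i
    fin_cases i
    rfl
  have hΘ : ContDiffOn ℝ ∞ Θ O := by
    rw [contDiffOn_clm_apply]
    intro v
    refine contDiffOn_pi.2 fun j => ?_
    simp only [hΘj]
    exact fun y hy => (contDiffAt_alternating_iff.1
      ((hθ j).contDiffAt (hO.mem_nhds hy)) ![v]).contDiffWithinAt
  obtain ⟨O', hOO, hO', hy', Y, hY, hYΘ⟩ := exists_generalized_inverse (W := W) hO hΘ
    (fun y hy v => by
      rw [hW y hy]
      constructor
      · intro h; funext j; rw [hΘj, h j]; rfl
      · intro h j; rw [← hΘj, h]; rfl) hy₀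
  -- `P y` is an idempotent whose complementary projection `Q y` takes values in `W`; thus `η`
  -- vanishes when all its arguments are of the form `Q v`.
  let P : F → V →L[ℝ] V := fun y => Y y ∘L Θ y
  let Q : F → V →L[ℝ] V := fun y => ContinuousLinearMap.id ℝ V - P y
  have hP : ContDiffOn ℝ ∞ P O' := hY.clm_comp (hΘ.mono hOO)
  have hQ : ContDiffOn ℝ ∞ Q O' := contDiffOn_const.sub hP
  -- As `P v = ∑ θ j v • Y e_j`, wedging the contractions by `Y e_j` with `θ j` makes `P` act as a
  -- derivation on the averaged form, and this returns `η`.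
  refine ⟨O', hOO, hO', hy', fun j y => (-1 : ℝ) ^ k •
    (averagedForm (P y) (Q y) (η y)).curryLeft (Y y (Pi.single j 1)), fun j y hy => ?_,
    fun y hy => ?_⟩
  · have hn := hO'.mem_nhds hy
    refine (contDiffAt_alternating_iff.2 fun v => ?_).contDiffWithinAt
    change ContDiffAt ℝ ∞ (fun y => (-1 : ℝ) ^ k *
      averagedForm (P y) (Q y) (η y) (Fin.cons (Y y (Pi.single j 1)) v)) y
    simp only [averagedForm_apply]
    refine contDiffAt_const.mul (ContDiffAt.sum fun S _ => contDiffAt_const.mul ?_)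
    refine ContDiffAt.alternating_apply (η := η) (v := fun y l => (if l ∈ S then P y else Q y)
      ((Fin.cons (Y y (Pi.single j 1)) v : Fin (k + 1) → V) l))
      (hη.contDiffAt (hO.mem_nhds (hOO hy))) fun l => ?_
    have h1 : ContDiffAt ℝ ∞
        (fun y => (Fin.cons (Y y (Pi.single j 1)) v : Fin (k + 1) → V) l) y := by
      refine Fin.cases ?_ (fun i => ?_) l
      · exact (hY.contDiffAt hn).clm_apply contDiffAt_const
      · exact contDiffAt_const
    by_cases hl : l ∈ S
    · simp only [hl, if_true]
      exact (hP.contDiffAt hn).clm_apply h1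
    · simp only [hl, if_false]
      exact (hQ.contDiffAt hn).clm_apply h1
  · ext v
    rw [ContinuousAlternatingMap.sum_apply, sum_wedge_curryLeft]
    have h2 : ∀ v, ∑ j, θ j y ![v] • Y y (Pi.single j 1) = P y v := by
      intro v
      change _ = Y y (Θ y v)
      conv_rhs => rw [← Finset.univ_sum_single (Θ y v), map_sum]
      refine Finset.sum_congr rfl fun j _ => ?_
      rw [hΘj, ← map_smul, ← Pi.single_smul, smul_eq_mul, mul_one]
    simp only [h2]
    exact sum_averagedForm_update (fun v => (hYΘ y hy v).1) (fun v => rfl)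
      (fun v => hηW y (hOO hy) _ fun i => (hYΘ y hy (v i)).2) v

end Smooth

/-! ### The ideal of a foliation -/

section Ideal

variable {m : ℕ} {M : Type*} [TopologicalSpace M] [ChartedSpace (EuclideanSpace ℝ (Fin m)) M]
  [IsManifold (𝓡 m) ∞ M] {p : ℕ} {D : Distribution m M}

theorem wedge_add_left {V : Type*} [AddCommGroup V] [Module ℝ V] [TopologicalSpace V] {k l : ℕ}
    (α α' : V [⋀^Fin k]→L[ℝ] ℝ) (β : V [⋀^Fin l]→L[ℝ] ℝ) :
    wedge (α + α') β = wedge α β + wedge α' β := by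
  ext v
  simp only [wedge_apply, ContinuousAlternatingMap.add_apply, add_mul, mul_add,
    Finset.sum_add_distrib]

theorem wedge_smul_left {V : Type*} [AddCommGroup V] [Module ℝ V] [TopologicalSpace V] {k l : ℕ}
    (c : ℝ) (α : V [⋀^Fin k]→L[ℝ] ℝ) (β : V [⋀^Fin l]→L[ℝ] ℝ) :
    wedge (c • α) β = c • wedge α β := by
  ext v
  simp only [wedge_apply, ContinuousAlternatingMap.smul_apply, smul_eq_mul, Finset.mul_sum]
  exact Finset.sum_congr rfl fun σ _ => by ring

theorem chartPullback_pullbackForm {k : ℕ} {φ : OpenPartialHomeomorph M (𝔼 m)}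
    (hφ : φ ∈ maximalAtlas (𝓡 m) ∞ M) (θ : Form m M k) {x : M} (hx : x ∈ φ.source) :
    chartPullback φ (pullbackForm φ.symm θ) x = θ x := by
  ext v
  exact (form_apply_eq hφ θ hx v).symm

theorem chartPullback_wedge {k l : ℕ} (φ : OpenPartialHomeomorph M (𝔼 m))
    (α : 𝔼 m → 𝔼 m [⋀^Fin k]→L[ℝ] ℝ) (β : 𝔼 m → 𝔼 m [⋀^Fin l]→L[ℝ] ℝ) (x : M) :
    wedge (chartPullback φ α x) (chartPullback φ β x)
      = chartPullback φ (fun y => wedge (α y) (β y)) x :=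
  wedge_compContinuousLinearMap _ _ _

/-- The ideal of a foliation consists of the smooth forms which vanish on the leaves. -/
theorem IsFoliation.mem_foliationIdeal_iff [T2Space M] [SecondCountableTopology M]
    (hD : IsFoliation p D) {k : ℕ} {η : Form m M k} :
    η ∈ foliationIdeal D k ↔ SmoothForm η ∧ VanishesOn D η := by
  have : LocallyCompactSpace M := ChartedSpace.locallyCompactSpace (𝔼 m) M
  constructor
  · intro h
    cases k with
    | zero =>
      rw [show η = 0 from (Submodule.mem_bot ℝ).1 h]
      exact ⟨smoothForm_zero m M 0, fun _ _ _ => rfl⟩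
    | succ k =>
      refine Submodule.span_induction (p := fun η _ => SmoothForm η ∧ VanishesOn D η)
        ?_ ?_ ?_ ?_ h
      · rintro _ ⟨α, θ, hα, hθ, hθD, rfl⟩
        exact ⟨hα.wedgeForm hθ, hθD.wedgeForm_left⟩
      · exact ⟨smoothForm_zero m M _, fun _ _ _ => rfl⟩
      · rintro a b _ _ ⟨ha, ha'⟩ ⟨hb, hb'⟩
        refine ⟨ha.add hb, fun x v hv => ?_⟩
        change a x v + b x v = 0
        rw [ha' x v hv, hb' x v hv, add_zero]
      · rintro c a _ ⟨ha, ha'⟩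
        refine ⟨ha.smul c, fun x v hv => ?_⟩
        change c * a x v = 0
        rw [ha' x v hv, mul_zero]
  · rintro ⟨hη, hηD⟩
    cases k with
    | zero =>
      refine (Submodule.mem_bot ℝ).2 ?_
      funext x
      ext v
      exact hηD x v fun i => i.elim0
    | succ k =>
      obtain ⟨θ, hθ, hθD, hker⟩ := hD.exists_oneForms
      -- With the `θ j` global and fixed, the equation for the coefficients `α` is affine, hence
      -- convex, and local solutions can be averaged.
      obtain ⟨α, hα, hαη⟩ := exists_smoothForm_of_local (ι := Fin (2 * m + 1)) (k := k)
        (fun x => {α | ∑ j, wedge (α j) (θ j x) = η x}) (fun x => by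
          intro α hα β hβ a b _ _ hab
          simp only [mem_ofPred_eq, Pi.add_apply, Pi.smul_apply, wedge_add_left, wedge_smul_left,
            Finset.sum_add_distrib, ← Finset.smul_sum] at *
          rw [hα, hβ, ← add_smul, hab, one_smul]) (fun x₀ => by
          obtain ⟨φ, hφ, hx, W, hW, hDW⟩ := hD x₀
          have hDW' : ∀ y ∈ φ.target, ∀ v : 𝔼 m,
              v ∈ W ↔ mfderiv (𝓡 m) (𝓡 m) φ.symm y v ∈ D (φ.symm y) := by
            intro y hy v
            rw [hDW _ (φ.map_target hy), mfderiv_mfderiv_symm hφ hy]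
            exact Iff.rfl
          obtain ⟨O', hOO, hO', hy', α, hα, hαη⟩ := exists_local_wedge_decomposition
            (W := W) (θ := fun j => pullbackForm φ.symm (θ j)) φ.open_target
            (fun j => (hθ j).contDiffOn_chart hφ) (hη.contDiffOn_chart hφ)
            (fun y hy v => by
              rw [hDW' y hy]
              have h1 : ∀ j, pullbackForm φ.symm (θ j) y ![v]
                  = θ j (φ.symm y) ![mfderiv (𝓡 m) (𝓡 m) φ.symm y v] := fun j => by
                change θ j (φ.symm y) (fun i => mfderiv (𝓡 m) (𝓡 m) φ.symm y (![v] i)) = _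
                congr 1
                funext i
                fin_cases i
                rfl
              constructor
              · intro h j
                rw [h1]
                refine hθD j _ _ fun i => ?_
                fin_cases i
                exact h
              · intro h
                exact hker _ _ fun j => by rw [← h1, h j])
            (fun y hy v hv => hηD (φ.symm y) (fun i => mfderiv (𝓡 m) (𝓡 m) φ.symm y (v i))
              fun i => (hDW' y hy (v i)).1 (hv i)) (φ.map_source hx)
          refine ⟨φ, hφ, hx, O', hO', hy', α, hα, fun x hx hxO => ?_⟩
          have h2 : ∀ j, wedge (chartPullback φ (α j) x) (θ j x) = chartPullback φ
              (fun y => wedge (α j y) (pullbackForm φ.symm (θ j) y)) x := fun j => by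
            rw [← chartPullback_wedge, chartPullback_pullbackForm hφ (θ j) hx]
          rw [mem_ofPred_eq, Finset.sum_congr rfl fun j _ => h2 j,
            ← chartPullback_pullbackForm hφ η hx]
          ext v
          rw [ContinuousAlternatingMap.sum_apply]
          have h3 := congrArg (fun A : 𝔼 m [⋀^Fin (k + 1)]→L[ℝ] ℝ =>
            A fun i => chartDeriv φ x (v i)) (hαη _ hxO)
          simp only [ContinuousAlternatingMap.sum_apply] at h3
          exact h3)
      have h4 : η = ∑ j, wedgeForm (α j) (θ j) := by
        funext x
        rw [Finset.sum_apply]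
        exact (hαη x).symm
      rw [h4]
      exact Submodule.sum_mem _ fun j _ =>
        Submodule.subset_span ⟨α j, θ j, hα j, hθ j, hθD j, rfl⟩

/-- The ideal of a foliation is a differential ideal. -/
theorem IsFoliation.isDifferentialIdeal [T2Space M] [SecondCountableTopology M]
    (hD : IsFoliation p D) : IsDifferentialIdeal (foliationIdeal D) where
  smooth k η h := (hD.mem_foliationIdeal_iff.1 h).1
  wedge_left k l α hα η hη := by
    rw [hD.mem_foliationIdeal_iff] at *
    exact ⟨hα.wedgeForm hη.1, hη.2.wedgeForm_left⟩
  wedge_right k l α hα η hη := by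
    rw [hD.mem_foliationIdeal_iff] at *
    exact ⟨hη.1.wedgeForm hα, hη.2.wedgeForm_right⟩
  extD_mem k η hη := by
    rw [hD.mem_foliationIdeal_iff] at *
    exact ⟨smoothForm_extD hη.1, hD.vanishesOn_extD hη.1 hη.2⟩

/-- The one-forms in the ideal of a foliation define the foliation. -/
theorem IsFoliation.mem_iff_foliationIdeal [T2Space M] [SecondCountableTopology M]
    (hD : IsFoliation p D) (x : M) (v : TangentSpace (𝓡 m) x) :
    v ∈ D x ↔ ∀ θ ∈ foliationIdeal D 1, θ x ![v] = 0 := by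
  constructor
  · intro hv θ hθ
    refine (hD.mem_foliationIdeal_iff.1 hθ).2 x _ fun i => ?_
    fin_cases i
    exact hv
  · intro h
    obtain ⟨θ, hθ, hθD, hker⟩ := hD.exists_oneForms
    exact hker x v fun i => h _ (hD.mem_foliationIdeal_iff.2 ⟨hθ i, hθD i⟩)

end Ideal

/-! ### Smoothness of composition operators -/

section Composition

variable {A B : Type} [NormedAddCommGroup A] [NormedSpace ℝ A] [NormedAddCommGroup B]
  [NormedSpace ℝ B]

/-- Pointwise application of curves of linear maps to curves. -/
noncomputable def applyCurve (A B : Type) [NormedAddCommGroup A] [NormedSpace ℝ A]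
    [NormedAddCommGroup B] [NormedSpace ℝ B] :
    C(unitInterval, A →L[ℝ] B) →L[ℝ] C(unitInterval, A) →L[ℝ] C(unitInterval, B) :=
  LinearMap.mkContinuous₂ (E := C(unitInterval, A →L[ℝ] B)) (F := C(unitInterval, A))
    (G := C(unitInterval, B))
    (LinearMap.mk₂ ℝ (fun (T : C(unitInterval, A →L[ℝ] B)) (h : C(unitInterval, A)) =>
      (⟨fun s => T s (h s), by fun_prop⟩ : C(unitInterval, B)))
    (fun _ _ _ => by ext; simp) (fun _ _ _ => by ext; simp) (fun _ _ _ => by ext; simp)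
    (fun _ _ _ => by ext; simp)) 1 (fun T h => by
      refine (ContinuousMap.norm_le _ (by positivity)).2 fun s => ?_
      rw [one_mul]
      exact ((T s).le_opNorm _).trans (mul_le_mul (T.norm_coe_le_norm s) (h.norm_coe_le_norm s)
        (norm_nonneg _) ((norm_nonneg (T s)).trans (T.norm_coe_le_norm s))))

/-- Postcomposition with `G'` is continuous for the uniform norm, so `G'` varies by at most `c`
between `γ` and nearby curves, uniformly in the parameter. The mean value inequality on the segment
from `γ s` to `γ' s` then bounds the remainder. -/
theorem hasFDerivAt_comp_curve {G : C(A, B)} {G' : C(A, A →L[ℝ] B)}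
    (hG : ∀ a, HasFDerivAt G (G' a) a) (γ : C(unitInterval, A)) :
    HasFDerivAt (fun γ : C(unitInterval, A) => G.comp γ) (applyCurve A B (G'.comp γ)) γ := by
  refine HasFDerivAt.of_isLittleO (Asymptotics.isLittleO_iff.2 fun c hc => ?_)
  have hcont := (ContinuousMap.continuous_postcomp (X := unitInterval) G').continuousAt (x := γ)
  obtain ⟨δ, hδ, hball⟩ := Metric.continuousAt_iff (α := C(unitInterval, A))
    (β := C(unitInterval, A →L[ℝ] B)).1 hcont c hc
  filter_upwards [Metric.ball_mem_nhds γ hδ] with γ' hγ'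
  refine (ContinuousMap.norm_le _ (by positivity)).2 fun s => ?_
  have h1 : ∀ a ∈ segment ℝ (γ s) (γ' s), ‖G' a - G' (γ s)‖ ≤ c := by
    intro a ha
    rw [segment_eq_image'] at ha
    obtain ⟨t, ht, rfl⟩ := ha
    have h2 : dist (γ + t • (γ' - γ)) γ < δ := by
      rw [dist_eq_norm, add_sub_cancel_left, norm_smul, Real.norm_of_nonneg ht.1]
      rw [Metric.mem_ball, dist_eq_norm] at hγ'
      exact (mul_le_of_le_one_left (norm_nonneg _) ht.2).trans_lt hγ'
    have h3 := hball h2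
    rw [← dist_eq_norm]
    exact (ContinuousMap.dist_apply_le_dist (f := G'.comp (γ + t • (γ' - γ))) (g := G'.comp γ)
      s).trans h3.le
  have h4 := (convex_segment (γ s) (γ' s)).norm_image_sub_le_of_norm_hasFDerivWithin_le' (𝕜 := ℝ)
    (fun a _ => (hG a).hasFDerivWithinAt) h1 (left_mem_segment ℝ _ _) (right_mem_segment ℝ _ _)
  refine h4.trans (mul_le_mul_of_nonneg_left ?_ hc.le)
  exact ContinuousMap.norm_coe_le_norm (γ' - γ) s

/-- The composition operator with a smooth map is smooth. -/
theorem contDiff_comp_curve (G : C(A, B)) (hG : ContDiff ℝ ∞ G) :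
    ContDiff ℝ ∞ (fun γ : C(unitInterval, A) => G.comp γ) := by
  rw [contDiff_infty]
  intro n
  -- The target must vary: the derivative is built from composition with `fderiv ℝ G`, which takes
  -- values in `A →L[ℝ] B`.
  induction n generalizing B with
  | zero =>
    exact contDiff_zero.2 (ContinuousMap.continuous_postcomp G)
  | succ n ih =>
    let G' : C(A, A →L[ℝ] B) := ⟨fderiv ℝ G, hG.continuous_fderiv (by simp)⟩
    have hG' : ∀ a, HasFDerivAt G (G' a) a := fun a =>
      (hG.differentiable (by simp) a).hasFDerivAt
    have hd := hasFDerivAt_comp_curve hG'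
    push_cast
    refine contDiff_succ_iff_fderiv.2 ⟨fun γ => (hd γ).differentiableAt, by simp, ?_⟩
    rw [funext fun γ => (hd γ).fderiv]
    exact (ContinuousLinearMap.contDiff (E := C(unitInterval, A →L[ℝ] B))
      (F := C(unitInterval, A) →L[ℝ] C(unitInterval, B)) (applyCurve A B)).comp
      (ih G' (hG.fderiv_right (by simp)))

/-- The antiderivative of a curve that vanishes at `0`. -/
noncomputable def primitive (γ : C(unitInterval, B)) (t : ℝ) : B :=
  ∫ s in (0 : ℝ)..t, γ (projIcc 0 1 zero_le_one s)

/-- Extending the curve constantly beyond the interval gives two-sided derivatives at the endpoints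
as well. -/
theorem hasDerivAt_primitive [CompleteSpace B] (γ : C(unitInterval, B)) (t : ℝ) :
    HasDerivAt (primitive γ) (γ (projIcc 0 1 zero_le_one t)) t := by
  have hc : Continuous fun s => γ (projIcc (0 : ℝ) 1 zero_le_one s) :=
    γ.continuous.comp continuous_projIcc
  exact (hc.integral_hasStrictDerivAt 0 t).hasDerivAt

/-- Integration of curves. -/
noncomputable def integrateCurve (B : Type) [NormedAddCommGroup B] [NormedSpace ℝ B]
    [CompleteSpace B] : C(unitInterval, B) →L[ℝ] C(unitInterval, B) :=
  LinearMap.mkContinuous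
    { toFun := fun γ => ⟨fun t => primitive γ t, by
        have h : Continuous (primitive γ) :=
          continuous_iff_continuousAt.2 fun t => (hasDerivAt_primitive γ t).continuousAt
        exact h.comp continuous_subtype_val⟩
      map_add' := fun γ δ => by
        ext t
        refine intervalIntegral.integral_add ?_ ?_
        · exact (γ.continuous.comp continuous_projIcc).intervalIntegrable _ _
        · exact (δ.continuous.comp continuous_projIcc).intervalIntegrable _ _
      map_smul' := fun c γ => by
        ext t
        exact intervalIntegral.integral_smul c _ } 1 (fun γ => by
    refine (ContinuousMap.norm_le _ (by positivity)).2 fun t => ?_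
    refine (intervalIntegral.norm_integral_le_of_norm_le_const (C := ‖γ‖) fun s _ =>
      γ.norm_coe_le_norm _).trans ?_
    rw [one_mul, sub_zero, abs_of_nonneg t.2.1]
    exact mul_le_of_le_one_right (norm_nonneg _) t.2.2)

/-- Constant curves. -/
noncomputable def constCurve (B : Type) [NormedAddCommGroup B] [NormedSpace ℝ B] :
    B →L[ℝ] C(unitInterval, B) :=
  LinearMap.mkContinuous
    { toFun := fun b => ContinuousMap.const _ b
      map_add' := fun _ _ => rfl
      map_smul' := fun _ _ => rfl } 1 (fun b => by
    refine (ContinuousMap.norm_le _ (by positivity)).2 fun t => ?_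
    rw [one_mul]
    rfl)

end Composition

/-! ### The inverse function theorem on a neighbourhood -/

/-- The inverse function theorem at `a` gives smoothness of the inverse only at the image of `a`.
Restricting to the open set where the derivative is invertible gives it on the whole target. -/
theorem exists_smooth_localInverse {E F : Type*} [NormedAddCommGroup E] [NormedSpace ℝ E]
    [CompleteSpace E] [NormedAddCommGroup F] [NormedSpace ℝ F] {f : E → F} {O : Set E}
    (hO : IsOpen O) (hf : ContDiffOn ℝ ∞ f O) {a : E} (ha : a ∈ O) (f' : E ≃L[ℝ] F)
    (hf' : HasFDerivAt f (f' : E →L[ℝ] F) a) :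
    ∃ e : OpenPartialHomeomorph E F, a ∈ e.source ∧ e.source ⊆ O ∧ ⇑e = f ∧
      ContDiffOn ℝ ∞ e.symm e.target := by
  have hfa : ContDiffAt ℝ ∞ f a := hf.contDiffAt (hO.mem_nhds ha)
  let e₀ := hfa.toOpenPartialHomeomorph f hf' (by simp)
  have hcont : ContinuousOn (fderiv ℝ f) O :=
    (hf.continuousOn_fderiv_of_isOpen hO (by simp))
  let U : Set E := O ∩ fderiv ℝ f ⁻¹' range ((↑) : (E ≃L[ℝ] F) → E →L[ℝ] F)
  have hU : IsOpen U := hcont.isOpen_inter_preimage hO ContinuousLinearEquiv.isOpen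
  refine ⟨e₀.restrOpen U hU, ?_, fun x hx => hx.2.1, rfl, ?_⟩
  · exact ⟨hfa.mem_toOpenPartialHomeomorph_source hf' (by simp), ha, f', hf'.fderiv.symm⟩
  · intro y hy
    set e := e₀.restrOpen U hU
    have hx : e.symm y ∈ U := (e.map_target hy).2
    obtain ⟨g, hg⟩ := hx.2
    have hfx : ContDiffAt ℝ ∞ f (e.symm y) := hf.contDiffAt (hO.mem_nhds hx.1)
    refine (e.contDiffAt_symm (f₀' := g) hy ?_ hfx).contDiffWithinAt
    rw [hg]
    exact (hfx.differentiableAt (by simp)).hasFDerivAt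

/-! ### The theorem of Frobenius for a distribution given as a graph -/

section Frobenius

variable {X Z : Type} [NormedAddCommGroup X] [NormedSpace ℝ X] [NormedAddCommGroup Z]
  [NormedSpace ℝ Z]

/-- The right-hand side of the differential equation for the leaves along rays. -/
def rayField (F : X × Z → X →L[ℝ] Z) (x₀ : X) (q : ℝ × X × Z) : Z :=
  F (x₀ + q.1 • q.2.1, q.2.2) q.2.1

theorem contDiff_rayField {F : X × Z → X →L[ℝ] Z} (hF : ContDiff ℝ ∞ F) (x₀ : X) :
    ContDiff ℝ ∞ (rayField F x₀) := by
  have h : ContDiff ℝ ∞ fun q : ℝ × X × Z => (x₀ + q.1 • q.2.1, q.2.2) := by fun_prop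
  exact (hF.comp h).clm_apply (by fun_prop)

/-- Linearization at frozen time in the direction and the state: the right-hand side of the
variational equation in `deriv_rays_eq`. -/
theorem fderiv_rayField_apply {F : X × Z → X →L[ℝ] Z} (hF : ContDiff ℝ ∞ F) (x₀ : X)
    (q : ℝ × X × Z) (u : X) (w : Z) :
    fderiv ℝ (rayField F x₀) q (0, u, w) = F (x₀ + q.1 • q.2.1, q.2.2) u
      + fderiv ℝ F (x₀ + q.1 • q.2.1, q.2.2) (q.1 • u, w) q.2.1 := by
  have h1 : HasFDerivAt (fun q : ℝ × X × Z => x₀ + q.1 • q.2.1) _ q :=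
    (((hasFDerivAt_id (𝕜 := ℝ) q).fst).smul (hasFDerivAt_id (𝕜 := ℝ) q).snd.fst).const_add x₀
  have h2 := h1.prodMk (hasFDerivAt_id (𝕜 := ℝ) q).snd.snd
  have h3 := ((hF.differentiable (by simp) (x₀ + q.1 • q.2.1, q.2.2)).hasFDerivAt.comp q
    h2).clm_apply (hasFDerivAt_id (𝕜 := ℝ) q).snd.fst
  have h4 : HasFDerivAt (rayField F x₀) _ q := h3
  rw [h4.fderiv]
  simp

/-- The curve `s ↦ (s, x, γ s)`, up to the constant part `s ↦ (s, 0, 0)`. -/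
noncomputable def rayCurve (X Z : Type) [NormedAddCommGroup X] [NormedSpace ℝ X]
    [NormedAddCommGroup Z] [NormedSpace ℝ Z] :
    X × C(unitInterval, Z) →L[ℝ] C(unitInterval, ℝ × X × Z) :=
  (ContinuousLinearMap.compLeftContinuous ℝ unitInterval
      ((ContinuousLinearMap.inr ℝ ℝ (X × Z)) ∘L ContinuousLinearMap.inl ℝ X Z)) ∘L
    (constCurve X ∘L ContinuousLinearMap.fst ℝ X C(unitInterval, Z))
  + (ContinuousLinearMap.compLeftContinuous ℝ unitInterval
      ((ContinuousLinearMap.inr ℝ ℝ (X × Z)) ∘L ContinuousLinearMap.inr ℝ X Z)) ∘L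
    ContinuousLinearMap.snd ℝ X C(unitInterval, Z)

theorem rayCurve_apply (x : X) (γ : C(unitInterval, Z)) (s : unitInterval) :
    rayCurve X Z (x, γ) s = (0, x, γ s) := by
  have : rayCurve X Z (x, γ) s = ((0 : ℝ), x, (0 : Z)) + ((0 : ℝ), (0 : X), γ s) := rfl
  rw [this]
  simp

/-- The curve `s ↦ (s, 0, 0)`. -/
def timeCurve (X Z : Type) [NormedAddCommGroup X] [NormedAddCommGroup Z] :
    C(unitInterval, ℝ × X × Z) := ⟨fun s => (s, 0, 0), by fun_prop⟩

theorem timeCurve_add_rayCurve (x : X) (γ : C(unitInterval, Z)) (s : unitInterval) :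
    (timeCurve X Z + rayCurve X Z (x, γ)) s = ((s : ℝ), x, γ s) := by
  rw [ContinuousMap.add_apply, rayCurve_apply]
  simp [timeCurve]

variable [CompleteSpace Z]

/-- The defect of the integral equation for leaves along rays. -/
noncomputable def rayDefect (G : C(ℝ × X × Z, Z)) (q : (X × Z) × C(unitInterval, Z)) :
    C(unitInterval, Z) :=
  q.2 - constCurve Z q.1.2
    - integrateCurve Z (G.comp (timeCurve X Z + rayCurve X Z (q.1.1, q.2)))

theorem contDiff_rayDefect {G : C(ℝ × X × Z, Z)} (hG : ContDiff ℝ ∞ G) :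
    ContDiff ℝ ∞ (rayDefect G) := by
  have h1 : ContDiff ℝ ∞ fun q : (X × Z) × C(unitInterval, Z) =>
      constCurve Z q.1.2 := (constCurve Z).contDiff.comp (by fun_prop)
  have h2 : ContDiff ℝ ∞ (rayCurve X Z) := ContinuousLinearMap.contDiff
    (E := X × C(unitInterval, Z)) (F := C(unitInterval, ℝ × X × Z)) _
  have h3 : ContDiff ℝ ∞ fun q : (X × Z) × C(unitInterval, Z) =>
      timeCurve X Z + rayCurve X Z (q.1.1, q.2) := contDiff_const.add (h2.comp (by fun_prop))
  have h4 : ContDiff ℝ ∞ (integrateCurve Z) := ContinuousLinearMap.contDiff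
    (E := C(unitInterval, Z)) (F := C(unitInterval, Z)) _
  exact (contDiff_snd.sub h1).sub (h4.comp ((contDiff_comp_curve G hG).comp h3))

/-- Differentiating a family of solutions with this formula yields the linear integral equation
satisfied by its variations. -/
theorem hasFDerivAt_rayDefect {G : C(ℝ × X × Z, Z)} {G' : C(ℝ × X × Z, (ℝ × X × Z) →L[ℝ] Z)}
    (hG : ∀ a, HasFDerivAt G (G' a) a) (q : (X × Z) × C(unitInterval, Z)) :
    ∃ T : (X × Z) × C(unitInterval, Z) →L[ℝ] C(unitInterval, Z), HasFDerivAt (rayDefect G) T q ∧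
      ∀ u w h, T ((u, w), h) = h - constCurve Z w - integrateCurve Z (applyCurve (ℝ × X × Z) Z
        (G'.comp (timeCurve X Z + rayCurve X Z (q.1.1, q.2))) (rayCurve X Z (u, h))) := by
  have hid := hasFDerivAt_id (𝕜 := ℝ) q
  have h1 := (ContinuousLinearMap.hasFDerivAt (E := Z) (F := C(unitInterval, Z))
    (constCurve Z)).comp q hid.fst.snd
  have h2 := (ContinuousLinearMap.hasFDerivAt (E := X × C(unitInterval, Z))
    (F := C(unitInterval, ℝ × X × Z)) (rayCurve X Z) (x := (q.1.1, q.2))).comp q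
    (hid.fst.fst.prodMk hid.snd)
  have h3 := (hasFDerivAt_comp_curve hG (timeCurve X Z + rayCurve X Z (q.1.1, q.2))).comp q
    (h2.const_add (timeCurve X Z))
  have h4 := (ContinuousLinearMap.hasFDerivAt (E := C(unitInterval, Z))
    (F := C(unitInterval, Z)) (integrateCurve Z)).comp q h3
  exact ⟨_, (hid.snd.sub h1).sub h4, fun u w h => rfl⟩

/-- Smooth dependence of the solutions on the direction and the initial value. -/
theorem exists_smooth_rays [CompleteSpace X] {G : C(ℝ × X × Z, Z)} (hG : ContDiff ℝ ∞ G)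
    (h0 : ∀ s z, G (s, 0, z) = 0) (z₀ : Z) :
    ∃ (N : Set (X × Z)) (S : X × Z → C(unitInterval, Z)), IsOpen N ∧ (0, z₀) ∈ N ∧
      ContDiffOn ℝ ∞ S N ∧ ∀ p ∈ N, rayDefect G (p, S p) = 0 := by
  let a : (X × Z) × C(unitInterval, Z) := ((0, z₀), constCurve Z z₀)
  have hΦ := contDiff_rayDefect hG
  -- In direction `0` the field vanishes, so the defect is affine in `γ` and its partial derivative
  -- in `γ` is the identity.
  have hΦ0 : ∀ z γ, rayDefect G ((0, z), γ) = γ - constCurve Z z := by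
    intro z γ
    have h1 : G.comp (timeCurve X Z + rayCurve X Z (0, γ)) = 0 := by
      ext s
      rw [ContinuousMap.comp_apply, timeCurve_add_rayCurve, h0]
      rfl
    change γ - constCurve Z z
      - integrateCurve Z (G.comp (timeCurve X Z + rayCurve X Z (0, γ))) = _
    rw [h1, map_zero, sub_zero]
  have hΦa := (hΦ.differentiable (by simp) a).hasFDerivAt
  have hinr : ∀ h, fderiv ℝ (rayDefect G) a (0, h) = h := by
    intro h
    have h1 : HasFDerivAt (fun γ : C(unitInterval, Z) => (((0 : X), z₀), γ))
        (ContinuousLinearMap.inr ℝ (X × Z) C(unitInterval, Z)) (constCurve Z z₀) :=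
      (hasFDerivAt_const ((0 : X), z₀) _).prodMk (hasFDerivAt_id _)
    have h2 := hΦa.comp (constCurve Z z₀) h1
    have h3 : HasFDerivAt (fun γ : C(unitInterval, Z) => rayDefect G ((0, z₀), γ))
        (ContinuousLinearMap.id ℝ _) (constCurve Z z₀) := by
      simp only [hΦ0]
      exact (hasFDerivAt_id _).sub_const _
    exact congrArg (fun T : C(unitInterval, Z) →L[ℝ] C(unitInterval, Z) => T h) (h2.unique h3)
  -- Keeping the parameters as a first component turns the implicit function theorem into inversion
  -- of `f`, whose derivative is triangular.
  let f : (X × Z) × C(unitInterval, Z) → (X × Z) × C(unitInterval, Z) :=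
    fun q => (q.1, rayDefect G q)
  let f' : ((X × Z) × C(unitInterval, Z)) ≃L[ℝ] (X × Z) × C(unitInterval, Z) :=
    ContinuousLinearEquiv.skewProd (ContinuousLinearEquiv.refl ℝ (X × Z))
      (ContinuousLinearEquiv.refl ℝ C(unitInterval, Z))
      (fderiv ℝ (rayDefect G) a ∘L ContinuousLinearMap.inl ℝ (X × Z) C(unitInterval, Z))
  have hf' : HasFDerivAt f (f' : _ →L[ℝ] (X × Z) × C(unitInterval, Z)) a := by
    refine ((hasFDerivAt_id (𝕜 := ℝ) a).fst.prodMk hΦa).congr_fderiv ?_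
    refine ContinuousLinearMap.ext fun q => ?_
    have h5 : fderiv ℝ (rayDefect G) a q = q.2 + fderiv ℝ (rayDefect G) a (q.1, 0) := by
      conv_lhs => rw [show q = (0, q.2) + (q.1, 0) by simp]
      rw [map_add, hinr]
    exact Prod.ext rfl h5
  obtain ⟨e, hae, -, hef, hes⟩ := exists_smooth_localInverse isOpen_univ
    (contDiff_fst.prodMk hΦ).contDiffOn (mem_univ a) f' hf'
  have hc : Continuous fun p : X × Z => (p, (0 : C(unitInterval, Z))) := by fun_prop
  have hfa : f a = ((0, z₀), 0) := by
    change ((0, z₀), rayDefect G ((0, z₀), constCurve Z z₀)) = _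
    rw [hΦ0, sub_self]
  refine ⟨(fun p => (p, 0)) ⁻¹' e.target, fun p => (e.symm (p, 0)).2,
    e.open_target.preimage hc, ?_, ?_, ?_⟩
  · rw [mem_preimage, ← hfa, ← show e a = f a from congrFun hef a]
    exact e.map_source hae
  · have hcd : ContDiff ℝ ∞ fun p : X × Z => (p, (0 : C(unitInterval, Z))) :=
      contDiff_id.prodMk contDiff_const
    exact contDiff_snd.comp_contDiffOn (hes.comp hcd.contDiffOn fun p hp => hp)
  · intro p hp
    have h6 : f (e.symm (p, 0)) = (p, 0) := by
      rw [← show e (e.symm (p, 0)) = f (e.symm (p, 0)) from congrFun hef _]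
      exact e.right_inv hp
    have h7 : (e.symm (p, 0)).1 = p := congrArg Prod.fst h6
    have h8 : rayDefect G (e.symm (p, 0)) = 0 := congrArg Prod.snd h6
    rwa [show e.symm (p, 0) = (p, (e.symm (p, 0)).2) from Prod.ext h7 rfl] at h8

/-- The derivative of the solutions with respect to the direction. -/
theorem deriv_rays_eq {F : X × Z → X →L[ℝ] Z} (hF : ContDiff ℝ ∞ F) {x₀ : X}
    {G : C(ℝ × X × Z, Z)} (hG : ∀ q, G q = rayField F x₀ q)
    {G' : C(ℝ × X × Z, (ℝ × X × Z) →L[ℝ] Z)} (hG' : ∀ q, G' q = fderiv ℝ (rayField F x₀) q)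
    {O : Set (X × Z)}
    (hint : ∀ q ∈ O, ∀ u v, fderiv ℝ F q (u, F q u) v = fderiv ℝ F q (v, F q v) u)
    {x : X} {z : Z} {γ : C(unitInterval, Z)} (hγ : rayDefect G ((x, z), γ) = 0)
    (hO : ∀ t : unitInterval, (x₀ + (t : ℝ) • x, γ t) ∈ O) {u : X} {h : C(unitInterval, Z)}
    (hh : h = integrateCurve Z (applyCurve (ℝ × X × Z) Z
        (G'.comp (timeCurve X Z + rayCurve X Z (x, γ))) (rayCurve X Z (u, h)))) :
    h 1 = F (x₀ + x, γ 1) u := by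
  set c := timeCurve X Z + rayCurve X Z (x, γ) with hc
  have hcs : ∀ s : unitInterval, c s = ((s : ℝ), x, γ s) := fun s => timeCurve_add_rayCurve x γ s
  let g := G.comp c
  let k := applyCurve (ℝ × X × Z) Z (G'.comp c) (rayCurve X Z (u, h))
  let γ' : ℝ → Z := fun t => z + primitive g t
  have hγt : ∀ t : unitInterval, γ t = γ' t := by
    intro t
    have h1 := congrArg (fun δ : C(unitInterval, Z) => δ t) hγ
    have h2 : γ t - z - primitive g t = 0 := h1
    rw [sub_sub, sub_eq_zero] at h2
    exact h2
  have hht : ∀ t : unitInterval, h t = primitive k t := fun t =>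
    congrArg (fun δ : C(unitInterval, Z) => δ t) hh
  let π : ℝ → unitInterval := projIcc 0 1 zero_le_one
  have hπ : ∀ t ∈ Icc (0 : ℝ) 1, (π t : ℝ) = t := fun t ht => by
    simp only [π, projIcc_of_mem zero_le_one ht]
  have hγ'd : ∀ t ∈ Icc (0 : ℝ) 1, HasDerivAt γ' (F (x₀ + t • x, γ' t) x) t := by
    intro t ht
    have h1 := (hasDerivAt_primitive g t).const_add z
    have h2 : g (π t) = F (x₀ + t • x, γ' t) x := by
      change G (c (π t)) = _
      rw [hcs, hG, hγt, hπ t ht]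
      rfl
    exact h2 ▸ h1
  let v : ℝ → Z → Z := fun t w => G' (c (π t)) (0, u, w)
  -- `R` is the variation expected if the rays sweep out leaves. It satisfies the same linear
  -- equation as `primitive k` and also vanishes at `0`, so the two coincide.
  let R : ℝ → Z := fun t => t • F (x₀ + t • x, γ' t) u
  have hkd : ∀ t ∈ Icc (0 : ℝ) 1, HasDerivAt (primitive k) (v t (primitive k t)) t := by
    intro t ht
    have h1 := hasDerivAt_primitive k t
    have h2 : k (π t) = v t (primitive k t) := by
      change G' (c (π t)) (rayCurve X Z (u, h) (π t)) = _
      rw [rayCurve_apply, hht, hπ t ht]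
    exact h2 ▸ h1
  have hRd : ∀ t ∈ Icc (0 : ℝ) 1, HasDerivAt R (v t (R t)) t := by
    intro t ht
    have h1 : HasDerivAt (fun t : ℝ => x₀ + t • x) x t := by
      simpa using ((hasDerivAt_id t).smul_const x).const_add x₀
    have h2 := (hF.differentiable (by simp) (x₀ + t • x, γ' t)).hasFDerivAt.comp_hasDerivAt t
      (h1.prodMk (hγ'd t ht))
    have h3 := h2.clm_apply (hasDerivAt_const t u)
    have h4 := (hasDerivAt_id t).smul h3
    have hq : (x₀ + t • x, γ' t) ∈ O := by
      have := hO (π t)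
      rwa [hγt, hπ t ht] at this
    refine h4.congr_deriv ?_
    have h5 : v t (R t) = F (x₀ + t • x, γ' t) u
        + fderiv ℝ F (x₀ + t • x, γ' t) (t • u, t • F (x₀ + t • x, γ' t) u) x := by
      change G' (c (π t)) (0, u, R t) = _
      rw [hG', fderiv_rayField_apply hF, hcs, hγt, hπ t ht]
    -- Integrability exchanges `u` and `x`: the derivative of `F` along the ray becomes the term of
    -- the variational equation.
    rw [h5, ← Prod.smul_mk, map_smul, smul_apply, hint _ hq u x]
    simp [add_comm]
  have hlip : ∀ t ∈ Ico (0 : ℝ) 1, LipschitzOnWith ‖G'.comp c‖₊ (v t) univ := by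
    intro t _
    refine LipschitzWith.lipschitzOnWith (LipschitzWith.of_dist_le_mul fun w w' => ?_)
    rw [dist_eq_norm, dist_eq_norm, ← map_sub]
    refine ((G' (c (π t))).le_opNorm _).trans (mul_le_mul ?_ ?_ (norm_nonneg _) (by positivity))
    · exact ContinuousMap.norm_coe_le_norm (G'.comp c) (π t)
    · simp [Prod.norm_def]
  have key := ODE_solution_unique_of_mem_Icc_right hlip
    (fun t ht => (hkd t ht).continuousAt.continuousWithinAt)
    (fun t ht => (hkd t (Ico_subset_Icc_self ht)).hasDerivWithinAt) (fun _ _ => mem_univ _)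
    (fun t ht => (hRd t ht).continuousAt.continuousWithinAt)
    (fun t ht => (hRd t (Ico_subset_Icc_self ht)).hasDerivWithinAt) (fun _ _ => mem_univ _)
    (by simp [primitive, R]) (right_mem_Icc.2 zero_le_one)
  rw [hht]
  refine key.trans ?_
  have h1 := hγt 1
  simp only [R, one_smul]
  rw [h1]
  rfl

/-- **Frobenius' theorem** for the distribution `{(u, F u)}`, in terms of a globally defined
smooth `F` which satisfies the integrability condition on an open set. -/
theorem exists_flat_chart_of_contDiff [CompleteSpace X] {F : X × Z → X →L[ℝ] Z}
    (hF : ContDiff ℝ ∞ F) {O : Set (X × Z)} (hO : IsOpen O)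
    (hint : ∀ q ∈ O, ∀ u v, fderiv ℝ F q (u, F q u) v = fderiv ℝ F q (v, F q v) u)
    {q₀ : X × Z} (hq₀ : q₀ ∈ O) :
    ∃ χ : OpenPartialHomeomorph (X × Z) (X × Z), q₀ ∈ χ.source ∧ ContDiffOn ℝ ∞ χ χ.source ∧
      ContDiffOn ℝ ∞ χ.symm χ.target ∧
      ∀ q ∈ χ.source, ∀ v, (fderiv ℝ χ q v).2 = 0 ↔ v.2 = F q v.1 := by
  obtain ⟨x₀, z₀⟩ := q₀
  have hr := contDiff_rayField hF x₀
  let G : C(ℝ × X × Z, Z) := ⟨rayField F x₀, hr.continuous⟩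
  let G' : C(ℝ × X × Z, (ℝ × X × Z) →L[ℝ] Z) :=
    ⟨fderiv ℝ (rayField F x₀), hr.continuous_fderiv (by simp)⟩
  have hGG' : ∀ a, HasFDerivAt G (G' a) a := fun a => (hr.differentiable (by simp) a).hasFDerivAt
  have hG0 : ∀ s z, G (s, 0, z) = 0 := fun s z => by
    change F _ (0 : X) = 0
    exact map_zero _
  obtain ⟨N, S, hN, h0N, hS, hSN⟩ := exists_smooth_rays (G := G) hr hG0 z₀
  have hS0 : ∀ z, (0, z) ∈ N → S (0, z) = constCurve Z z := by
    intro z hz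
    ext t
    have h1 := congrArg (fun δ : C(unitInterval, Z) => δ t) (hSN _ hz)
    have h2 : S (0, z) t - z
        - primitive (G.comp (timeCurve X Z + rayCurve X Z (0, S (0, z)))) t = 0 := h1
    have h3 : G.comp (timeCurve X Z + rayCurve X Z (0, S (0, z))) = 0 := by
      ext s
      rw [ContinuousMap.comp_apply, timeCurve_add_rayCurve, hG0]
      rfl
    rw [h3] at h2
    have h4 : primitive (0 : C(unitInterval, Z)) t = 0 := by simp [primitive]
    rw [h4, sub_zero, sub_eq_zero] at h2
    exact h2
  obtain ⟨ε, hε, hball⟩ := Metric.isOpen_iff.1 hO _ hq₀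
  -- A short direction and a solution close to the constant curve keep the whole ray in `O`, where
  -- integrability is available.
  let N' : Set (X × Z) := (N ∩ S ⁻¹' Metric.ball (constCurve Z z₀) ε) ∩ {p | ‖p.1‖ < ε}
  have hN' : IsOpen N' := (hS.continuousOn.isOpen_inter_preimage hN Metric.isOpen_ball).inter
    (isOpen_lt (by fun_prop) continuous_const)
  have h0N' : ((0 : X), z₀) ∈ N' := ⟨⟨h0N, by
    rw [mem_preimage, hS0 z₀ h0N]; exact Metric.mem_ball_self hε⟩, by simpa using hε⟩
  have hSO : ∀ p ∈ N', ∀ t : unitInterval, (x₀ + (t : ℝ) • p.1, S p t) ∈ O := by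
    rintro p ⟨⟨hpN, hpS⟩, hpε⟩ t
    refine hball ?_
    rw [Metric.mem_ball, Prod.dist_eq, max_lt_iff]
    constructor
    · rw [dist_eq_norm, add_sub_cancel_left, norm_smul, Real.norm_of_nonneg t.2.1]
      exact (mul_le_of_le_one_left (norm_nonneg _) t.2.2).trans_lt hpε
    · exact (ContinuousMap.dist_apply_le_dist (f := S p) (g := constCurve Z z₀) t).trans_lt hpS
  have hSd : ∀ p ∈ N', HasFDerivAt S (fderiv ℝ S p) p := fun p hp =>
    ((hS.contDiffAt (hN.mem_nhds hp.1.1)).differentiableAt (by simp)).hasFDerivAt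
  -- With the initial value fixed, changing the direction by `u` moves the endpoint by `F u`, so the
  -- surface swept out is tangent to the distribution.
  have hSu : ∀ p ∈ N', ∀ u, fderiv ℝ S p (u, 0) 1 = F (x₀ + p.1, S p 1) u := by
    intro p hp u
    obtain ⟨T, hT, hTeq⟩ := hasFDerivAt_rayDefect hGG' (p, S p)
    have h1 := hT.comp p ((hasFDerivAt_id (𝕜 := ℝ) p).prodMk (hSd p hp))
    have h2 : rayDefect G ∘ (fun p => (p, S p)) =ᶠ[𝓝 p] fun _ => 0 := by
      filter_upwards [hN.mem_nhds hp.1.1] with p' hp'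
      exact hSN p' hp'
    have h3 := h1.unique ((hasFDerivAt_const (0 : C(unitInterval, Z)) p).congr_of_eventuallyEq h2)
    have h4 := congrArg (fun A : X × Z →L[ℝ] C(unitInterval, Z) => A (u, 0)) h3
    have h5 : T ((u, 0), fderiv ℝ S p (u, 0)) = 0 := h4
    rw [hTeq, map_zero, sub_zero, sub_eq_zero] at h5
    exact deriv_rays_eq hF (fun _ => rfl) (fun _ => rfl) hint (hSN p hp.1.1) (hSO p hp) h5
  let ev : C(unitInterval, Z) →L[ℝ] Z := ContinuousMap.evalCLM ℝ 1
  -- For fixed `z`, `ψ` sweeps out the leaf through `(x₀, z)`. The second coordinate of its inverse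
  -- recovers `z`, and is therefore constant along leaves.
  let ψ : X × Z → X × Z := fun p => (x₀ + p.1, S p 1)
  have hψ : ContDiffOn ℝ ∞ ψ N' := by
    have h1 : ContDiffOn ℝ ∞ (fun p => ev (S p)) N' := (ContinuousLinearMap.contDiff
      (E := C(unitInterval, Z)) ev).comp_contDiffOn (hS.mono fun p hp => hp.1.1)
    exact (contDiff_const.add contDiff_fst).contDiffOn.prodMk h1
  have hψd : ∀ p ∈ N', HasFDerivAt ψ ((ContinuousLinearMap.fst ℝ X Z).prod
      (ev ∘L fderiv ℝ S p)) p := by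
    intro p hp
    have h1 := (ContinuousLinearMap.hasFDerivAt (E := C(unitInterval, Z)) ev (x := S p)).comp p
      (hSd p hp)
    exact ((hasFDerivAt_id (𝕜 := ℝ) p).fst.const_add x₀).prodMk h1
  have hSw : ∀ w, fderiv ℝ S (0, z₀) (0, w) = constCurve Z w := by
    intro w
    have h1 : HasFDerivAt (fun z : Z => ((0 : X), z)) (ContinuousLinearMap.inr ℝ X Z) z₀ :=
      (hasFDerivAt_const (0 : X) z₀).prodMk (hasFDerivAt_id z₀)
    have h2 := (hSd _ h0N').comp z₀ h1
    have h3 : (S ∘ fun z : Z => ((0 : X), z)) =ᶠ[𝓝 z₀] constCurve Z := by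
      have : Continuous fun z : Z => ((0 : X), z) := by fun_prop
      filter_upwards [(hN.preimage this).mem_nhds h0N] with z hz
      exact hS0 z hz
    have h4 := h2.unique ((ContinuousLinearMap.hasFDerivAt (E := Z) (F := C(unitInterval, Z))
      (constCurve Z) (x := z₀)).congr_of_eventuallyEq h3)
    exact congrArg (fun A : Z →L[ℝ] C(unitInterval, Z) => A w) h4
  let ψ' : (X × Z) ≃L[ℝ] X × Z := ContinuousLinearEquiv.skewProd (ContinuousLinearEquiv.refl ℝ X)
    (ContinuousLinearEquiv.refl ℝ Z) (F (x₀ + 0, S (0, z₀) 1))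
  have hψ' : HasFDerivAt ψ (ψ' : X × Z →L[ℝ] X × Z) (0, z₀) := by
    refine (hψd _ h0N').congr_fderiv ?_
    refine ContinuousLinearMap.ext fun q => ?_
    have h1 : fderiv ℝ S (0, z₀) q 1 = q.2 + F (x₀ + 0, S (0, z₀) 1) q.1 := by
      conv_lhs => rw [show q = (0, q.2) + (q.1, 0) by simp]
      rw [map_add, ContinuousMap.add_apply, hSw, hSu _ h0N']
      rfl
    exact Prod.ext rfl h1
  obtain ⟨e, h0e, heN, heψ, hes⟩ := exists_smooth_localInverse hN' hψ h0N' ψ' hψ'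
  have he0 : e (0, z₀) = (x₀, z₀) := by
    rw [heψ]
    change (x₀ + 0, S (0, z₀) 1) = _
    rw [add_zero, hS0 z₀ h0N]
    rfl
  refine ⟨e.symm, he0 ▸ e.map_source h0e, hes, ?_, ?_⟩
  · rw [e.symm_symm, heψ]
    exact hψ.mono heN
  · intro q hq v
    set p := e.symm q with hp
    have hpN : p ∈ N' := heN (e.map_target hq)
    have hq' : q = ψ p := by rw [← heψ]; exact (e.right_inv hq).symm
    have hqF : (x₀ + p.1, S p 1) = q := hq'.symm
    have hd1 : HasFDerivAt e.symm (fderiv ℝ e.symm q) q :=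
      ((hes.contDiffAt (e.open_target.mem_nhds hq)).differentiableAt (by simp)).hasFDerivAt
    have hd2 : HasFDerivAt ψ ((ContinuousLinearMap.fst ℝ X Z).prod (ev ∘L fderiv ℝ S p)) p :=
      hψd p hpN
    have hA : ∀ v, ((ContinuousLinearMap.fst ℝ X Z).prod (ev ∘L fderiv ℝ S p))
        (fderiv ℝ e.symm q v) = v := by
      intro v
      have h1 : HasFDerivAt (ψ ∘ e.symm) _ q := HasFDerivAt.comp q hd2 hd1
      have h2 : ψ ∘ e.symm =ᶠ[𝓝 q] id := by
        filter_upwards [e.open_target.mem_nhds hq] with q' hq'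
        rw [← heψ]
        exact e.right_inv hq'
      have h3 := h1.unique ((hasFDerivAt_id q).congr_of_eventuallyEq h2)
      exact congrArg (fun A : X × Z →L[ℝ] X × Z => A v) h3
    have hB : ∀ v, fderiv ℝ e.symm q
        (((ContinuousLinearMap.fst ℝ X Z).prod (ev ∘L fderiv ℝ S p)) v) = v := by
      intro v
      have h1 : HasFDerivAt (e.symm ∘ ψ) _ p := HasFDerivAt.comp p (by rw [← hq']; exact hd1) hd2
      have h2 : e.symm ∘ ψ =ᶠ[𝓝 p] id := by
        filter_upwards [e.open_source.mem_nhds (e.map_target hq)] with p' hp'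
        rw [← heψ]
        exact e.left_inv hp'
      have h3 := h1.unique ((hasFDerivAt_id p).congr_of_eventuallyEq h2)
      exact congrArg (fun A : X × Z →L[ℝ] X × Z => A v) h3
    have hAu : ∀ u, ((ContinuousLinearMap.fst ℝ X Z).prod (ev ∘L fderiv ℝ S p)) (u, 0)
        = (u, F q u) := by
      intro u
      have h1 := hSu p hpN u
      rw [hqF] at h1
      exact Prod.ext rfl h1
    constructor
    · intro h
      have h1 := hA v
      rw [show fderiv ℝ e.symm q v = ((fderiv ℝ e.symm q v).1, 0) from Prod.ext rfl h, hAu] at h1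
      rw [← h1]
    · intro h
      have h1 := hB (v.1, 0)
      rw [hAu, ← h] at h1
      change (fderiv ℝ e.symm q (v.1, v.2)).2 = 0
      rw [h1]

/-- **Frobenius' theorem** for the distribution `{(u, F u)}`. -/
theorem exists_flat_chart [FiniteDimensional ℝ X] [FiniteDimensional ℝ Z]
    {F : X × Z → X →L[ℝ] Z} {O : Set (X × Z)} (hO : IsOpen O) (hF : ContDiffOn ℝ ∞ F O)
    (hint : ∀ q ∈ O, ∀ u v, fderiv ℝ F q (u, F q u) v = fderiv ℝ F q (v, F q v) u)
    {q₀ : X × Z} (hq₀ : q₀ ∈ O) :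
    ∃ χ : OpenPartialHomeomorph (X × Z) (X × Z), q₀ ∈ χ.source ∧ χ.source ⊆ O ∧
      ContDiffOn ℝ ∞ χ χ.source ∧ ContDiffOn ℝ ∞ χ.symm χ.target ∧
      ∀ q ∈ χ.source, ∀ v, (fderiv ℝ χ q v).2 = 0 ↔ v.2 = F q v.1 := by
  have : CompleteSpace X := FiniteDimensional.complete ℝ X
  obtain ⟨ε, hε, hball⟩ := Metric.isOpen_iff.1 hO _ hq₀
  let b : ContDiffBump q₀ := ⟨ε / 4, ε / 2, by positivity, by linarith⟩
  -- The cutoff may spoil integrability outside the inner ball, so the global version is applied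
  -- with that ball as its open set.
  let F' : X × Z → X →L[ℝ] Z := fun q => b q • F q
  have hF' : ContDiff ℝ ∞ F' := by
    rw [contDiff_iff_contDiffAt]
    intro q
    by_cases hq : q ∈ Metric.ball q₀ ε
    · exact b.contDiff.contDiffAt.smul (hF.contDiffAt (hO.mem_nhds (hball hq)))
    · have hq' : q ∉ tsupport b := by
        rw [b.tsupport_eq]
        intro h
        exact hq (Metric.closedBall_subset_ball (by change ε / 2 < ε; linarith) h)
      refine (contDiffAt_const (c := (0 : X →L[ℝ] Z))).congr_of_eventuallyEq ?_
      filter_upwards [(isClosed_tsupport b).isOpen_compl.mem_nhds hq'] with q' h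
      simp only [F', image_eq_zero_of_notMem_tsupport h, zero_smul]
  have heq : ∀ q ∈ Metric.ball q₀ (ε / 4), F' q = F q := fun q hq => by
    simp only [F', b.one_of_mem_closedBall (Metric.ball_subset_closedBall hq), one_smul]
  have hsub : Metric.ball q₀ (ε / 4) ⊆ O :=
    (Metric.ball_subset_ball (by linarith)).trans hball
  obtain ⟨χ, h1, h2, h3, h4⟩ := exists_flat_chart_of_contDiff hF' Metric.isOpen_ball
    (O := Metric.ball q₀ (ε / 4)) (fun q hq u v => by
      have : F' =ᶠ[𝓝 q] F := by
        filter_upwards [Metric.isOpen_ball.mem_nhds hq] with q' hq'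
        exact heq q' hq'
      rw [this.fderiv_eq, heq q hq]
      exact hint q (hsub hq) u v) (Metric.mem_ball_self (by positivity))
  have hr : (χ.restrOpen _ (Metric.isOpen_ball (x := q₀) (ε := ε / 4))).source
      = χ.source ∩ Metric.ball q₀ (ε / 4) := χ.restrOpen_source _ _
  refine ⟨χ.restrOpen _ (Metric.isOpen_ball (x := q₀) (ε := ε / 4)), ?_, ?_, ?_, ?_, ?_⟩
  · rw [hr]
    exact ⟨h1, Metric.mem_ball_self (by positivity)⟩
  · rw [hr]
    exact fun q hq => hsub hq.2
  · rw [hr]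
    exact h2.mono inter_subset_left
  · exact h3.mono fun q hq => hq.1
  · intro q hq v
    rw [hr] at hq
    rw [← heq q hq.2]
    exact h4 q hq.1 v

end Frobenius

/-! ### Bivector fields on a vector space -/

section Jacobiator

variable {E : Type*} [NormedAddCommGroup E] [NormedSpace ℝ E]

/-- The Jacobiator (Schouten bracket with itself, up to a factor) of the bivector field `H`. -/
noncomputable def jacobiator (H : E → (E →L[ℝ] ℝ) →L[ℝ] E) (y : E) (a b c : E →L[ℝ] ℝ) : ℝ :=
  a (fderiv ℝ H y (H y c) b) + b (fderiv ℝ H y (H y a) c) + c (fderiv ℝ H y (H y b) a)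

theorem fderiv_bracket_apply {H : E → (E →L[ℝ] ℝ) →L[ℝ] E} {y : E} (hH : DifferentiableAt ℝ H y)
    {f g : E → ℝ} (hf : ContDiffAt ℝ 2 f y) (hg : ContDiffAt ℝ 2 g y) (w : E) :
    fderiv ℝ (fun z => fderiv ℝ f z (H z (fderiv ℝ g z))) y w
      = fderiv ℝ (fderiv ℝ f) y w (H y (fderiv ℝ g y))
        + fderiv ℝ f y (fderiv ℝ H y w (fderiv ℝ g y))
        + fderiv ℝ f y (H y (fderiv ℝ (fderiv ℝ g) y w)) := by
  have hf' : HasFDerivAt (fderiv ℝ f) _ y :=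
    ((hf.fderiv_right (m := 1) le_rfl).differentiableAt (by simp)).hasFDerivAt
  have hg' : HasFDerivAt (fderiv ℝ g) _ y :=
    ((hg.fderiv_right (m := 1) le_rfl).differentiableAt (by simp)).hasFDerivAt
  rw [(hf'.clm_apply (hH.hasFDerivAt.clm_apply hg')).fderiv]
  simp
  ring

/-- The Jacobi identity depends only on the differentials of the three functions. -/
theorem jacobi_eq_jacobiator {H : E → (E →L[ℝ] ℝ) →L[ℝ] E} {y : E} (hH : DifferentiableAt ℝ H y)
    (hs : ∀ a b : E →L[ℝ] ℝ, a (H y b) = -b (H y a)) {f g l : E → ℝ} (hf : ContDiffAt ℝ 2 f y)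
    (hg : ContDiffAt ℝ 2 g y) (hl : ContDiffAt ℝ 2 l y) :
    fderiv ℝ (fun z => fderiv ℝ f z (H z (fderiv ℝ g z))) y (H y (fderiv ℝ l y))
      + fderiv ℝ (fun z => fderiv ℝ g z (H z (fderiv ℝ l z))) y (H y (fderiv ℝ f y))
      + fderiv ℝ (fun z => fderiv ℝ l z (H z (fderiv ℝ f z))) y (H y (fderiv ℝ g y))
      = jacobiator H y (fderiv ℝ f y) (fderiv ℝ g y) (fderiv ℝ l y) := by
  rw [fderiv_bracket_apply hH hf hg, fderiv_bracket_apply hH hg hl, fderiv_bracket_apply hH hl hf,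
    hs (fderiv ℝ f y) (fderiv ℝ (fderiv ℝ g) y _), hs (fderiv ℝ g y) (fderiv ℝ (fderiv ℝ l) y _),
    hs (fderiv ℝ l y) (fderiv ℝ (fderiv ℝ f) y _)]
  -- After skewness is used, each second derivative occurs twice, with opposite signs and
  -- interchanged arguments.
  have h1 := (hf.isSymmSndFDerivAt (by simp)) (H y (fderiv ℝ l y)) (H y (fderiv ℝ g y))
  have h2 := (hg.isSymmSndFDerivAt (by simp)) (H y (fderiv ℝ f y)) (H y (fderiv ℝ l y))
  have h3 := (hl.isSymmSndFDerivAt (by simp)) (H y (fderiv ℝ g y)) (H y (fderiv ℝ f y))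
  rw [jacobiator, h1, h2, h3]
  ring

/-- A functional vanishing on `W` but not on the derivative would be constant along `f` with nonzero
derivative. Without differentiability `fderiv` is `0`, which lies in `W` too. -/
theorem fderiv_mem_submodule {V : Type*} [NormedAddCommGroup V] [NormedSpace ℝ V]
    [FiniteDimensional ℝ V] {W : Submodule ℝ V} {f : E → V} {y : E} (hf : ∀ᶠ z in 𝓝 y, f z ∈ W)
    (u : E) : fderiv ℝ f y u ∈ W := by
  by_cases hd : DifferentiableAt ℝ f y
  · by_contra hu
    obtain ⟨a, ha0, haW⟩ := Submodule.exists_dual_map_eq_bot_of_notMem hu inferInstance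
    have h1 : HasFDerivAt (fun z => LinearMap.toContinuousLinearMap a (f z))
        (LinearMap.toContinuousLinearMap a ∘L fderiv ℝ f y) y :=
      (LinearMap.toContinuousLinearMap a).hasFDerivAt.comp y hd.hasFDerivAt
    have h2 : HasFDerivAt (fun z => LinearMap.toContinuousLinearMap a (f z)) (0 : E →L[ℝ] ℝ) y := by
      refine (hasFDerivAt_const (0 : ℝ) y).congr_of_eventuallyEq ?_
      filter_upwards [hf] with z hz
      have := Submodule.mem_map_of_mem (f := a) hz
      rw [haW] at this
      exact (Submodule.mem_bot ℝ).1 this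
    exact ha0 (congrArg (fun L : E →L[ℝ] ℝ => L u) (h1.unique h2))
  · simp [fderiv_zero_of_not_differentiableAt hd]

theorem fderiv_skew {H : E → (E →L[ℝ] ℝ) →L[ℝ] E} {y : E} (hH : DifferentiableAt ℝ H y)
    (hs : ∀ᶠ z in 𝓝 y, ∀ a b : E →L[ℝ] ℝ, a (H z b) = -b (H z a)) (u : E) (a b : E →L[ℝ] ℝ) :
    a (fderiv ℝ H y u b) = -b (fderiv ℝ H y u a) := by
  have hHa (a b : E →L[ℝ] ℝ) : HasFDerivAt (fun z => b (H z a))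
      (b ∘L (fderiv ℝ H y).flip a) y := by
    have := b.hasFDerivAt.comp y (hH.hasFDerivAt.clm_apply (hasFDerivAt_const a y))
    refine this.congr_fderiv ?_
    ext u
    simp
  have h3 := (hHa b a).unique ((hHa a b).neg.congr_of_eventuallyEq (hs.mono fun z hz => hz a b))
  exact congrArg (fun L : E →L[ℝ] ℝ => L u) h3

theorem alternating_two_swap {V : Type*} [AddCommGroup V] [Module ℝ V] [TopologicalSpace V]
    (ω₀ : V [⋀^Fin 2]→L[ℝ] ℝ) (v w : V) : ω₀ ![v, w] = -ω₀ ![w, v] := by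
  have h := ω₀.map_swap ![w, v] (i := 0) (j := 1) (by simp)
  refine Eq.trans ?_ h
  change ω₀ _ = ω₀ _
  congr 1
  funext i; fin_cases i <;> rfl

/-- Along its image, a bivector field inverse to a 2-form `Ω` has Jacobiator `-dΩ`. -/
theorem extDeriv_eq_neg_jacobiator [FiniteDimensional ℝ E] {W : Submodule ℝ E}
    {H : E → (E →L[ℝ] ℝ) →L[ℝ] E} {Ω : E → E [⋀^Fin 2]→L[ℝ] ℝ} {y : E}
    (hH : DifferentiableAt ℝ H y) (hΩ : DifferentiableAt ℝ Ω y)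
    (hs : ∀ᶠ z in 𝓝 y, ∀ a b : E →L[ℝ] ℝ, a (H z b) = -b (H z a)) (hW : ∀ᶠ z in 𝓝 y, ∀ a, H z a ∈ W)
    (hi : ∀ᶠ z in 𝓝 y, ∀ a, ∀ v ∈ W, Ω z ![v, H z a] = a v) (a b c : E →L[ℝ] ℝ) :
    extDeriv Ω y ![H y c, H y b, H y a] = -jacobiator H y a b c := by
  have hHa (a : E →L[ℝ] ℝ) : HasFDerivAt (fun z => H z a) ((fderiv ℝ H y).flip a) y := by
    have := hH.hasFDerivAt.clm_apply (hasFDerivAt_const a y)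
    refine this.congr_fderiv ?_
    ext u
    simp
  have hWd (u : E) (a : E →L[ℝ] ℝ) : fderiv ℝ H y u a ∈ W := by
    have h1 := fderiv_mem_submodule (hW.mono fun z hz => hz a) u
    rw [(hHa a).fderiv] at h1
    exact h1
  -- With the first argument frozen at `H y b`, the function `z ↦ Ω z (H y b, H z a)` is constantly
  -- `a (H y b)` near `y`. Differentiating it trades the derivative of `Ω` for that of `H`.
  have hkey (u : E) (a b : E →L[ℝ] ℝ) :
      fderiv ℝ Ω y u ![H y b, H y a] = b (fderiv ℝ H y u a) := by
    have hg : ∀ i, HasFDerivAt ((![fun _ => H y b, fun z => H z a] : Fin 2 → E → E) i)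
        ((![0, (fderiv ℝ H y).flip a] : Fin 2 → E →L[ℝ] E) i) y := by
      intro i
      fin_cases i
      · exact hasFDerivAt_const _ _
      · exact hHa a
    have h1 := hΩ.hasFDerivAt.continuousAlternatingMap_apply hg
    have h2 : HasFDerivAt (fun z => Ω z fun i => (![fun _ => H y b, fun z => H z a] : Fin 2 → E → E) i z)
        (0 : E →L[ℝ] ℝ) y := by
      refine (hasFDerivAt_const (b (H y a) + (a (H y b) - b (H y a))) y).congr_of_eventuallyEq ?_
      filter_upwards [hi] with z hz
      have : (fun i => (![fun _ => H y b, fun z => H z a] : Fin 2 → E → E) i z)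
          = ![H y b, H z a] := by
        funext i; fin_cases i <;> rfl
      rw [this, hz a _ (hW.self_of_nhds b)]
      ring
    have h3 := congrArg (fun L : E →L[ℝ] ℝ => L u) (h1.unique h2)
    have h4 : (fun i => (![fun _ => H y b, fun z => H z a] : Fin 2 → E → E) i y)
          = ![H y b, H y a] := by
        funext i; fin_cases i <;> rfl
    simp only [h4, Fin.sum_univ_two] at h3
    have h5 : fderiv ℝ Ω y u ![H y b, H y a] + (Ω y ![0, H y a] + Ω y ![H y b, fderiv ℝ H y u a])
        = 0 := by
      have e1 : Function.update ![H y b, H y a] 0 (0 : E) = ![0, H y a] := by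
        funext i; fin_cases i <;> rfl
      have e2 : Function.update ![H y b, H y a] 1 (fderiv ℝ H y u a)
          = ![H y b, fderiv ℝ H y u a] := by
        funext i; fin_cases i <;> rfl
      rw [← e1, ← e2]
      exact h3
    rw [(Ω y).map_coord_zero (0 : Fin 2) rfl, zero_add,
      alternating_two_swap (Ω y) (H y b) (fderiv ℝ H y u a), hi.self_of_nhds b _ (hWd u a)] at h5
    linarith
  rw [extDeriv_apply hΩ]
  have hc (v : Fin 2 → E) (u : E) : fderiv ℝ (fun z => Ω z v) y u = fderiv ℝ Ω y u v :=
    congrArg (fun L : E →L[ℝ] ℝ => L u)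
      (hΩ.hasFDerivAt.continuousAlternatingMap_apply_const v).fderiv
  have e0 : (0 : Fin 3).removeNth ![H y c, H y b, H y a] = ![H y b, H y a] := by
    funext i; fin_cases i <;> rfl
  have e1 : (1 : Fin 3).removeNth ![H y c, H y b, H y a] = ![H y c, H y a] := by
    funext i; fin_cases i <;> rfl
  have e2 : (2 : Fin 3).removeNth ![H y c, H y b, H y a] = ![H y c, H y b] := by
    funext i; fin_cases i <;> rfl
  simp only [hc]
  refine (Fin.sum_univ_three _).trans ?_
  erw [e0, e1, e2]
  simp [hkey, jacobiator]
  rw [fderiv_skew hH hs _ b a, fderiv_skew hH hs _ c b]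
  ring

end Jacobiator

/-! ### Bivector fields in charts -/

section TensorCharts

variable {m : ℕ} {M : Type*} [TopologicalSpace M] [ChartedSpace (EuclideanSpace ℝ (Fin m)) M]

/-- The expression of a contravariant 2-tensor field in a chart. -/
noncomputable def tensorRep (φ : OpenPartialHomeomorph M (𝔼 m)) (h : TwoTensor m M) (y : 𝔼 m) :
    (𝔼 m →L[ℝ] ℝ) →L[ℝ] 𝔼 m :=
  chartDeriv φ (φ.symm y) ∘L h (φ.symm y) ∘L
    ContinuousLinearMap.precomp ℝ (chartDeriv φ (φ.symm y))

theorem tensorRep_apply {φ : OpenPartialHomeomorph M (𝔼 m)} (h : TwoTensor m M) {x : M}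
    (hx : x ∈ φ.source) (b : 𝔼 m →L[ℝ] ℝ) :
    tensorRep φ h (φ x) b = chartDeriv φ x (h x (b ∘L chartDeriv φ x)) := by
  change chartDeriv φ (φ.symm (φ x)) (h (φ.symm (φ x)) (b ∘L chartDeriv φ (φ.symm (φ x)))) = _
  rw [φ.left_inv hx]

theorem contDiffOn_dual_iff {F V : Type*} [NormedAddCommGroup F] [NormedSpace ℝ F]
    [NormedAddCommGroup V] [NormedSpace ℝ V] [FiniteDimensional ℝ V] {f : F → V} {s : Set F}
    {n : WithTop ℕ∞} :
    ContDiffOn ℝ n f s ↔ ∀ a : V →L[ℝ] ℝ, ContDiffOn ℝ n (fun y => a (f y)) s := by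
  refine ⟨fun h a => a.contDiff.comp_contDiffOn h, fun h => ?_⟩
  let b := Module.finBasis ℝ V
  have : f = fun y => ∑ i, b.coord i (f y) • b i := funext fun y => (b.sum_repr _).symm
  rw [this]
  exact ContDiffOn.sum fun i _ => (h (b.coord i).toContinuousLinearMap).smul contDiffOn_const

theorem contDiffOn_bivector_iff {F V : Type*} [NormedAddCommGroup F] [NormedSpace ℝ F]
    [NormedAddCommGroup V] [NormedSpace ℝ V] [FiniteDimensional ℝ V]
    {H : F → (V →L[ℝ] ℝ) →L[ℝ] V} {s : Set F} {n : WithTop ℕ∞} :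
    ContDiffOn ℝ n H s ↔ ∀ a b : V →L[ℝ] ℝ, ContDiffOn ℝ n (fun y => a (H y b)) s := by
  rw [contDiffOn_clm_apply]
  simp_rw [contDiffOn_dual_iff (V := V)]
  exact forall_comm

theorem smoothTensor_iff {h : TwoTensor m M} : SmoothTensor h ↔ ∀ x₀ : M,
    ContDiffOn ℝ ∞ (tensorRep (chartAt (𝔼 m) x₀) h) (chartAt (𝔼 m) x₀).target := by
  simp_rw [contDiffOn_bivector_iff]
  simp only [SmoothTensor, extChartAt, mfld_simps]
  rfl

variable [IsManifold (𝓡 m) ∞ M]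

theorem tensor_apply_eq {φ : OpenPartialHomeomorph M (𝔼 m)}
    (hφ : φ ∈ maximalAtlas (𝓡 m) ∞ M) (h : TwoTensor m M) {x : M} (hx : x ∈ φ.source)
    (a : TangentSpace (𝓡 m) x →L[ℝ] ℝ) :
    chartDeriv φ x (h x a) = tensorRep φ h (φ x) (a ∘L chartDerivInv φ x) := by
  rw [tensorRep_apply h hx]
  congr 2
  refine ContinuousLinearMap.ext fun v => ?_
  exact (congrArg a (chartDerivInv_chartDeriv hφ hx v)).symm

theorem chartDeriv_eq_fderiv_comp {φ ψ : OpenPartialHomeomorph M (𝔼 m)}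
    (hφ : φ ∈ maximalAtlas (𝓡 m) ∞ M) (hψ : ψ ∈ maximalAtlas (𝓡 m) ∞ M) {x : M}
    (hx : x ∈ φ.source) (hx' : x ∈ ψ.source) :
    chartDeriv ψ x = fderiv ℝ (ψ ∘ φ.symm) (φ x) ∘L chartDeriv φ x := by
  refine ContinuousLinearMap.ext fun v => ?_
  have h1 : φ.symm (φ x) ∈ ψ.source := by rwa [φ.left_inv hx]
  have h := mfderiv_chart_comp hψ h1
    ((contMDiffAt_chart_symm hφ (φ.map_source hx)).mdifferentiableAt (by simp)) (chartDeriv φ x v)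
  refine Eq.trans ?_ h.symm
  change chartDeriv ψ x v = chartDeriv ψ (φ.symm (φ x)) (chartDerivInv φ x (chartDeriv φ x v))
  rw [chartDerivInv_chartDeriv hφ hx, φ.left_inv hx]

/-- This is the transformation law of contravariant tensors: the new expression is `E H Eᵀ`, with
`E` the Jacobian matrix of the coordinate change. -/
theorem contDiffAt_tensorRep {φ ψ : OpenPartialHomeomorph M (𝔼 m)}
    (hφ : φ ∈ maximalAtlas (𝓡 m) ∞ M) (hψ : ψ ∈ maximalAtlas (𝓡 m) ∞ M) {h : TwoTensor m M} {x : M}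
    (hx : x ∈ φ.source) (hx' : x ∈ ψ.source) (hh : ContDiffAt ℝ ∞ (tensorRep φ h) (φ x)) :
    ContDiffAt ℝ ∞ (tensorRep ψ h) (ψ x) := by
  have hτ : ContDiffAt ℝ ∞ (φ ∘ ψ.symm) (ψ x) :=
    contDiffAt_chart_comp hφ (by rwa [ψ.left_inv hx'])
      (contMDiffAt_chart_symm hψ (ψ.map_source hx'))
  have hτ' : ContDiffAt ℝ ∞ (ψ ∘ φ.symm) (φ x) :=
    contDiffAt_chart_comp hψ (by rwa [φ.left_inv hx])
      (contMDiffAt_chart_symm hφ (φ.map_source hx))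
  have hτx : (φ ∘ ψ.symm) (ψ x) = φ x := congrArg φ (ψ.left_inv hx')
  have hE : ContDiffAt ℝ ∞ (fun y => fderiv ℝ (ψ ∘ φ.symm) ((φ ∘ ψ.symm) y)) (ψ x) := by
    refine ContDiffAt.comp (g := fderiv ℝ (ψ ∘ φ.symm)) (ψ x) ?_ hτ
    rw [hτx]
    exact hτ'.fderiv_right (by simp)
  have hH : ContDiffAt ℝ ∞ (fun y => tensorRep φ h ((φ ∘ ψ.symm) y)) (ψ x) := by
    refine ContDiffAt.comp (g := tensorRep φ h) (ψ x) ?_ hτ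
    rwa [hτx]
  have hP' : ContDiff ℝ ∞ fun L : 𝔼 m →L[ℝ] 𝔼 m =>
      (ContinuousLinearMap.precomp ℝ L : (𝔼 m →L[ℝ] ℝ) →L[ℝ] 𝔼 m →L[ℝ] ℝ) :=
    contDiff_clm_apply_iff.2 fun b => contDiff_const.clm_comp contDiff_id
  have hP := hP'.contDiffAt.comp (ψ x) hE
  refine (hE.clm_comp (hH.clm_comp hP)).congr_of_eventuallyEq ?_
  have hs : ∀ᶠ y in 𝓝 (ψ x), y ∈ ψ.target ∧ ψ.symm y ∈ φ.source :=
    (eventually_mem_set.2 (ψ.open_target.mem_nhds (ψ.map_source hx'))).and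
      ((ψ.continuousAt_symm (ψ.map_source hx')).preimage_mem_nhds
        (by rw [ψ.left_inv hx']; exact φ.open_source.mem_nhds hx))
  filter_upwards [hs] with y hy
  refine ContinuousLinearMap.ext fun b => ?_
  have h1 := chartDeriv_eq_fderiv_comp hφ hψ hy.2 (ψ.map_target hy.1)
  change chartDeriv ψ (ψ.symm y) (h (ψ.symm y) (b ∘L chartDeriv ψ (ψ.symm y))) =
    fderiv ℝ (ψ ∘ φ.symm) (φ (ψ.symm y)) (tensorRep φ h (φ (ψ.symm y))
      (b ∘L fderiv ℝ (ψ ∘ φ.symm) (φ (ψ.symm y))))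
  rw [tensorRep_apply h hy.2, h1]
  rfl

theorem smoothTensor_of_local {h : TwoTensor m M}
    (hh : ∀ x : M, ∃ φ ∈ maximalAtlas (𝓡 m) ∞ M, x ∈ φ.source ∧
      ContDiffAt ℝ ∞ (tensorRep φ h) (φ x)) : SmoothTensor h := by
  rw [smoothTensor_iff]
  intro x₀ y hy
  obtain ⟨φ, hφ, hx, hc⟩ := hh ((chartAt (𝔼 m) x₀).symm y)
  have := contDiffAt_tensorRep hφ (chart_mem_maximalAtlas x₀) hx
    ((chartAt (𝔼 m) x₀).map_target hy) hc
  rw [(chartAt (𝔼 m) x₀).right_inv hy] at this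
  exact this.contDiffWithinAt

theorem SmoothTensor.contDiffOn_tensorRep {h : TwoTensor m M} (hh : SmoothTensor h)
    {φ : OpenPartialHomeomorph M (𝔼 m)} (hφ : φ ∈ maximalAtlas (𝓡 m) ∞ M) :
    ContDiffOn ℝ ∞ (tensorRep φ h) φ.target := by
  intro y hy
  have hs := mem_chart_source (𝔼 m) (φ.symm y)
  have := contDiffAt_tensorRep (chart_mem_maximalAtlas (φ.symm y)) hφ hs (φ.map_target hy)
    ((smoothTensor_iff.1 hh (φ.symm y)).contDiffAt
      ((chartAt (𝔼 m) (φ.symm y)).open_target.mem_nhds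
        ((chartAt (𝔼 m) (φ.symm y)).map_source hs)))
  rw [φ.right_inv hy] at this
  exact this.contDiffWithinAt

theorem tensorRep_skew {φ : OpenPartialHomeomorph M (𝔼 m)} {h : TwoTensor m M}
    (hs : ∀ (x : M) (a b : TangentSpace (𝓡 m) x →L[ℝ] ℝ), a (h x b) = -b (h x a)) (y : 𝔼 m)
    (a b : 𝔼 m →L[ℝ] ℝ) : a (tensorRep φ h y b) = -b (tensorRep φ h y a) :=
  hs (φ.symm y) (a ∘L chartDeriv φ (φ.symm y)) (b ∘L chartDeriv φ (φ.symm y))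

theorem dFun_eq {φ : OpenPartialHomeomorph M (𝔼 m)} (hφ : φ ∈ maximalAtlas (𝓡 m) ∞ M)
    {f : M → ℝ} {x : M} (hx : x ∈ φ.source) (hf : MDifferentiableAt (𝓡 m) 𝓘(ℝ, ℝ) f x) :
    dFun f x = fderiv ℝ (f ∘ φ.symm) (φ x) ∘L chartDeriv φ x := by
  refine ContinuousLinearMap.ext fun v => ?_
  have h1 : MDifferentiableAt (𝓡 m) 𝓘(ℝ, ℝ) f (φ.symm (φ x)) := by rwa [φ.left_inv hx]
  have h := mfderiv_comp (I := 𝓡 m) (I' := 𝓡 m) (I'' := 𝓘(ℝ, ℝ)) (φ x) h1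
    ((contMDiffAt_chart_symm hφ (φ.map_source hx)).mdifferentiableAt (by simp))
  rw [mfderiv_eq_fderiv] at h
  refine Eq.trans ?_ (congrArg (fun L : 𝔼 m →L[ℝ] ℝ => L (chartDeriv φ x v)) h).symm
  change dFun f x v = dFun f (φ.symm (φ x)) (chartDerivInv φ x (chartDeriv φ x v))
  rw [chartDerivInv_chartDeriv hφ hx, φ.left_inv hx]

theorem bracket_eq {φ : OpenPartialHomeomorph M (𝔼 m)} (hφ : φ ∈ maximalAtlas (𝓡 m) ∞ M)
    (h : TwoTensor m M) {f g : M → ℝ} {x : M} (hx : x ∈ φ.source)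
    (hf : MDifferentiableAt (𝓡 m) 𝓘(ℝ, ℝ) f x) (hg : MDifferentiableAt (𝓡 m) 𝓘(ℝ, ℝ) g x) :
    bracket h f g x = fderiv ℝ (f ∘ φ.symm) (φ x)
      (tensorRep φ h (φ x) (fderiv ℝ (g ∘ φ.symm) (φ x))) := by
  rw [bracket, dFun_eq hφ hx hf, dFun_eq hφ hx hg, tensorRep_apply h hx]
  rfl

theorem mdifferentiableAt_of_chart {φ : OpenPartialHomeomorph M (𝔼 m)}
    (hφ : φ ∈ maximalAtlas (𝓡 m) ∞ M) {f : M → ℝ} {x : M} (hx : x ∈ φ.source)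
    (hf : DifferentiableAt ℝ (f ∘ φ.symm) (φ x)) : MDifferentiableAt (𝓡 m) 𝓘(ℝ, ℝ) f x := by
  have h1 : MDifferentiableAt (𝓡 m) 𝓘(ℝ, ℝ) ((f ∘ φ.symm) ∘ φ) x :=
    hf.mdifferentiableAt.comp x ((contMDiffAt_chart hφ hx).mdifferentiableAt (by simp))
  refine h1.congr_of_eventuallyEq ?_
  filter_upwards [φ.open_source.mem_nhds hx] with z hz
  exact (congrArg f (φ.left_inv hz)).symm

theorem contDiffAt_comp_chart_symm {φ : OpenPartialHomeomorph M (𝔼 m)}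
    (hφ : φ ∈ maximalAtlas (𝓡 m) ∞ M) {f : M → ℝ} (hf : ContMDiff (𝓡 m) 𝓘(ℝ, ℝ) ∞ f) {y : 𝔼 m}
    (hy : y ∈ φ.target) : ContDiffAt ℝ ∞ (f ∘ φ.symm) y := by
  rw [← contMDiffAt_iff_contDiffAt]
  exact (hf.contMDiffAt).comp y (contMDiffAt_chart_symm hφ hy)

/-- The outer bracket needs the inner one to be differentiable on `M`, which is read off from its
expression in the chart. -/
theorem bracket_bracket_eq {φ : OpenPartialHomeomorph M (𝔼 m)} (hφ : φ ∈ maximalAtlas (𝓡 m) ∞ M)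
    {h : TwoTensor m M} (hh : SmoothTensor h) {f g l : M → ℝ} {x : M} (hx : x ∈ φ.source)
    (hf : ContMDiff (𝓡 m) 𝓘(ℝ, ℝ) ∞ f) (hg : ContMDiff (𝓡 m) 𝓘(ℝ, ℝ) ∞ g)
    (hl : ContMDiff (𝓡 m) 𝓘(ℝ, ℝ) ∞ l) :
    bracket h (bracket h f g) l x = fderiv ℝ (fun z => fderiv ℝ (f ∘ φ.symm) z
      (tensorRep φ h z (fderiv ℝ (g ∘ φ.symm) z))) (φ x)
      (tensorRep φ h (φ x) (fderiv ℝ (l ∘ φ.symm) (φ x))) := by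
  have hy := φ.map_source hx
  have he : (bracket h f g) ∘ φ.symm =ᶠ[𝓝 (φ x)] fun z => fderiv ℝ (f ∘ φ.symm) z
      (tensorRep φ h z (fderiv ℝ (g ∘ φ.symm) z)) := by
    filter_upwards [φ.open_target.mem_nhds hy] with z hz
    have := bracket_eq hφ h (φ.map_target hz) (hf.mdifferentiable (by simp) _)
      (hg.mdifferentiable (by simp) _)
    rwa [φ.right_inv hz] at this
  have hd : DifferentiableAt ℝ (fun z => fderiv ℝ (f ∘ φ.symm) z
      (tensorRep φ h z (fderiv ℝ (g ∘ φ.symm) z))) (φ x) := by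
    have hF := (contDiffAt_comp_chart_symm hφ hf hy).fderiv_right (m := ∞) (by simp)
    have hG := (contDiffAt_comp_chart_symm hφ hg hy).fderiv_right (m := ∞) (by simp)
    have hH := (hh.contDiffOn_tensorRep hφ).contDiffAt (φ.open_target.mem_nhds hy)
    exact (hF.clm_apply (hH.clm_apply hG)).differentiableAt (by simp)
  rw [bracket_eq hφ h hx (mdifferentiableAt_of_chart hφ hx (hd.congr_of_eventuallyEq he))
    (hl.mdifferentiable (by simp) _), he.fderiv_eq]

/-- The Jacobi identity at a point in terms of the Jacobiator in a chart. -/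
theorem jacobi_eq {φ : OpenPartialHomeomorph M (𝔼 m)} (hφ : φ ∈ maximalAtlas (𝓡 m) ∞ M)
    {h : TwoTensor m M} (hh : SmoothTensor h)
    (hs : ∀ (x : M) (a b : TangentSpace (𝓡 m) x →L[ℝ] ℝ), a (h x b) = -b (h x a))
    {f g l : M → ℝ} {x : M} (hx : x ∈ φ.source)
    (hf : ContMDiff (𝓡 m) 𝓘(ℝ, ℝ) ∞ f) (hg : ContMDiff (𝓡 m) 𝓘(ℝ, ℝ) ∞ g)
    (hl : ContMDiff (𝓡 m) 𝓘(ℝ, ℝ) ∞ l) :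
    bracket h (bracket h f g) l x + bracket h (bracket h g l) f x
        + bracket h (bracket h l f) g x
      = jacobiator (tensorRep φ h) (φ x) (fderiv ℝ (f ∘ φ.symm) (φ x))
        (fderiv ℝ (g ∘ φ.symm) (φ x)) (fderiv ℝ (l ∘ φ.symm) (φ x)) := by
  have hy := φ.map_source hx
  rw [bracket_bracket_eq hφ hh hx hf hg hl, bracket_bracket_eq hφ hh hx hg hl hf,
    bracket_bracket_eq hφ hh hx hl hf hg]
  exact jacobi_eq_jacobiator
    (((hh.contDiffOn_tensorRep hφ).contDiffAt (φ.open_target.mem_nhds hy)).differentiableAt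
      (by simp)) (tensorRep_skew hs _)
    ((contDiffAt_comp_chart_symm hφ hf hy).of_le two_le_infty)
    ((contDiffAt_comp_chart_symm hφ hg hy).of_le two_le_infty)
    ((contDiffAt_comp_chart_symm hφ hl hy).of_le two_le_infty)

/-- Every covector in a chart is the differential of a global smooth function. -/
theorem exists_contMDiff_fderiv_eq [T2Space M] {φ : OpenPartialHomeomorph M (𝔼 m)}
    (hφ : φ ∈ maximalAtlas (𝓡 m) ∞ M) {x : M} (hx : x ∈ φ.source) (a : 𝔼 m →L[ℝ] ℝ) :
    ∃ f : M → ℝ, ContMDiff (𝓡 m) 𝓘(ℝ, ℝ) ∞ f ∧ fderiv ℝ (f ∘ φ.symm) (φ x) = a := by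
  obtain ⟨ρ, hρ, hsub⟩ : ∃ ρ : SmoothBumpFunction (𝓡 m) x, tsupport ρ ⊆ φ.source ∧ True := by
    obtain ⟨ρ, -, hρ⟩ := (SmoothBumpFunction.nhds_basis_tsupport (I := 𝓡 m) x).mem_iff.1
      (φ.open_source.mem_nhds hx)
    exact ⟨ρ, hρ, trivial⟩
  refine ⟨fun z => ρ z • a (φ z), ?_, ?_⟩
  · refine contMDiff_of_tsupport fun z hz => ?_
    have hz' : z ∈ φ.source := hρ (closure_mono (Function.support_smul_subset_left _ _) hz)
    exact (ρ.contMDiff.contMDiffAt).smul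
      ((a.contDiff.contMDiff.contMDiffAt).comp z (contMDiffAt_chart hφ hz'))
  · have h1 : (fun z => ρ z • a (φ z)) ∘ φ.symm =ᶠ[𝓝 (φ x)] a := by
      have h2 : Tendsto φ.symm (𝓝 (φ x)) (𝓝 x) := by
        simpa [ContinuousAt, φ.left_inv hx] using φ.continuousAt_symm (φ.map_source hx)
      filter_upwards [h2.eventually ρ.eventuallyEq_one, φ.open_target.mem_nhds (φ.map_source hx)]
        with z hz hz'
      simp [hz, φ.right_inv hz']
    rw [h1.fderiv_eq, a.fderiv]

/-- The identity is assumed only for global functions, but their differentials at a point realize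
every triple of covectors. -/
theorem IsPoisson.jacobiator_eq_zero [T2Space M] {h : TwoTensor m M} (hh : IsPoisson h)
    {φ : OpenPartialHomeomorph M (𝔼 m)} (hφ : φ ∈ maximalAtlas (𝓡 m) ∞ M) {y : 𝔼 m}
    (hy : y ∈ φ.target) (a b c : 𝔼 m →L[ℝ] ℝ) : jacobiator (tensorRep φ h) y a b c = 0 := by
  have hx := φ.map_target hy
  obtain ⟨f, hf, rfl⟩ := exists_contMDiff_fderiv_eq hφ hx a
  obtain ⟨g, hg, rfl⟩ := exists_contMDiff_fderiv_eq hφ hx b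
  obtain ⟨l, hl, rfl⟩ := exists_contMDiff_fderiv_eq hφ hx c
  have h1 := jacobi_eq hφ hh.smooth hh.skew hx hf hg hl
  rw [hh.jacobi f g l hf hg hl, φ.right_inv hy] at h1
  rw [φ.right_inv hy]
  exact h1.symm

end TensorCharts

/-! ### The tensor defined by a foliation and a leafwise symplectic form -/

section Pairing

variable {V : Type*} [AddCommGroup V] [Module ℝ V] [TopologicalSpace V]

/-- The covector `w ↦ η (v, w)`. -/
noncomputable def formPairing (η : V [⋀^Fin 2]→L[ℝ] ℝ) (v : V) : V →L[ℝ] ℝ :=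
  η.toContinuousMultilinearMap.toContinuousLinearMap ![v, 0] 1

@[simp]
theorem formPairing_apply (η : V [⋀^Fin 2]→L[ℝ] ℝ) (v w : V) : formPairing η v w = η ![v, w] := by
  have : Function.update ![v, 0] 1 w = ![v, w] := by
    funext i; fin_cases i <;> rfl
  rw [← this]
  rfl

theorem formPairing_swap (η : V [⋀^Fin 2]→L[ℝ] ℝ) (v w : V) :
    η ![v, w] = -formPairing η w v := by
  rw [formPairing_apply, alternating_two_swap]

theorem eq_of_pairing_eq {η : V [⋀^Fin 2]→L[ℝ] ℝ} {W : Submodule ℝ V}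
    (hn : ∀ v ∈ W, (∀ w ∈ W, η ![v, w] = 0) → v = 0) {w w' : V} (hw : w ∈ W) (hw' : w' ∈ W)
    (h : ∀ v ∈ W, η ![v, w] = η ![v, w']) : w = w' := by
  refine sub_eq_zero.1 (hn _ (W.sub_mem hw hw') fun v hv => ?_)
  rw [alternating_two_swap, ← formPairing_apply, map_sub, formPairing_apply, formPairing_apply,
    h v hv, sub_self, neg_zero]

end Pairing

/-- Through the inner product on `W`, the restriction of `Ω y` becomes an operator `B y` with `⟨v, B
y w⟩ = Ω y (v, w)`; it is invertible at `y₀` by nondegeneracy, hence nearby. `H y a` is the inverse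
operator applied to `P a`, the vector representing `a` on `W`. -/
theorem exists_contDiffOn_inverse_tensor {F V : Type*} [NormedAddCommGroup F] [NormedSpace ℝ F]
    [NormedAddCommGroup V] [InnerProductSpace ℝ V] [FiniteDimensional ℝ V] {W : Submodule ℝ V}
    {Ω : F → V [⋀^Fin 2]→L[ℝ] ℝ} {O : Set F} (hO : IsOpen O) (hΩ : ContDiffOn ℝ ∞ Ω O) {y₀ : F}
    (hy₀ : y₀ ∈ O) (hn : ∀ v ∈ W, (∀ w ∈ W, Ω y₀ ![v, w] = 0) → v = 0) :
    ∃ O' ⊆ O, IsOpen O' ∧ y₀ ∈ O' ∧ ∃ H : F → (V →L[ℝ] ℝ) →L[ℝ] V, ContDiffOn ℝ ∞ H O' ∧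
      ∀ y ∈ O', ∀ a, H y a ∈ W ∧ ∀ v ∈ W, Ω y ![v, H y a] = a v := by
  let e := stdOrthonormalBasis ℝ W
  let B : F → W →L[ℝ] W := fun y =>
    ∑ i, (formPairing (Ω y) (e i : V) ∘L W.subtypeL).smulRight (e i)
  have hBa (y : F) (w : W) : B y w = ∑ i, Ω y ![(e i : V), w] • e i := by
    simp [B]
  have hB (y : F) (v w : W) : inner ℝ v (B y w) = Ω y ![(v : V), w] := by
    have h1 : Ω y ![(v : V), w] = -formPairing (Ω y) w (∑ i, inner ℝ (e i) v • e i : W) := by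
      rw [formPairing_swap, e.sum_repr' v]
    rw [hBa, inner_sum, h1]
    simp only [AddSubmonoidClass.coe_finsetSum, Submodule.coe_smul, map_sum, map_smul, smul_eq_mul,
      inner_smul_right, formPairing_apply, ← Finset.sum_neg_distrib]
    refine Finset.sum_congr rfl fun i _ => ?_
    rw [alternating_two_swap, real_inner_comm]
    ring
  have hBs : ContDiffOn ℝ ∞ B O := by
    refine contDiffOn_clm_apply.2 fun w => ?_
    simp only [hBa]
    have h1 (v : Fin 2 → V) : ContDiffOn ℝ ∞ (fun y => Ω y v) O := fun y hy =>
      (contDiffAt_alternating_iff.1 (hΩ.contDiffAt (hO.mem_nhds hy)) v).contDiffWithinAt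
    exact ContDiffOn.sum fun i _ => (h1 ![(e i : V), w]).smul contDiffOn_const
  have hu : IsUnit (B y₀) := by
    have hinj : Function.Injective (B y₀) := by
      refine (injective_iff_map_eq_zero _).2 fun w hw => ?_
      have : (w : V) = 0 := hn w w.2 fun v hv => by
        have := hB y₀ ⟨v, hv⟩ w
        rw [hw, inner_zero_right] at this
        rw [alternating_two_swap, ← this, neg_zero]
      exact Subtype.ext this
    exact ContinuousLinearMap.isUnit_iff_isUnit_toLinearMap.2
      ((Module.End.isUnit_iff _).2 ⟨hinj, LinearMap.injective_iff_surjective.1 hinj⟩)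
  obtain ⟨O', hO'O, hO', hy₀', K, hK, hBK⟩ := exists_contDiffOn_inverse hO hBs hy₀ hu
  let P : (V →L[ℝ] ℝ) →L[ℝ] W :=
    ∑ i, (ContinuousLinearMap.apply ℝ ℝ (e i : V)).smulRight (e i)
  have hP (a : V →L[ℝ] ℝ) (v : W) : inner ℝ v (P a) = a v := by
    have h1 : a v = a (∑ i, inner ℝ (e i) v • e i : W) := by rw [e.sum_repr' v]
    rw [h1]
    simp only [P, AddSubmonoidClass.coe_finsetSum, Submodule.coe_smul, map_sum, map_smul,
      smul_eq_mul, inner_sum, sum_apply, ContinuousLinearMap.smulRight_apply, inner_smul_right,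
      ContinuousLinearMap.apply_apply]
    refine Finset.sum_congr rfl fun i _ => ?_
    rw [real_inner_comm]
    ring
  refine ⟨O', hO'O, hO', hy₀', fun y => W.subtypeL ∘L K y ∘L P,
    contDiffOn_const.clm_comp (hK.clm_comp contDiffOn_const), fun y hy a => ⟨(K y (P a)).2, ?_⟩⟩
  intro v hv
  have := hB y ⟨v, hv⟩ (K y (P a))
  rw [(hBK y hy).2, hP] at this
  exact this.symm

/-! ### Leafwise forms and tensors in foliated charts -/

section Leafwise

variable {m : ℕ} {M : Type*} [TopologicalSpace M] [ChartedSpace (EuclideanSpace ℝ (Fin m)) M]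
  [IsManifold (𝓡 m) ∞ M] {p : ℕ} {D : Distribution m M}

theorem pullbackForm_symm_apply {φ : OpenPartialHomeomorph M (𝔼 m)}
    (hφ : φ ∈ maximalAtlas (𝓡 m) ∞ M) {k : ℕ} (θ : Form m M k) {x : M} (hx : x ∈ φ.source)
    (v : Fin k → 𝔼 m) :
    pullbackForm φ.symm θ (φ x) v = θ x (fun i => chartDerivInv φ x (v i)) := by
  rw [form_apply_eq hφ θ hx]
  simp only [chartDeriv_chartDerivInv hφ hx]

theorem pullbackForm_symm_apply_two {φ : OpenPartialHomeomorph M (𝔼 m)}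
    (hφ : φ ∈ maximalAtlas (𝓡 m) ∞ M) (θ : Form m M 2) {x : M} (hx : x ∈ φ.source)
    (v w : 𝔼 m) :
    pullbackForm φ.symm θ (φ x) ![v, w] = θ x ![chartDerivInv φ x v, chartDerivInv φ x w] := by
  rw [pullbackForm_symm_apply hφ θ hx]
  congr 1
  funext i; fin_cases i <;> rfl

theorem chartDerivInv_mem {φ : OpenPartialHomeomorph M (𝔼 m)}
    (hφ : φ ∈ maximalAtlas (𝓡 m) ∞ M) {W : Submodule ℝ (𝔼 m)} {x : M} (hx : x ∈ φ.source)
    (hW : ∀ v : TangentSpace (𝓡 m) x, v ∈ D x ↔ chartDeriv φ x v ∈ W) {w : 𝔼 m} (hw : w ∈ W) :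
    chartDerivInv φ x w ∈ D x := by
  rw [hW, chartDeriv_chartDerivInv hφ hx]
  exact hw

theorem IsFoliation.exists_chart (hD : IsFoliation p D) (x : M) :
    ∃ φ ∈ maximalAtlas (𝓡 m) ∞ M, x ∈ φ.source ∧ ∃ W : Submodule ℝ (𝔼 m),
      Module.finrank ℝ W = p ∧
      ∀ y ∈ φ.source, ∀ v : TangentSpace (𝓡 m) y, v ∈ D y ↔ chartDeriv φ y v ∈ W :=
  hD x

theorem IsFoliation.finrank_eq (hD : IsFoliation p D) (x : M) : Module.finrank ℝ (D x) = p := by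
  obtain ⟨φ, hφ, hx, W, hWp, hW⟩ := hD.exists_chart x
  have h1 : (D x).map (chartDeriv φ x).toLinearMap = W := by
    ext w
    constructor
    · rintro ⟨v, hv, rfl⟩
      exact (hW x hx v).1 hv
    · intro hw
      exact ⟨chartDerivInv φ x w, chartDerivInv_mem hφ hx (hW x hx) hw,
        chartDeriv_chartDerivInv hφ hx w⟩
  have hinj : Function.Injective (chartDeriv φ x).toLinearMap :=
    Function.LeftInverse.injective (chartDerivInv_chartDeriv hφ hx)
  rw [← hWp, ← h1]
  exact (Submodule.equivMapOfInjective _ hinj (D x)).finrank_eq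

theorem LeafwiseNondegenerate.chart {Ω : Form m M 2} (hn : LeafwiseNondegenerate D Ω)
    {φ : OpenPartialHomeomorph M (𝔼 m)} (hφ : φ ∈ maximalAtlas (𝓡 m) ∞ M)
    {W : Submodule ℝ (𝔼 m)} {x : M} (hx : x ∈ φ.source)
    (hW : ∀ v : TangentSpace (𝓡 m) x, v ∈ D x ↔ chartDeriv φ x v ∈ W) :
    ∀ v ∈ W, (∀ w ∈ W, pullbackForm φ.symm Ω (φ x) ![v, w] = 0) → v = 0 := by
  intro v hv h
  have h1 := hn x _ (chartDerivInv_mem hφ hx hW hv) fun w hw => by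
    have := h _ ((hW w).1 hw)
    rwa [pullbackForm_symm_apply_two hφ Ω hx, chartDerivInv_chartDeriv hφ hx] at this
  rw [← chartDeriv_chartDerivInv hφ hx v, h1, map_zero]

/-- A tensor inverse to `Ω` along `D` in a foliated chart. -/
theorem tensorRep_inverse {Ω : Form m M 2} {h : TwoTensor m M}
    {φ : OpenPartialHomeomorph M (𝔼 m)} (hφ : φ ∈ maximalAtlas (𝓡 m) ∞ M)
    {W : Submodule ℝ (𝔼 m)} {x : M} (hx : x ∈ φ.source)
    (hW : ∀ v : TangentSpace (𝓡 m) x, v ∈ D x ↔ chartDeriv φ x v ∈ W)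
    (hh : ∀ a, h x a ∈ D x ∧ ∀ v ∈ D x, Ω x ![v, h x a] = a v) (a : 𝔼 m →L[ℝ] ℝ) :
    tensorRep φ h (φ x) a ∈ W ∧
      ∀ v ∈ W, pullbackForm φ.symm Ω (φ x) ![v, tensorRep φ h (φ x) a] = a v := by
  have h1 := hh (a ∘L chartDeriv φ x)
  rw [tensorRep_apply h hx]
  refine ⟨(hW _).1 h1.1, fun v hv => ?_⟩
  rw [pullbackForm_symm_apply_two hφ Ω hx, chartDerivInv_chartDeriv hφ hx,
    h1.2 _ (chartDerivInv_mem hφ hx hW hv)]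
  exact congrArg a (chartDeriv_chartDerivInv hφ hx v)

/-- A leaf vector `w` is the image of the covector `v ↦ Ω (v, w)`, by uniqueness of the vector
representing a covector on the leaf. -/
theorem LeafwiseNondegenerate.range_eq {Ω : Form m M 2} (hn : LeafwiseNondegenerate D Ω)
    {h : TwoTensor m M} (hh : ∀ x a, h x a ∈ D x ∧ ∀ v ∈ D x, Ω x ![v, h x a] = a v) :
    casimirDistribution h = D := by
  funext x
  refine le_antisymm ?_ fun w hw => ?_
  · rintro _ ⟨a, rfl⟩
    exact (hh x a).1
  · refine ⟨-formPairing (Ω x) w, eq_of_pairing_eq (hn x) (hh x _).1 hw fun v hv => ?_⟩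
    rw [formPairing_swap _ v w]
    exact (hh x _).2 v hv

theorem IsTensorOf.mem_and_inverse {Ω : Form m M 2} {h : TwoTensor m M} (hh : IsTensorOf D Ω h)
    (x : M) (a : TangentSpace (𝓡 m) x →L[ℝ] ℝ) :
    h x a ∈ D x ∧ ∀ v ∈ D x, Ω x ![v, h x a] = a v := by
  refine ⟨?_, hh.inverse x a⟩
  rw [← hh.range_eq]
  exact ⟨a, rfl⟩

theorem LeafwiseNondegenerate.eq_of_isTensorOf {Ω : Form m M 2} (hn : LeafwiseNondegenerate D Ω)
    {h h' : TwoTensor m M} (hh : IsTensorOf D Ω h) (hh' : IsTensorOf D Ω h') : h = h' := by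
  funext x
  refine ContinuousLinearMap.ext fun a => eq_of_pairing_eq (hn x) (hh.mem_and_inverse x a).1
    (hh'.mem_and_inverse x a).1 fun v hv => ?_
  rw [hh.inverse x a v hv, hh'.inverse x a v hv]

/-- In a foliated chart, the exterior derivative of `Ω` along the leaves is the Jacobiator. -/
theorem extD_apply_eq_jacobiator {Ω : Form m M 2} (hΩ : SmoothForm Ω) {h : TwoTensor m M}
    (hs : SmoothTensor h)
    (hsk : ∀ (x : M) (a b : TangentSpace (𝓡 m) x →L[ℝ] ℝ), a (h x b) = -b (h x a))
    (hh : ∀ x a, h x a ∈ D x ∧ ∀ v ∈ D x, Ω x ![v, h x a] = a v)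
    {φ : OpenPartialHomeomorph M (𝔼 m)} (hφ : φ ∈ maximalAtlas (𝓡 m) ∞ M)
    {W : Submodule ℝ (𝔼 m)}
    (hW : ∀ y ∈ φ.source, ∀ v : TangentSpace (𝓡 m) y, v ∈ D y ↔ chartDeriv φ y v ∈ W)
    {y : 𝔼 m} (hy : y ∈ φ.target) (a b c : 𝔼 m →L[ℝ] ℝ) :
    pullbackForm φ.symm (extD Ω) y
      ![tensorRep φ h y c, tensorRep φ h y b, tensorRep φ h y a]
      = -jacobiator (tensorRep φ h) y a b c := by
  have hnhds := φ.open_target.mem_nhds hy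
  have hinv : ∀ z ∈ φ.target, ∀ a, tensorRep φ h z a ∈ W ∧
      ∀ v ∈ W, pullbackForm φ.symm Ω z ![v, tensorRep φ h z a] = a v := fun z hz a => by
    have := tensorRep_inverse hφ (φ.map_target hz) (hW _ (φ.map_target hz)) (hh _) a
    rwa [φ.right_inv hz] at this
  rw [hΩ.pullbackForm_extD (contMDiffAt_chart_symm hφ hy)]
  exact extDeriv_eq_neg_jacobiator (W := W)
    (((hs.contDiffOn_tensorRep hφ).contDiffAt hnhds).differentiableAt (by simp))
    (((hΩ.contDiffOn_chart hφ).contDiffAt hnhds).differentiableAt (by simp))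
    (Eventually.of_forall fun z => tensorRep_skew hsk z)
    (mem_of_superset hnhds fun z hz a => (hinv z hz a).1)
    (mem_of_superset hnhds fun z hz a => (hinv z hz a).2) a b c

/-- Nondegeneracy gives the tensor at each point, skewness is inherited from `Ω`, and the Jacobiator
is minus `dΩ` on leaf vectors, hence zero. -/
theorem IsFoliation.exists_isTensorOf (hD : IsFoliation p D) {Ω : Form m M 2}
    (hΩ : IsLeafwiseSymplectic p D Ω) :
    ∃ h : TwoTensor m M, IsTensorOf D Ω h ∧ IsPoisson h ∧ HasConstRank h p := by
  have hloc : ∀ x : M, ∃ φ ∈ maximalAtlas (𝓡 m) ∞ M, x ∈ φ.source ∧ ∃ W : Submodule ℝ (𝔼 m),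
      (∀ y ∈ φ.source, ∀ v : TangentSpace (𝓡 m) y, v ∈ D y ↔ chartDeriv φ y v ∈ W) ∧
      ∃ O ⊆ φ.target, IsOpen O ∧ φ x ∈ O ∧ ∃ H : 𝔼 m → (𝔼 m →L[ℝ] ℝ) →L[ℝ] 𝔼 m,
        ContDiffOn ℝ ∞ H O ∧ ∀ y ∈ O, ∀ a, H y a ∈ W ∧
          ∀ v ∈ W, pullbackForm φ.symm Ω y ![v, H y a] = a v := by
    intro x
    obtain ⟨φ, hφ, hx, W, -, hW⟩ := hD.exists_chart x
    exact ⟨φ, hφ, hx, W, hW, exists_contDiffOn_inverse_tensor φ.open_target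
      (hΩ.smooth.contDiffOn_chart hφ) (φ.map_source hx)
      (hΩ.nondegenerate.chart hφ hx (hW x hx))⟩
  -- The tensor is chosen point by point. By nondegeneracy there is no freedom in the choice, so it
  -- agrees with the smooth local inverses of `hloc`.
  have hpt : ∀ x : M, ∃ L : (TangentSpace (𝓡 m) x →L[ℝ] ℝ) →L[ℝ] TangentSpace (𝓡 m) x,
      ∀ a, L a ∈ D x ∧ ∀ v ∈ D x, Ω x ![v, L a] = a v := by
    intro x
    obtain ⟨φ, hφ, hx, W, hW, O, -, -, hxO, H, -, hH⟩ := hloc x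
    refine ⟨chartDerivInv φ x ∘L H (φ x) ∘L ContinuousLinearMap.precomp ℝ (chartDerivInv φ x),
      fun a => ?_⟩
    have h1 := hH _ hxO (a ∘L chartDerivInv φ x)
    refine ⟨chartDerivInv_mem hφ hx (hW x hx) h1.1, fun v hv => ?_⟩
    have h2 := h1.2 _ ((hW x hx v).1 hv)
    rw [pullbackForm_symm_apply_two hφ Ω hx, chartDerivInv_chartDeriv hφ hx] at h2
    exact h2.trans (congrArg a (chartDerivInv_chartDeriv hφ hx v))
  choose h hh using hpt
  have hsk : ∀ (x : M) (a b : TangentSpace (𝓡 m) x →L[ℝ] ℝ), a (h x b) = -b (h x a) := by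
    intro x a b
    rw [← (hh x a).2 _ (hh x b).1, ← (hh x b).2 _ (hh x a).1, alternating_two_swap]
  have hs : SmoothTensor h := by
    refine smoothTensor_of_local fun x => ?_
    obtain ⟨φ, hφ, hx, W, hW, O, hOt, hO, hxO, H, hHs, hH⟩ := hloc x
    refine ⟨φ, hφ, hx, (hHs.contDiffAt (hO.mem_nhds hxO)).congr_of_eventuallyEq ?_⟩
    filter_upwards [hO.mem_nhds hxO] with y hy
    have hy' := φ.map_target (hOt hy)
    have h1 := hΩ.nondegenerate.chart hφ hy' (hW _ hy')
    have h2 := tensorRep_inverse hφ hy' (hW _ hy') (hh _)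
    rw [φ.right_inv (hOt hy)] at h1 h2
    refine ContinuousLinearMap.ext fun a => eq_of_pairing_eq h1 (h2 a).1 (hH y hy a).1
      fun v hv => ?_
    rw [(h2 a).2 v hv, (hH y hy a).2 v hv]
  have hr := hΩ.nondegenerate.range_eq hh
  refine ⟨h, ⟨hr, fun x a => (hh x a).2⟩, ⟨hs, hsk, fun f g l hf hg hl x => ?_⟩, fun x => ?_⟩
  · obtain ⟨φ, hφ, hx, W, -, hW⟩ := hD.exists_chart x
    rw [jacobi_eq hφ hs hsk hx hf hg hl, ← neg_neg (jacobiator _ _ _ _ _),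
      ← extD_apply_eq_jacobiator hΩ.smooth hs hsk hh hφ hW (φ.map_source hx),
      pullbackForm_symm_apply hφ _ hx, (hD.leafwiseClosed_iff hΩ.smooth).1 hΩ.closed, neg_zero]
    have h2 := fun a => (tensorRep_inverse hφ hx (hW _ hx) (hh _) a).1
    intro i
    refine chartDerivInv_mem hφ hx (hW x hx) ?_
    fin_cases i
    · exact h2 _
    · exact h2 _
    · exact h2 _
  · change Module.finrank ℝ (casimirDistribution h x) = p
    rw [hr]
    exact hD.finrank_eq x

/-- Uniqueness comes from `IsTensorOf` alone; neither smoothness nor the Jacobi identity enters. -/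
theorem IsFoliation.existsUnique_isTensorOf (hD : IsFoliation p D) {Ω : Form m M 2}
    (hΩ : IsLeafwiseSymplectic p D Ω) :
    ∃! h : TwoTensor m M, IsTensorOf D Ω h ∧ IsPoisson h ∧ HasConstRank h p := by
  obtain ⟨h, hh⟩ := hD.exists_isTensorOf hΩ
  exact ⟨h, hh, fun h' hh' => hΩ.nondegenerate.eq_of_isTensorOf hh'.1 hh.1⟩

/-- Leaf vectors are the values of `h`, so `h` determines the restriction of an inverse form to the
leaves. Two forms with a common tensor thus agree there; conversely, closedness, nondegeneracy and
the inverse relation see only these restrictions. -/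
theorem IsFoliation.same_tensor_iff [T2Space M] [SecondCountableTopology M]
    (hD : IsFoliation p D) {Ω Ω' : Form m M 2}
    (hΩ : IsLeafwiseSymplectic p D Ω) (hΩ' : SmoothForm Ω') :
    (IsLeafwiseSymplectic p D Ω' ∧
        ∃ h : TwoTensor m M, IsPoisson h ∧ IsTensorOf D Ω h ∧ IsTensorOf D Ω' h) ↔
      Ω' - Ω ∈ foliationIdeal D 2 := by
  rw [hD.mem_foliationIdeal_iff]
  constructor
  · rintro ⟨-, h, -, h1, h2⟩
    refine ⟨hΩ'.sub hΩ.smooth, fun x v hv => ?_⟩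
    obtain ⟨a, ha⟩ : v 1 ∈ casimirDistribution h x := by rw [h1.range_eq]; exact hv 1
    have hv' : v = ![v 0, h x a] := by
      funext i; fin_cases i
      · rfl
      · exact ha.symm
    change Ω' x v - Ω x v = 0
    rw [hv', h1.inverse x a _ (hv 0), h2.inverse x a _ (hv 0), sub_self]
  · rintro ⟨-, hv⟩
    have heq : ∀ x, ∀ v ∈ D x, ∀ w ∈ D x, Ω' x ![v, w] = Ω x ![v, w] := fun x v hvD w hwD => by
      have : Ω' x ![v, w] - Ω x ![v, w] = 0 := hv x ![v, w] fun i => by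
        fin_cases i
        · exact hvD
        · exact hwD
      linarith
    refine ⟨⟨hΩ', fun U f hf u hu => ?_, fun x v hvD h => hΩ.nondegenerate x v hvD fun w hw => by
      rw [← heq x v hvD w hw]; exact h w hw⟩, ?_⟩
    · rw [← hΩ.closed U f hf u hu]
      refine Filter.EventuallyEq.extDeriv_eq ?_
      filter_upwards [hf.isOpen.mem_nhds hu] with z hz
      exact sub_eq_zero.1 (hv.pullbackForm_eq_zero hf hz)
    · obtain ⟨h, h1, h2, -⟩ := hD.exists_isTensorOf hΩ
      refine ⟨h, h2, h1, h1.range_eq, fun x a v hvD => ?_⟩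
      rw [heq x v hvD _ (h1.mem_and_inverse x a).1, h1.inverse x a v hvD]

end Leafwise

/-! ### Integrability of the image of a Poisson tensor of constant rank -/

section Integrability

variable {E : Type*} [NormedAddCommGroup E] [NormedSpace ℝ E]

theorem clm_separates [FiniteDimensional ℝ E] {v w : E} (h : ∀ a : E →L[ℝ] ℝ, a v = a w) :
    v = w := by
  let b := Module.finBasis ℝ E
  exact b.ext_elem fun i => h (b.coord i).toContinuousLinearMap

/-- The bracket of the vector fields `H b` and `H c` is tangent to the image of `H`. -/
theorem hamiltonian_bracket_mem_range [FiniteDimensional ℝ E]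
    {H : E → (E →L[ℝ] ℝ) →L[ℝ] E} {y : E} (hH : DifferentiableAt ℝ H y)
    (hs : ∀ᶠ z in 𝓝 y, ∀ a b : E →L[ℝ] ℝ, a (H z b) = -b (H z a))
    (hJ : ∀ a b c, jacobiator H y a b c = 0) (b c : E →L[ℝ] ℝ) :
    fderiv ℝ H y (H y c) b - fderiv ℝ H y (H y b) c ∈ LinearMap.range (H y).toLinearMap := by
  -- Paired with `a`, the Jacobi identity contains the bracket in its first and third terms; the
  -- second is the covector `u ↦ b (∂_u H c)` at `H y a`, and skewness moves `H y` onto this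
  -- covector.
  refine ⟨b ∘L (fderiv ℝ H y).flip c, ?_⟩
  refine clm_separates fun a => ?_
  have h1 := hJ a b c
  have h2 : a (H y (b ∘L (fderiv ℝ H y).flip c)) = -b (fderiv ℝ H y (H y a) c) :=
    hs.self_of_nhds a _
  have h3 := fderiv_skew hH hs (H y b) c a
  rw [jacobiator] at h1
  change a (H y (b ∘L (fderiv ℝ H y).flip c)) = _
  rw [h2, map_sub]
  linarith

/-- Lift `W` to covectors by a right inverse `ι` of `H y₀`. Then `P ∘ H y ∘ ι` is the identity at
`y₀` and invertible nearby; correcting `ι` by its inverse normalizes the frame `H y (β y u)` to have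
`P`-component `u`. -/
theorem exists_adapted_frame [FiniteDimensional ℝ E] {H : E → (E →L[ℝ] ℝ) →L[ℝ] E} {O : Set E}
    (hO : IsOpen O) (hH : ContDiffOn ℝ ∞ H O) {r : ℕ}
    (hr : ∀ y ∈ O, Module.finrank ℝ (LinearMap.range (H y).toLinearMap) = r) {y₀ : E} (hy₀ : y₀ ∈ O)
    {W : Submodule ℝ E} (hW : W = LinearMap.range (H y₀).toLinearMap) (P : E →L[ℝ] W)
    (hP : ∀ w : W, P w = w) :
    ∃ O' ⊆ O, IsOpen O' ∧ y₀ ∈ O' ∧ ∃ β : E → W →L[ℝ] E →L[ℝ] ℝ, ContDiffOn ℝ ∞ β O' ∧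
      ∀ y ∈ O', (∀ u, P (H y (β y u)) = u) ∧
        ∀ v ∈ LinearMap.range (H y).toLinearMap, H y (β y (P v)) = v := by
  obtain ⟨ι, hι⟩ : ∃ ι : W →L[ℝ] E →L[ℝ] ℝ, ∀ w, H y₀ (ι w) = w := by
    subst hW
    obtain ⟨g, hg⟩ := (H y₀).toLinearMap.rangeRestrict.exists_rightInverse_of_surjective
      (LinearMap.range_rangeRestrict _)
    exact ⟨g.toContinuousLinearMap, fun w => congrArg Subtype.val (LinearMap.congr_fun hg w)⟩
  have hB : ContDiffOn ℝ ∞ (fun y => P ∘L H y ∘L ι) O :=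
    contDiffOn_const.clm_comp (hH.clm_comp contDiffOn_const)
  have h0 : P ∘L H y₀ ∘L ι = 1 := by
    refine ContinuousLinearMap.ext fun w => ?_
    change P (H y₀ (ι w)) = w
    rw [hι, hP]
  obtain ⟨O', hsub, hO', hy₀', K, hK, hBK⟩ := exists_contDiffOn_inverse hO hB hy₀
    (by rw [h0]; exact isUnit_one)
  refine ⟨O', hsub, hO', hy₀', fun y => ι ∘L K y, contDiffOn_const.clm_comp hK, fun y hy => ?_⟩
  have h1 : ∀ u, P (H y (ι (K y u))) = u := (hBK y hy).2
  refine ⟨h1, fun v hv => ?_⟩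
  let S : W →ₗ[ℝ] E := (H y ∘L ι ∘L K y).toLinearMap
  have hS : Function.Injective S := Function.LeftInverse.injective (g := P) h1
  have hle : LinearMap.range S ≤ LinearMap.range (H y).toLinearMap := by
    rintro _ ⟨u, rfl⟩
    exact ⟨_, rfl⟩
  -- Constant rank enters here: the frame spans a subspace of the image of the same dimension.
  have heq : LinearMap.range S = LinearMap.range (H y).toLinearMap := by
    refine Submodule.eq_of_le_of_finrank_eq hle ?_
    rw [LinearMap.finrank_range_of_inj hS, hr y (hsub hy), ← hr y₀ hy₀, hW]
  rw [← heq] at hv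
  obtain ⟨u, rfl⟩ := hv
  change H y (ι (K y (P (H y (ι (K y u)))))) = H y (ι (K y u))
  rw [h1]

/-- The frame fields have constant `P`-component, so their bracket has `P`-component zero. It also
lies in the image of `H y`, where `P` is injective by `h2`; hence the frame fields commute. -/
theorem fderiv_frame_symm [FiniteDimensional ℝ E] {H : E → (E →L[ℝ] ℝ) →L[ℝ] E} {W : Submodule ℝ E}
    {P : E →L[ℝ] W} {β : E → W →L[ℝ] E →L[ℝ] ℝ} {y : E} (hH : DifferentiableAt ℝ H y)
    (hβ : DifferentiableAt ℝ β y)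
    (hs : ∀ᶠ z in 𝓝 y, ∀ a b : E →L[ℝ] ℝ, a (H z b) = -b (H z a))
    (hJ : ∀ a b c, jacobiator H y a b c = 0)
    (h1 : ∀ᶠ z in 𝓝 y, ∀ u, P (H z (β z u)) = u)
    (h2 : ∀ v ∈ LinearMap.range (H y).toLinearMap, H y (β y (P v)) = v) (u v : W) :
    fderiv ℝ (fun z => H z ∘L β z) y (H y (β y u)) v
      = fderiv ℝ (fun z => H z ∘L β z) y (H y (β y v)) u := by
  have hS := hH.hasFDerivAt.clm_comp hβ.hasFDerivAt
  have hSa (w : E) (u : W) : fderiv ℝ (fun z => H z ∘L β z) y w u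
      = fderiv ℝ H y w (β y u) + H y (fderiv ℝ β y w u) := by
    rw [hS.fderiv]
    simp [add_comm]
  have hP (w : E) (u : W) : P (fderiv ℝ (fun z => H z ∘L β z) y w u) = 0 := by
    have h3 : HasFDerivAt (fun z => P ((H z ∘L β z) u))
        (P ∘L (fderiv ℝ (fun z => H z ∘L β z) y).flip u) y := by
      have := P.hasFDerivAt.comp y (hS.differentiableAt.hasFDerivAt.clm_apply
        (hasFDerivAt_const u y))
      refine this.congr_fderiv ?_
      ext w
      simp
    have h4 := h3.unique ((hasFDerivAt_const u y).congr_of_eventuallyEq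
      (h1.mono fun z hz => hz u))
    exact congrArg (fun L : E →L[ℝ] W => L w) h4
  have hmem : fderiv ℝ (fun z => H z ∘L β z) y (H y (β y u)) v
      - fderiv ℝ (fun z => H z ∘L β z) y (H y (β y v)) u ∈ LinearMap.range (H y).toLinearMap := by
    rw [hSa, hSa, add_sub_add_comm]
    refine Submodule.add_mem _ (hamiltonian_bracket_mem_range hH hs hJ _ _) ?_
    rw [← map_sub]
    exact ⟨_, rfl⟩
  have h5 := h2 _ hmem
  rw [map_sub, hP, hP, sub_zero, map_zero, map_zero] at h5
  exact sub_eq_zero.1 h5.symm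

/-- The image of a Poisson tensor of constant rank on an open subset of a vector space is
integrable. -/
theorem exists_straightening {E : Type} [NormedAddCommGroup E] [InnerProductSpace ℝ E]
    [FiniteDimensional ℝ E] {H : E → (E →L[ℝ] ℝ) →L[ℝ] E} {O : Set E}
    (hO : IsOpen O) (hH : ContDiffOn ℝ ∞ H O) {r : ℕ}
    (hr : ∀ y ∈ O, Module.finrank ℝ (LinearMap.range (H y).toLinearMap) = r)
    (hs : ∀ y ∈ O, ∀ a b : E →L[ℝ] ℝ, a (H y b) = -b (H y a))
    (hJ : ∀ y ∈ O, ∀ a b c, jacobiator H y a b c = 0) {y₀ : E} (hy₀ : y₀ ∈ O) :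
    ∃ χ : OpenPartialHomeomorph E E, y₀ ∈ χ.source ∧ χ.source ⊆ O ∧
      ContDiffOn ℝ ∞ χ χ.source ∧ ContDiffOn ℝ ∞ χ.symm χ.target ∧
      ∃ W : Submodule ℝ E, Module.finrank ℝ W = r ∧
        ∀ y ∈ χ.source, ∀ v, v ∈ LinearMap.range (H y).toLinearMap ↔ fderiv ℝ χ y v ∈ W := by
  obtain ⟨W, hW⟩ : ∃ W, W = LinearMap.range (H y₀).toLinearMap := ⟨_, rfl⟩
  let L : E ≃L[ℝ] W × Wᗮ := (Submodule.prodEquivOfIsCompl W Wᗮ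
    W.isCompl_orthogonal).symm.toContinuousLinearEquiv
  have hLs (q : W × Wᗮ) : L.symm q = q.1 + q.2 := rfl
  have hLW (w : W) : L w = (w, 0) := by
    rw [← L.symm.injective.eq_iff, L.symm_apply_apply, hLs]
    simp
  let P : E →L[ℝ] W := ContinuousLinearMap.fst ℝ W Wᗮ ∘L L
  let Q : E →L[ℝ] Wᗮ := ContinuousLinearMap.snd ℝ W Wᗮ ∘L L
  obtain ⟨O', hsub, hO', hy₀', β, hβ, hβ'⟩ := exists_adapted_frame hO hH hr hy₀ hW P
    fun w => congrArg Prod.fst (hLW w)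
  let S : E → W →L[ℝ] E := fun y => H y ∘L β y
  have hS : ContDiffOn ℝ ∞ S O' := (hH.mono hsub).clm_comp hβ
  -- In the splitting `W × Wᗮ` the frame vector for `u` is `(u, F u)`: the image of `H` is the graph
  -- of `F`, and commuting frame fields give the symmetry required by Frobenius.
  let F : W × Wᗮ → W →L[ℝ] Wᗮ := fun q => Q ∘L S (L.symm q)
  have hLc : ContDiff ℝ ∞ L.symm := L.symm.contDiff
  have hF : ContDiffOn ℝ ∞ F (L.symm ⁻¹' O') :=
    contDiffOn_const.clm_comp (hS.comp hLc.contDiffOn fun q hq => hq)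
  have hLS : ∀ y ∈ O', ∀ u, L (S y u) = (u, Q (S y u)) := fun y hy u =>
    Prod.ext ((hβ' y hy).1 u) rfl
  have hint : ∀ q ∈ L.symm ⁻¹' O', ∀ u v, fderiv ℝ F q (u, F q u) v = fderiv ℝ F q (v, F q v) u := by
    intro q hq u v
    have hd : HasFDerivAt S (fderiv ℝ S (L.symm q)) (L.symm q) :=
      ((hS.contDiffAt (hO'.mem_nhds hq)).differentiableAt (by simp)).hasFDerivAt
    have hFd (w : W × Wᗮ) (u : W) : fderiv ℝ F q w u = Q (fderiv ℝ S (L.symm q) (L.symm w) u) := by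
      have h3 := (hasFDerivAt_const Q q).clm_comp (hd.comp q L.symm.hasFDerivAt)
      rw [show F = fun q => Q ∘L (S ∘ L.symm) q from rfl, h3.fderiv]
      simp
    have hw (u : W) : L.symm (u, F q u) = S (L.symm q) u := by
      have h3 : (u, F q u) = L (S (L.symm q) u) := (hLS _ hq u).symm
      rw [h3]
      exact L.symm_apply_apply _
    rw [hFd, hFd, hw, hw]
    refine congrArg Q (fderiv_frame_symm ((hH.contDiffAt (hO.mem_nhds (hsub hq))).differentiableAt
      (by simp)) ((hβ.contDiffAt (hO'.mem_nhds hq)).differentiableAt (by simp))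
      (mem_of_superset (hO.mem_nhds (hsub hq)) hs) (hJ _ (hsub hq))
      (mem_of_superset (hO'.mem_nhds hq) fun z hz => (hβ' z hz).1) (hβ' _ hq).2 u v)
  obtain ⟨χ, h1, h2, h3, h4, h5⟩ := exists_flat_chart (hO'.preimage L.symm.continuous) hF hint
    (q₀ := L y₀) (by rw [mem_preimage, L.symm_apply_apply]; exact hy₀')
  let χ' : OpenPartialHomeomorph E E :=
    L.toHomeomorph.transOpenPartialHomeomorph (χ.transHomeomorph L.symm.toHomeomorph)
  have hχO : χ'.source ⊆ O' := fun y hy => by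
    have h6 : L.symm (L y) ∈ O' := h2 hy
    rwa [L.symm_apply_apply] at h6
  refine ⟨χ', h1, hχO.trans hsub, ?_, ?_, W, ?_, ?_⟩
  · exact L.symm.contDiff.comp_contDiffOn (h3.comp L.contDiff.contDiffOn fun y hy => hy)
  · exact L.symm.contDiff.comp_contDiffOn (h4.comp L.contDiff.contDiffOn fun y hy => hy)
  · rw [hW, hr y₀ hy₀]
  · intro y hy v
    have hd : HasFDerivAt χ (fderiv ℝ χ (L y)) (L y) :=
      ((h3.contDiffAt (χ.open_source.mem_nhds hy)).differentiableAt (by simp)).hasFDerivAt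
    have hd' : fderiv ℝ χ' y v = L.symm (fderiv ℝ χ (L y) (L v)) := by
      have h6 : HasFDerivAt χ' _ y :=
        L.symm.hasFDerivAt.comp y (hd.comp y L.hasFDerivAt)
      rw [h6.fderiv]
      rfl
    have hWi (q : W × Wᗮ) : L.symm q ∈ W ↔ q.2 = 0 := by
      rw [hLs]
      constructor
      · intro h
        have h7 : (q.2 : E) ∈ W := (Submodule.add_mem_iff_right W q.1.2).1 h
        have h8 : L ((q.2 : E)) = (⟨q.2, h7⟩, 0) := hLW ⟨q.2, h7⟩
        have h9 : L.symm (0, q.2) = (q.2 : E) := by rw [hLs]; simp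
        have h10 := (congrArg L h9).symm.trans (L.apply_symm_apply _)
        exact congrArg Prod.snd (h10.symm.trans h8)
      · intro h
        rw [h]
        simp
    rw [hd', hWi, h5 (L y) hy]
    have hFy : F (L y) (L v).1 = Q (S y (P v)) := by
      change Q (S (L.symm (L y)) (P v)) = _
      rw [L.symm_apply_apply]
    rw [hFy]
    constructor
    · intro hv
      exact congrArg Q ((hβ' y (hχO hy)).2 v hv).symm
    · intro hv
      have h10 : L v = L (S y (P v)) := by
        rw [hLS y (hχO hy)]
        exact Prod.ext rfl hv
      rw [L.injective h10]
      exact ⟨_, rfl⟩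

end Integrability

/-! ### The Casimir foliation on the manifold -/

section Casimir

variable {m : ℕ} {M : Type*} [TopologicalSpace M] [ChartedSpace (EuclideanSpace ℝ (Fin m)) M]
  [IsManifold (𝓡 m) ∞ M]

theorem trans_mem_maximalAtlas {φ : OpenPartialHomeomorph M (𝔼 m)}
    (hφ : φ ∈ maximalAtlas (𝓡 m) ∞ M) {χ : OpenPartialHomeomorph (𝔼 m) (𝔼 m)}
    (h : ContDiffOn ℝ ∞ χ χ.source) (h' : ContDiffOn ℝ ∞ χ.symm χ.target) :
    φ.trans χ ∈ maximalAtlas (𝓡 m) ∞ M := by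
  have hχ : χ ∈ contDiffGroupoid ∞ (𝓡 m) := by
    rw [contDiffGroupoid, mem_groupoid_of_pregroupoid]
    simp only [contDiffPregroupoid, mfld_simps]
    exact ⟨by simpa using h, by simpa using h'⟩
  intro e he
  have h1 := (contDiffGroupoid ∞ (𝓡 m)).compatible_of_mem_maximalAtlas hφ
    ((contDiffGroupoid ∞ (𝓡 m)).subset_maximalAtlas he)
  have h2 := (contDiffGroupoid ∞ (𝓡 m)).compatible_of_mem_maximalAtlas
    ((contDiffGroupoid ∞ (𝓡 m)).subset_maximalAtlas he) hφ
  constructor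
  · rw [OpenPartialHomeomorph.trans_symm_eq_symm_trans_symm, OpenPartialHomeomorph.trans_assoc]
    exact (contDiffGroupoid ∞ (𝓡 m)).trans ((contDiffGroupoid ∞ (𝓡 m)).symm hχ) h1
  · rw [← OpenPartialHomeomorph.trans_assoc]
    exact (contDiffGroupoid ∞ (𝓡 m)).trans h2 hχ

theorem mem_casimirDistribution_iff {φ : OpenPartialHomeomorph M (𝔼 m)}
    (hφ : φ ∈ maximalAtlas (𝓡 m) ∞ M) (h : TwoTensor m M) {x : M} (hx : x ∈ φ.source)
    (v : TangentSpace (𝓡 m) x) : v ∈ casimirDistribution h x ↔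
      chartDeriv φ x v ∈ LinearMap.range (tensorRep φ h (φ x)).toLinearMap := by
  constructor
  · rintro ⟨a, rfl⟩
    exact ⟨a ∘L chartDerivInv φ x, (tensor_apply_eq hφ h hx a).symm⟩
  · rintro ⟨b, hb⟩
    refine ⟨b ∘L chartDeriv φ x, ?_⟩
    have h1 := (tensorRep_apply h hx b).symm.trans hb
    exact Function.LeftInverse.injective (chartDerivInv_chartDeriv hφ hx) h1

theorem finrank_range_tensorRep {φ : OpenPartialHomeomorph M (𝔼 m)}
    (hφ : φ ∈ maximalAtlas (𝓡 m) ∞ M) (h : TwoTensor m M) {y : 𝔼 m} (hy : y ∈ φ.target) :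
    Module.finrank ℝ (LinearMap.range (tensorRep φ h y).toLinearMap)
      = Module.finrank ℝ (LinearMap.range (h (φ.symm y)).toLinearMap) := by
  have hx := φ.map_target hy
  have hinj : Function.Injective (chartDeriv φ (φ.symm y)).toLinearMap :=
    Function.LeftInverse.injective (chartDerivInv_chartDeriv hφ hx)
  have h1 : (LinearMap.range (h (φ.symm y)).toLinearMap).map (chartDeriv φ (φ.symm y)).toLinearMap
      = LinearMap.range (tensorRep φ h y).toLinearMap := by
    ext w
    constructor
    · rintro ⟨v, hv, rfl⟩
      have := (mem_casimirDistribution_iff hφ h hx v).1 hv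
      rwa [φ.right_inv hy] at this
    · rintro ⟨b, rfl⟩
      exact ⟨_, ⟨_, rfl⟩, rfl⟩
  rw [← h1]
  exact (Submodule.equivMapOfInjective _ hinj _).finrank_eq.symm

/-- The image of a Poisson tensor of constant rank is tangent to a foliation. -/
theorem IsPoisson.isFoliation [T2Space M] {h : TwoTensor m M} (hh : IsPoisson h) {r : ℕ}
    (hr : HasConstRank h r) : IsFoliation r (casimirDistribution h) := by
  intro x
  have hφ := chart_mem_maximalAtlas (I := 𝓡 m) (n := ∞) x
  set φ := chartAt (𝔼 m) x
  have hx : x ∈ φ.source := mem_chart_source _ x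
  obtain ⟨χ, h1, h2, h3, h4, W, hWr, hW⟩ := exists_straightening φ.open_target
    (hh.smooth.contDiffOn_tensorRep hφ) (r := r)
    (fun y hy => (finrank_range_tensorRep hφ h hy).trans (hr _))
    (fun y _ => tensorRep_skew hh.skew y) (fun y hy => hh.jacobiator_eq_zero hφ hy)
    (φ.map_source hx)
  refine ⟨φ.trans χ, trans_mem_maximalAtlas hφ h3 h4, ?_, W, hWr, ?_⟩
  · rw [OpenPartialHomeomorph.trans_source]
    exact ⟨hx, h1⟩
  · intro z hz v
    rw [OpenPartialHomeomorph.trans_source] at hz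
    have hd : (mfderiv (𝓡 m) (𝓡 m) (φ.trans χ) z v : 𝔼 m)
        = fderiv ℝ χ (φ z) (chartDeriv φ z v) := by
      have h5 := mfderiv_comp (I := 𝓡 m) (I' := 𝓡 m) (I'' := 𝓡 m) z
        (((h3.contDiffAt (χ.open_source.mem_nhds hz.2)).differentiableAt
          (by simp)).mdifferentiableAt) ((contMDiffAt_chart hφ hz.1).mdifferentiableAt (by simp))
      rw [mfderiv_eq_fderiv] at h5
      exact congrArg (fun L : TangentSpace (𝓡 m) z →L[ℝ] 𝔼 m => L v) h5
    rw [hd, mem_casimirDistribution_iff hφ h hz.1]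
    exact hW _ hz.2 _

end Casimir

/-! ### The leafwise symplectic form of a Poisson tensor of constant rank -/

/-- The skew part `B(v, w) - B(w, v)` of a bilinear form. -/
noncomputable def skewForm {V : Type*} [NormedAddCommGroup V] [NormedSpace ℝ V]
    (B : V →L[ℝ] V →L[ℝ] ℝ) : V [⋀^Fin 2]→L[ℝ] ℝ where
  toFun v := B (v 0) (v 1) - B (v 1) (v 0)
  map_update_add' v i x y := by
    fin_cases i <;> simp [Function.update] <;> ring
  map_update_smul' v i c x := by
    fin_cases i <;> simp [Function.update] <;> ring
  map_eq_zero_of_eq' v i j h hij := by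
    fin_cases i <;> fin_cases j <;> simp_all
  cont := by fun_prop

theorem skewForm_apply {V : Type*} [NormedAddCommGroup V] [NormedSpace ℝ V]
    (B : V →L[ℝ] V →L[ℝ] ℝ) (v w : V) : skewForm B ![v, w] = B v w - B w v := rfl

/-- The inverse of a smooth bivector field with fixed image, as a smooth 2-form. -/
theorem exists_contDiffOn_inverse_form {F V : Type*} [NormedAddCommGroup F] [NormedSpace ℝ F]
    [NormedAddCommGroup V] [InnerProductSpace ℝ V] [FiniteDimensional ℝ V] {W : Submodule ℝ V}
    {H : F → (V →L[ℝ] ℝ) →L[ℝ] V} {O : Set F} (hO : IsOpen O) (hH : ContDiffOn ℝ ∞ H O)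
    (hs : ∀ y ∈ O, ∀ a b : V →L[ℝ] ℝ, a (H y b) = -b (H y a))
    (hW : ∀ y ∈ O, LinearMap.range (H y).toLinearMap = W) {y₀ : F} (hy₀ : y₀ ∈ O) :
    ∃ O' ⊆ O, IsOpen O' ∧ y₀ ∈ O' ∧ ∃ Ω : F → V [⋀^Fin 2]→L[ℝ] ℝ, ContDiffOn ℝ ∞ Ω O' ∧
      ∀ y ∈ O', ∀ a, ∀ v ∈ W, Ω y ![v, H y a] = a v := by
  obtain ⟨P, hP⟩ : ∃ P : V →L[ℝ] W, ∀ (w : V) (hw : w ∈ W), P w = ⟨w, hw⟩ :=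
    ⟨W.orthogonalProjectionOnto, fun w hw =>
      Submodule.orthogonalProjectionOnto_mem_subspace_eq_self (⟨w, hw⟩ : W)⟩
  obtain ⟨ι, hι⟩ : ∃ ι : W →L[ℝ] V →L[ℝ] ℝ, ∀ u v, ι u v = inner ℝ u (P v) :=
    ⟨(ContinuousLinearMap.precomp ℝ P) ∘L innerSL ℝ, fun u v => rfl⟩
  have hHW : ∀ y ∈ O, ∀ a, H y a ∈ W := fun y hy a => by
    rw [← hW y hy]
    exact ⟨a, rfl⟩
  -- By skewness `H y a` depends only on the restriction of `a` to `W`, so `H y` descends to an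
  -- operator `A y` on `W`.
  have hker : ∀ y ∈ O, ∀ a b : V →L[ℝ] ℝ, (∀ v ∈ W, a v = b v) → H y a = H y b := by
    intro y hy a b hab
    refine clm_separates fun c => ?_
    rw [hs y hy c a, hs y hy c b, hab _ (hHW y hy c)]
  have hdual (a : V →L[ℝ] ℝ) : ∃ u : W, ∀ v ∈ W, ι u v = a v := by
    refine ⟨(InnerProductSpace.toDual ℝ W).symm (a ∘L W.subtypeL), fun v hv => ?_⟩
    rw [hι, hP v hv, InnerProductSpace.toDual_symm_apply]
    rfl
  let A : F → W →L[ℝ] W := fun y => P ∘L H y ∘L ι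
  have hA : ContDiffOn ℝ ∞ A O := contDiffOn_const.clm_comp (hH.clm_comp contDiffOn_const)
  have hu : IsUnit (A y₀) := by
    have hsurj : Function.Surjective (A y₀) := by
      intro w
      obtain ⟨a, ha⟩ : (w : V) ∈ LinearMap.range (H y₀).toLinearMap := by
        rw [hW y₀ hy₀]
        exact w.2
      obtain ⟨u, hu⟩ := hdual a
      refine ⟨u, ?_⟩
      have h1 : H y₀ (ι u) = w := (hker y₀ hy₀ _ _ hu).trans ha
      change P (H y₀ (ι u)) = w
      rw [h1, hP _ w.2]
    exact ContinuousLinearMap.isUnit_iff_isUnit_toLinearMap.2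
      ((Module.End.isUnit_iff _).2 ⟨LinearMap.injective_iff_surjective.2 hsurj, hsurj⟩)
  obtain ⟨O', hsub, hO', hy₀', K, hK, hAK⟩ := exists_contDiffOn_inverse hO hA hy₀ hu
  -- Taking the skew part makes the form alternating by construction, without proving that `K y` is
  -- skew. On the pair `(v, H y a)` each of its two terms contributes half of `a v`, whence the
  -- factor `2⁻¹`.
  obtain ⟨B, hB, hBa⟩ : ∃ B : F → V →L[ℝ] V →L[ℝ] ℝ, ContDiffOn ℝ ∞ B O' ∧
      ∀ y v w, B y v w = -(2⁻¹ * inner ℝ (K y (P v)) (P w)) := by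
    have h1 : ContDiffOn ℝ ∞ (fun y => ι ∘L K y ∘L P) O' :=
      contDiffOn_const.clm_comp (hK.clm_comp contDiffOn_const)
    refine ⟨fun y => (-2⁻¹ : ℝ) • (ι ∘L K y ∘L P), h1.const_smul _, fun y v w => ?_⟩
    rw [← hι, ← neg_mul]
    rfl
  refine ⟨O', hsub, hO', hy₀', fun y => skewForm (B y), fun y hy => ?_, fun y hy a v hv => ?_⟩
  · refine (contDiffAt_alternating_iff.2 fun v => ?_).contDiffWithinAt
    have hBy := hB.contDiffAt (hO'.mem_nhds hy)
    exact ((hBy.clm_apply contDiffAt_const).clm_apply contDiffAt_const).sub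
      ((hBy.clm_apply contDiffAt_const).clm_apply contDiffAt_const)
  · have hskew : ∀ u u' : W, inner ℝ u (A y u') = -inner ℝ u' (A y u) := fun u u' => by
      have h1 := hs y (hsub hy) (ι u) (ι u')
      rw [hι, hι] at h1
      exact h1
    obtain ⟨u, hu⟩ := hdual a
    have h1 : P (H y a) = A y u := by
      rw [← hker y (hsub hy) _ _ hu]
      rfl
    have h2 : inner ℝ (K y (P v)) (A y u) = -inner ℝ u (P v) := by
      rw [hskew, (hAK y hy).2]
    rw [skewForm_apply, hBa, hBa, h1, (hAK y hy).1, h2, ← hι u v, hu v hv]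
    ring

/-! ### Global inverse forms and their closedness on the leaves -/

section Symplectic

variable {m : ℕ} {M : Type*} [TopologicalSpace M] [ChartedSpace (EuclideanSpace ℝ (Fin m)) M]
  [IsManifold (𝓡 m) ∞ M]

theorem chartPullback_apply_two (φ : OpenPartialHomeomorph M (𝔼 m))
    (η : 𝔼 m → 𝔼 m [⋀^Fin 2]→L[ℝ] ℝ) (x : M) (v w : TangentSpace (𝓡 m) x) :
    chartPullback φ η x ![v, w] = η (φ x) ![chartDeriv φ x v, chartDeriv φ x w] := by
  change η (φ x) (fun i => chartDeriv φ x (![v, w] i)) = _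
  congr 1
  funext i; fin_cases i <;> rfl

/-- For given `h`, being inverse to it is an affine condition on `Ω x`, so the inverses found in
foliated charts glue. -/
theorem IsFoliation.exists_inverse_form [T2Space M] [SecondCountableTopology M] {p : ℕ}
    {h : TwoTensor m M} (hD : IsFoliation p (casimirDistribution h)) (hh : SmoothTensor h)
    (hs : ∀ (x : M) (a b : TangentSpace (𝓡 m) x →L[ℝ] ℝ), a (h x b) = -b (h x a)) :
    ∃ Ω : Form m M 2, SmoothForm Ω ∧ IsTensorOf (casimirDistribution h) Ω h := by
  have : LocallyCompactSpace M := ChartedSpace.locallyCompactSpace (𝔼 m) M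
  suffices h1 : ∃ Ω : Form m M 2, SmoothForm Ω ∧
      ∀ x, Ω x ∈ {η : TangentSpace (𝓡 m) x [⋀^Fin 2]→L[ℝ] ℝ |
        ∀ a, ∀ v ∈ casimirDistribution h x, η ![v, h x a] = a v} by
    obtain ⟨Ω, hΩ, hΩP⟩ := h1
    exact ⟨Ω, hΩ, rfl, hΩP⟩
  refine exists_smoothForm_of_local_one _ (fun x => ?_) fun x₀ => ?_
  · intro η hη η' hη' s t _ _ hst a v hv
    change s * η ![v, h x a] + t * η' ![v, h x a] = a v
    rw [hη a v hv, hη' a v hv, ← add_mul, hst, one_mul]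
  · obtain ⟨φ, hφ, hx, W, -, hW⟩ := hD.exists_chart x₀
    have hrange : ∀ y ∈ φ.target, LinearMap.range (tensorRep φ h y).toLinearMap = W := by
      intro y hy
      have hy' := φ.map_target hy
      ext w
      have h1 := mem_casimirDistribution_iff hφ h hy' (chartDerivInv φ (φ.symm y) w)
      rw [hW _ hy', chartDeriv_chartDerivInv hφ hy', φ.right_inv hy] at h1
      exact h1.symm
    obtain ⟨O, hOt, hO, hxO, η, hη, hηH⟩ := exists_contDiffOn_inverse_form φ.open_target
      (hh.contDiffOn_tensorRep hφ) (fun y _ => tensorRep_skew hs y) hrange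
      (φ.map_source hx)
    refine ⟨φ, hφ, hx, O, hO, hxO, η, hη, fun x hx hxO a v hv => ?_⟩
    rw [chartPullback_apply_two, tensor_apply_eq hφ h hx, hηH _ hxO _ _ ((hW x hx v).1 hv)]
    exact congrArg a (chartDerivInv_chartDeriv hφ hx v)

theorem IsTensorOf.nondegenerate {h : TwoTensor m M} {D : Distribution m M} {Ω : Form m M 2}
    (hΩ : IsTensorOf D Ω h) : LeafwiseNondegenerate D Ω := by
  intro x v hv h0
  refine clm_separates (E := 𝔼 m) fun a => ?_
  have h1 := hΩ.inverse x a v hv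
  rw [h0 _ (hΩ.mem_and_inverse x a).1] at h1
  exact h1.symm.trans (map_zero a).symm

/-- Every leaf vector is a value of `h`, so the values of `dΩ` on triples of leaf vectors are all
Jacobiators. -/
theorem IsFoliation.leafwiseClosed_of_isTensorOf [T2Space M] {p : ℕ} {D : Distribution m M}
    (hD : IsFoliation p D) {h : TwoTensor m M} (hh : IsPoisson h)
    {Ω : Form m M 2} (hΩ : SmoothForm Ω) (hΩh : IsTensorOf D Ω h) :
    LeafwiseClosed p D Ω := by
  rw [hD.leafwiseClosed_iff hΩ]
  intro x v hv
  obtain ⟨φ, hφ, hx, W, -, hW⟩ := hD.exists_chart x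
  have h1 : ∀ i, ∃ a, tensorRep φ h (φ x) a = chartDeriv φ x (v i) := fun i =>
    (mem_casimirDistribution_iff hφ h hx (v i)).1 (by rw [hΩh.range_eq]; exact hv i)
  choose a ha using h1
  have h2 := extD_apply_eq_jacobiator hΩ hh.smooth hh.skew hΩh.mem_and_inverse hφ hW
    (φ.map_source hx) (a 2) (a 1) (a 0)
  rw [hh.jacobiator_eq_zero hφ (φ.map_source hx), neg_zero, ha, ha, ha] at h2
  rw [form_apply_eq hφ _ hx, ← h2]
  congr 1
  funext i; fin_cases i <;> rfl

theorem IsPoisson.exists_isLeafwiseSymplectic [T2Space M] [SecondCountableTopology M]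
    {h : TwoTensor m M} (hh : IsPoisson h) {r : ℕ} (hr : HasConstRank h r) :
    ∃ Ω : Form m M 2, IsLeafwiseSymplectic r (casimirDistribution h) Ω ∧
      IsTensorOf (casimirDistribution h) Ω h ∧
      extD Ω ∈ foliationIdeal (casimirDistribution h) 3 := by
  have hD := hh.isFoliation hr
  obtain ⟨Ω, hΩ, hΩh⟩ := hD.exists_inverse_form hh.smooth hh.skew
  have hc := hD.leafwiseClosed_of_isTensorOf hh hΩ hΩh
  exact ⟨Ω, ⟨hΩ, hc, hΩh.nondegenerate⟩, hΩh, hD.mem_foliationIdeal_iff.2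
    ⟨smoothForm_extD hΩ, (hD.leafwiseClosed_iff hΩ).1 hc⟩⟩

end Symplectic

/-! ### Symplectic bases and the Liouville form -/

section Liouville

/-- The standard symplectic form on `ℝ²`, on basis vectors. -/
def symplecticSign (a b : Fin 2) : ℝ := if a = b then 0 else if a = 0 then 1 else -1

/-- Induction on `n`, splitting off a pair with `B v w = 1`. Subspaces of a fixed space are used so
that passing to the orthogonal complement within `W` leaves the ambient space and `B` unchanged. -/
theorem exists_symplectic_basis {V : Type*} [AddCommGroup V] [Module ℝ V] [FiniteDimensional ℝ V]
    (B : V →ₗ[ℝ] V →ₗ[ℝ] ℝ) (hB : ∀ v, B v v = 0) (n : ℕ) :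
    ∀ W : Submodule ℝ V, Module.finrank ℝ W = 2 * n →
      (∀ v ∈ W, (∀ w ∈ W, B v w = 0) → v = 0) →
      ∃ e : Fin n × Fin 2 → V, (∀ i, e i ∈ W) ∧
        ∀ i j, B (e i) (e j) = if i.1 = j.1 then symplecticSign i.2 j.2 else 0 := by
  have hsk : ∀ v w, B v w = -B w v := fun v w => by
    have h := hB (v + w)
    simp only [map_add, LinearMap.add_apply, hB] at h
    linarith
  induction n with
  | zero => exact fun W _ _ => ⟨fun i => i.1.elim0, fun i => i.1.elim0, fun i => i.1.elim0⟩
  | succ n ih =>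
    intro W hdim hn
    obtain ⟨v, hv, hv0⟩ : ∃ v ∈ W, v ≠ 0 := by
      refine W.exists_mem_ne_zero_of_ne_bot fun h => ?_
      rw [h, finrank_bot] at hdim
      omega
    obtain ⟨w, hw, hvw⟩ : ∃ w ∈ W, B v w = 1 := by
      by_contra! h
      refine hv0 (hn v hv fun w hw => ?_)
      by_contra h0
      refine h ((B v w)⁻¹ • w) (W.smul_mem _ hw) ?_
      rw [map_smul, smul_eq_mul, inv_mul_cancel₀ h0]
    have hwv : B w v = -1 := by rw [hsk, hvw]
    let f : W →ₗ[ℝ] ℝ × ℝ := ((B v).prod (B w)) ∘ₗ W.subtype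
    have hf (u : W) : f u = (B v u, B w u) := rfl
    have hfs : Function.Surjective f := by
      rintro ⟨s, t⟩
      refine ⟨⟨s • w - t • v, W.sub_mem (W.smul_mem _ hw) (W.smul_mem _ hv)⟩, ?_⟩
      rw [hf]
      simp [hB, hvw, hwv]
    let W' : Submodule ℝ V := (LinearMap.ker f).map W.subtype
    have hW' (u : V) : u ∈ W' ↔ u ∈ W ∧ B v u = 0 ∧ B w u = 0 := by
      constructor
      · rintro ⟨u, hu, rfl⟩
        have : f u = 0 := hu
        rw [hf] at this
        exact ⟨u.2, congrArg Prod.fst this, congrArg Prod.snd this⟩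
      · rintro ⟨h1, h2, h3⟩
        exact ⟨⟨u, h1⟩, by
          change f _ = 0
          rw [hf]
          exact Prod.ext h2 h3, rfl⟩
    have hdim' : Module.finrank ℝ W' = 2 * n := by
      have h1 : Module.finrank ℝ W' = Module.finrank ℝ (LinearMap.ker f) :=
        (Submodule.equivMapOfInjective _ W.injective_subtype _).finrank_eq.symm
      have h2 := LinearMap.finrank_range_add_finrank_ker f
      rw [LinearMap.range_eq_top.2 hfs, finrank_top, Module.finrank_prod, Module.finrank_self,
        hdim] at h2
      omega
    obtain ⟨e, heW, he⟩ := ih W' hdim' fun u hu h => by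
      obtain ⟨huW, hvu, hwu⟩ := (hW' u).1 hu
      refine hn u huW fun x hx => ?_
      -- Subtracting the components along `v` and `w` projects `x` to `W'` without changing its
      -- pairing with `u`.
      have h1 : x - B v x • w + B w x • v ∈ W' := by
        refine (hW' _).2 ⟨W.add_mem (W.sub_mem hx (W.smul_mem _ hw)) (W.smul_mem _ hv), ?_, ?_⟩
        · simp [hB, hvw]
        · simp [hB, hwv]
      have h2 := h _ h1
      simp only [map_add, map_sub, map_smul, smul_eq_mul, hsk u v, hsk u w, hvu, hwu] at h2
      simpa using h2
    have hve : ∀ i, B v (e i) = 0 := fun i => ((hW' _).1 (heW i)).2.1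
    have hwe : ∀ i, B w (e i) = 0 := fun i => ((hW' _).1 (heW i)).2.2
    refine ⟨fun p => Fin.cases (![v, w] p.2) (fun i => e (i, p.2)) p.1, ?_, ?_⟩
    · rintro ⟨i, a⟩
      refine Fin.cases ?_ (fun i => ((hW' _).1 (heW (i, a))).1) i
      fin_cases a
      · exact hv
      · exact hw
    · rintro ⟨i, a⟩ ⟨j, b⟩
      induction i using Fin.cases with
      | zero =>
        induction j using Fin.cases with
        | zero => fin_cases a <;> fin_cases b <;> simp [symplecticSign, hB, hvw, hwv]
        | succ j => fin_cases a <;> simp [hve, hwe, (Fin.succ_ne_zero j).symm]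
      | succ i =>
        induction j using Fin.cases with
        | zero => fin_cases b <;> simp [hsk (e _), hve, hwe, Fin.succ_ne_zero i]
        | succ j => simp [he]

/-- A permutation contributing to the Liouville form on a symplectic basis contributes
positively. -/
theorem sign_mul_prod_symplecticSign_nonneg {n : ℕ} (σ : Equiv.Perm (Fin n × Fin 2)) :
    0 ≤ ((Equiv.Perm.sign σ : ℤ) : ℝ) * ∏ i, (if (σ (i, 0)).1 = (σ (i, 1)).1 then
      symplecticSign (σ (i, 0)).2 (σ (i, 1)).2 else 0) := by
  by_cases h : ∀ i, (σ (i, 0)).1 = (σ (i, 1)).1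
  swap
  · push Not at h
    obtain ⟨i, hi⟩ := h
    rw [Finset.prod_eq_zero (Finset.mem_univ i) (if_neg hi), mul_zero]
  have h' : ∀ i c, (σ (i, c)).1 = (σ (i, 0)).1 := fun i c => by
    fin_cases c
    · rfl
    · exact (h i).symm
  have hτ : Function.Bijective fun i => (σ (i, 0)).1 := by
    refine Finite.surjective_iff_bijective.1 fun j => ⟨(σ.symm (j, 0)).1, ?_⟩
    rw [← h' _ (σ.symm (j, 0)).2, Prod.mk.eta, σ.apply_symm_apply]
  have hs : ∀ i, Function.Bijective fun c => (σ (i, c)).2 := fun i => by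
    refine Finite.injective_iff_bijective.1 fun c d hcd => ?_
    have : σ (i, c) = σ (i, d) := Prod.ext ((h' i c).trans (h' i d).symm) hcd
    exact congrArg Prod.snd (σ.injective this)
  let τ : Equiv.Perm (Fin n) := Equiv.ofBijective _ hτ
  let s : Fin n → Equiv.Perm (Fin 2) := fun i => Equiv.ofBijective _ (hs i)
  -- A contributing permutation permutes the pairs by `τ` and acts inside each pair by `s i`. As `τ`
  -- acts on both columns its sign cancels, and the sign of `σ` is exactly the product of symplectic
  -- signs.
  have hσ : σ = Equiv.prodCongrLeft (fun _ => τ) * Equiv.prodCongrRight s := by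
    refine Equiv.ext fun ⟨i, c⟩ => ?_
    exact Prod.ext (h' i c) rfl
  have hsign : Equiv.Perm.sign σ = ∏ i, Equiv.Perm.sign (s i) := by
    rw [hσ, Equiv.Perm.sign_mul, Equiv.Perm.sign_prodCongrLeft, Equiv.Perm.sign_prodCongrRight,
      Fin.prod_univ_two, Int.units_mul_self, one_mul]
  have hsym (π : Equiv.Perm (Fin 2)) :
      symplecticSign (π 0) (π 1) = ((Equiv.Perm.sign π : ℤ) : ℝ) := by
    have : π = 1 ∨ π = Equiv.swap 0 1 := by revert π; decide
    rcases this with rfl | rfl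
    · simp [symplecticSign]
    · rw [Equiv.Perm.sign_swap (by decide)]
      simp [symplecticSign]
  have hp : ∏ i, (if (σ (i, 0)).1 = (σ (i, 1)).1 then
      symplecticSign (σ (i, 0)).2 (σ (i, 1)).2 else 0) = ((Equiv.Perm.sign σ : ℤ) : ℝ) := by
    rw [hsign]
    push_cast
    refine Finset.prod_congr rfl fun i _ => ?_
    rw [if_pos (h i), ← hsym (s i)]
    rfl
  rw [hp]
  exact mul_self_nonneg _

variable {V : Type*} [AddCommGroup V] [Module ℝ V] [TopologicalSpace V]

theorem prod_pairing_update {n : ℕ} [DecidableEq (Fin n × Fin 2)] (η : V [⋀^Fin 2]→L[ℝ] ℝ)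
    (v : Fin n × Fin 2 → V) (p : Fin n × Fin 2) (x : V) :
    ∏ i, η (fun c => Function.update v p x (i, c))
      = η (Function.update (fun c => v (p.1, c)) p.2 x)
        * ∏ i ∈ Finset.univ.erase p.1, η (fun c => v (i, c)) := by
  rw [← Finset.mul_prod_erase _ _ (Finset.mem_univ p.1)]
  congr 1
  · congr 1
    funext c
    simp only [Function.update_apply, Prod.ext_iff, true_and]
  · refine Finset.prod_congr rfl fun i hi => ?_
    congr 1
    funext c
    exact Function.update_of_ne (fun h => (Finset.mem_erase.1 hi).1 (congrArg Prod.fst h)) _ _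

/-- The multilinear map `v ↦ ∏ i, η (v (i, 0), v (i, 1))`. -/
def pairProduct (n : ℕ) (η : V [⋀^Fin 2]→L[ℝ] ℝ) :
    ContinuousMultilinearMap ℝ (fun _ : Fin n × Fin 2 => V) ℝ where
  toFun v := ∏ i, η fun c => v (i, c)
  map_update_add' v p x y := by
    rw [prod_pairing_update, prod_pairing_update, prod_pairing_update, η.map_update_add, add_mul]
  map_update_smul' v p c x := by
    rw [prod_pairing_update, prod_pairing_update, η.map_update_smul, smul_mul_assoc]
  cont := continuous_finsetProd _ fun i _ =>
    η.cont.comp (continuous_pi fun c => continuous_apply (i, c))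

/-- The Liouville form `η ∧ ⋯ ∧ η` (`n` factors, up to a constant). -/
noncomputable def liouvilleForm (n : ℕ) (η : V [⋀^Fin 2]→L[ℝ] ℝ) :
    V [⋀^Fin (2 * n)]→L[ℝ] ℝ where
  toContinuousMultilinearMap :=
    (pairProduct n η).alternatization.toContinuousMultilinearMap.domDomCongr
      (finProdFinEquiv.trans (finCongr (mul_comm n 2)))
  map_eq_zero_of_eq' v i j h hij :=
    (pairProduct n η).alternatization.map_eq_zero_of_eq _
      (i := (finProdFinEquiv.trans (finCongr (mul_comm n 2))).symm i)
      (j := (finProdFinEquiv.trans (finCongr (mul_comm n 2))).symm j)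
      (by
        change v (Equiv.trans _ _ (Equiv.symm _ i)) = v (Equiv.trans _ _ (Equiv.symm _ j))
        rw [Equiv.apply_symm_apply, Equiv.apply_symm_apply, h])
      ((Equiv.injective _).ne hij)

theorem liouvilleForm_apply (n : ℕ) (η : V [⋀^Fin 2]→L[ℝ] ℝ) (v : Fin (2 * n) → V) :
    liouvilleForm n η v = ∑ σ : Equiv.Perm (Fin n × Fin 2), ((Equiv.Perm.sign σ : ℤ) : ℝ) *
      ∏ i, η fun c => v (finCongr (mul_comm n 2) (finProdFinEquiv (σ (i, c)))) := by
  refine (ContinuousMultilinearMap.alternatization_apply_apply _ _).trans ?_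
  refine Finset.sum_congr rfl fun σ _ => ?_
  rw [Units.smul_def, zsmul_eq_mul]
  rfl

/-- On a symplectic basis all terms of the alternating sum are nonnegative, and the identity
permutation contributes `1`. -/
theorem exists_liouvilleForm_ne_zero [FiniteDimensional ℝ V] {n : ℕ} {η : V [⋀^Fin 2]→L[ℝ] ℝ}
    {W : Submodule ℝ V} (hW : Module.finrank ℝ W = 2 * n)
    (hn : ∀ v ∈ W, (∀ w ∈ W, η ![v, w] = 0) → v = 0) :
    ∃ v : Fin (2 * n) → V, (∀ i, v i ∈ W) ∧ liouvilleForm n η v ≠ 0 := by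
  let B : V →ₗ[ℝ] V →ₗ[ℝ] ℝ := LinearMap.mk₂ ℝ (fun v w => η ![v, w])
    (fun v v' w => by
      rw [formPairing_swap, formPairing_swap, formPairing_swap, map_add]; ring)
    (fun c v w => by
      rw [formPairing_swap, formPairing_swap, map_smul, smul_eq_mul, smul_eq_mul]; ring)
    (fun v w w' => by
      rw [← formPairing_apply, map_add, formPairing_apply, formPairing_apply])
    (fun c v w => by
      rw [← formPairing_apply, map_smul, formPairing_apply])
  obtain ⟨e, heW, he⟩ := exists_symplectic_basis B
    (fun v => η.map_eq_zero_of_eq ![v, v] (i := 0) (j := 1) rfl (by simp)) n W hW hn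
  let ε : Fin (2 * n) ≃ Fin n × Fin 2 := (finProdFinEquiv.trans (finCongr (mul_comm n 2))).symm
  refine ⟨fun i => e (ε i), fun i => heW _, ?_⟩
  have h1 : ∀ σ : Equiv.Perm (Fin n × Fin 2), (∏ i, η fun c => e (ε (finCongr (mul_comm n 2)
      (finProdFinEquiv (σ (i, c)))))) = ∏ i, (if (σ (i, 0)).1 = (σ (i, 1)).1 then
      symplecticSign (σ (i, 0)).2 (σ (i, 1)).2 else 0) := by
    intro σ
    refine Finset.prod_congr rfl fun i _ => ?_
    rw [← he]
    change _ = η ![e (σ (i, 0)), e (σ (i, 1))]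
    congr 1
    funext c
    have h2 : ε (finCongr (mul_comm n 2) (finProdFinEquiv (σ (i, c)))) = σ (i, c) :=
      (finProdFinEquiv.trans (finCongr (mul_comm n 2))).symm_apply_apply _
    rw [h2]
    fin_cases c <;> rfl
  rw [liouvilleForm_apply]
  simp only [h1]
  refine ne_of_gt (Finset.sum_pos' (fun σ _ => sign_mul_prod_symplecticSign_nonneg σ)
    ⟨1, Finset.mem_univ _, ?_⟩)
  simp [symplecticSign]

end Liouville

/-! ### Orientation by the Liouville form -/

section Orientation

variable {m : ℕ} {M : Type*} [TopologicalSpace M] [ChartedSpace (EuclideanSpace ℝ (Fin m)) M]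
  [IsManifold (𝓡 m) ∞ M]

theorem smoothForm_liouvilleForm {Ω : Form m M 2} (hΩ : SmoothForm Ω) (n : ℕ) :
    SmoothForm (fun x => liouvilleForm n (Ω x) : Form m M (2 * n)) := by
  rw [smoothForm_iff_pullbackForm] at hΩ ⊢
  intro x
  refine contDiffAt_alternating_iff.2 fun v => ?_
  have h1 := contDiffAt_alternating_iff.1 (hΩ x)
  have h2 : (fun y => pullbackForm (chartAt (𝔼 m) x).symm
      (fun x => liouvilleForm n (Ω x) : Form m M (2 * n)) y v) = fun y =>
      ∑ σ : Equiv.Perm (Fin n × Fin 2), ((Equiv.Perm.sign σ : ℤ) : ℝ) *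
        ∏ i, pullbackForm (chartAt (𝔼 m) x).symm Ω y fun c =>
          v (finCongr (mul_comm n 2) (finProdFinEquiv (σ (i, c)))) :=
    funext fun y => liouvilleForm_apply n (Ω ((chartAt (𝔼 m) x).symm y))
      fun i => mfderiv (𝓡 m) (𝓡 m) (chartAt (𝔼 m) x).symm y (v i)
  rw [h2]
  exact ContDiffAt.sum fun σ _ => contDiffAt_const.mul (contDiffAt_prod fun i _ => h1 _)

theorem IsLeafwiseSymplectic.isOrientable {n : ℕ} {D : Distribution m M} {Ω : Form m M 2}
    (hD : IsFoliation (2 * n) D) (hΩ : IsLeafwiseSymplectic (2 * n) D Ω) :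
    IsOrientable (2 * n) D :=
  ⟨_, smoothForm_liouvilleForm hΩ.smooth n, fun x =>
    exists_liouvilleForm_ne_zero (V := 𝔼 m) (hD.finrank_eq x) (hΩ.nondegenerate x)⟩

end Orientation

end PoissonFoliation

theorem lemma4 {m : ℕ} {M : Type*} [TopologicalSpace M] [T2Space M] [SecondCountableTopology M]
    [ChartedSpace (EuclideanSpace ℝ (Fin m)) M] [IsManifold (𝓡 m) ∞ M] :
    -- a Poisson tensor of constant rank `2n` gives a foliation and a leafwise symplectic form
    (∀ (n : ℕ) (h : TwoTensor m M), IsPoisson h → HasConstRank h (2 * n) →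
      IsFoliation (2 * n) (casimirDistribution h) ∧
      IsOrientable (2 * n) (casimirDistribution h) ∧
      IsDifferentialIdeal (foliationIdeal (casimirDistribution h)) ∧
      (∀ (x : M) (v : TangentSpace (𝓡 m) x), v ∈ casimirDistribution h x ↔
        ∀ θ ∈ foliationIdeal (casimirDistribution h) 1, θ x ![v] = 0) ∧
      ∃ Ω : Form m M 2, IsLeafwiseSymplectic (2 * n) (casimirDistribution h) Ω ∧
        IsTensorOf (casimirDistribution h) Ω h ∧
        extD Ω ∈ foliationIdeal (casimirDistribution h) 3) ∧
    -- conversely, a foliation with a leafwise symplectic form defines a Poisson tensor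
    (∀ (p : ℕ) (D : Distribution m M) (Ω : Form m M 2), IsFoliation p D →
      IsLeafwiseSymplectic p D Ω →
      ∃! h : TwoTensor m M, IsTensorOf D Ω h ∧ IsPoisson h ∧ HasConstRank h p) ∧
    -- two 2-forms define the same tensor exactly when they differ by an element of the ideal
    (∀ (p : ℕ) (D : Distribution m M) (Ω Ω' : Form m M 2), IsFoliation p D →
      IsLeafwiseSymplectic p D Ω → SmoothForm Ω' →
      ((IsLeafwiseSymplectic p D Ω' ∧
          ∃ h : TwoTensor m M, IsPoisson h ∧ IsTensorOf D Ω h ∧ IsTensorOf D Ω' h) ↔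
        Ω' - Ω ∈ foliationIdeal D 2)) := by
  refine ⟨fun n h hh hr => ?_, fun p D Ω hD hΩ => hD.existsUnique_isTensorOf hΩ,
    fun p D Ω Ω' hD hΩ hΩ' => hD.same_tensor_iff hΩ hΩ'⟩
  have hD := hh.isFoliation hr
  obtain ⟨Ω, hΩ, hΩh, hΩI⟩ := hh.exists_isLeafwiseSymplectic hr
  exact ⟨hD, hΩ.isOrientable hD, hD.isDifferentialIdeal, hD.mem_iff_foliationIdeal,
    Ω, hΩ, hΩh, hΩI⟩
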